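/- Let $n\ge 2$, $r>0$, let $B_r\subset\mathbb R^n$ be the open ball of radius $r$ centred at the origin, and let $u\in C^4(B_r)$ be a convex function with graph $M=\{X(x)=(x,u(x)) : x\in B_r\}\subset\mathbb R^{n+1}$. Let $\nu=(\nabla u,-1)/\sqrt{1+|\nabla u|^2}$ be its outer unit normal and $\kappa_1(x),\dots,\kappa_n(x)$ its principal curvatures at $X(x)$ with respect to $\nu$ (so that $\kappa_i\ge 0$), i.e. the eigenvalues of the second fundamental form relative to the first. Let $f=f(X,\nu)$ be a function of class $C^2$ on $(B_r\times\mathbb R)\times\mathbb S^n$, and suppose that $M$ solves the prescribed scalar curvature equation $$\sigma_2(\kappa_1(x),\dots,\kappa_n(x))=\sum_{i<j}\kappa_i(x)\kappa_j(x)=f(X(x),\nu(x))>0\qquad\text{for all }x\in B_r .$$ Then $$\max_{x\in \overline{B_{r/2}}}|\kappa_i(x)|\le C,\qquad i=1,\dots,n,$$ where the constant $C$ depends only on $n$, $r$ and upper bounds for $\|M\|_{C^1(B_r)}=\sup_{B_r}|u|+\sup_{B_r}|\nabla u|$, for $\|f\|_{C^2(B_r)}$ (the sum of the suprema over $x\in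 B_r$ of the norms of the derivatives of $f$ in both variables, of orders $0,1,2$, at the points $(X(x),\nu(x))$) and for $\|1/f\|_{L^\infty(B_r)}=\sup_{x\in B_r} 1/f(X(x),\nu(x))$. The derivatives of $f$ are those of its extension $f(X,p/|p|)$, $p\neq 0$, homogeneous of degree $0$ in the second variable. -/

import Mathlib

open Metric
open scoped ENNReal NNReal

noncomputable section

namespace CurvEst

/-- The base space `ℝⁿ`. -/
abbrev Base (n : ℕ) := EuclideanSpace ℝ (Fin n)

/-- The ambient Euclidean space `ℝⁿ⁺¹`. -/
abbrev Ambient (n : ℕ) := EuclideanSpace ℝ (Fin (n + 1))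

/-- The unit sphere `𝕊ⁿ ⊂ ℝⁿ⁺¹`. -/
abbrev UnitSphere (n : ℕ) := sphere (0 : Ambient n) 1

variable {n : ℕ}

/-- The vector `(v, t) ∈ ℝⁿ⁺¹ = ℝⁿ × ℝ`. -/
def pair (v : Base n) (t : ℝ) : Ambient n :=
  WithLp.toLp 2 (Fin.snoc (α := fun _ => ℝ) (fun i => v i) t)

/-- The projection `ℝⁿ⁺¹ = ℝⁿ × ℝ → ℝⁿ`. -/
def horiz (X : Ambient n) : Base n := WithLp.toLp 2 fun i => X i.castSucc

/-- The position vector `X(x) = (x, u(x))` of the graph of `u`. -/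
def position (u : Base n → ℝ) (x : Base n) : Ambient n := pair x (u x)

/-- The (non-normalized) downward normal vector `(∇u(x), -1)` of the graph of `u`. -/
def rawNormal (u : Base n → ℝ) (x : Base n) : Ambient n := pair (gradient u x) (-1)

theorem rawNormal_ne_zero (u : Base n → ℝ) (x : Base n) : rawNormal u x ≠ 0 := by
  intro h
  have h2 : rawNormal u x (Fin.last n) = (0 : Ambient n) (Fin.last n) := by rw [h]
  simp [rawNormal, pair] at h2

/-- Radial projection of a nonzero vector of `ℝⁿ⁺¹` to the unit sphere. -/
def toSphere (p : Ambient n) (hp : p ≠ 0) : UnitSphere n :=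
  ⟨‖p‖⁻¹ • p, by
    rw [mem_sphere_zero_iff_norm, norm_smul, norm_inv, norm_norm]
    exact inv_mul_cancel₀ (norm_ne_zero_iff.mpr hp)⟩

/-- The outer unit normal `ν(x) = (∇u, -1) / √(1 + |∇u|²)` of the graph of (a convex) `u`, i.e. the
unit normal that points out of the epigraph. -/
def normal (u : Base n → ℝ) (x : Base n) : UnitSphere n :=
  toSphere (rawNormal u x) (rawNormal_ne_zero u x)

/-- The `i`-th coordinate vector of `ℝⁿ`. -/
def coordVec (i : Fin n) : Base n := EuclideanSpace.single i (1 : ℝ)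

/-- First fundamental form of the graph in the coordinates `x`: `g_ij = ⟨∂ᵢX, ∂ⱼX⟩`. -/
def firstForm (u : Base n → ℝ) (x : Base n) : Matrix (Fin n) (Fin n) ℝ :=
  Matrix.of fun i j =>
    inner ℝ (fderiv ℝ (position u) x (coordVec i)) (fderiv ℝ (position u) x (coordVec j))

/-- Second fundamental form of the graph in the coordinates `x`, with respect to the outer normal:
`h_ij = -⟨∂ᵢ∂ⱼX, ν⟩` (Gauss formula `X_ij = -h_ij ν`). -/
def secondForm (u : Base n → ℝ) (x : Base n) : Matrix (Fin n) (Fin n) ℝ :=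
  Matrix.of fun i j =>
    -inner ℝ (iteratedFDeriv ℝ 2 (position u) x ![coordVec i, coordVec j])
      (normal u x : Ambient n)

/-- The matrix `g⁻¹ h` of the Weingarten map (shape operator). The matrix `g` is positive definite,
hence invertible, wherever `u` is differentiable. -/
def weingarten (u : Base n → ℝ) (x : Base n) : Matrix (Fin n) (Fin n) ℝ :=
  (firstForm u x)⁻¹ * secondForm u x

/-- The principal curvatures `κ₁, …, κₙ` of the graph of `u` at `X(x)`, listed with multiplicity:
the eigenvalues of the Weingarten map (all real, as it is self-adjoint with respect to `g`). -/
def principalCurvatures (u : Base n → ℝ) (x : Base n) : Multiset ℝ :=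
  (weingarten u x).charpoly.roots

/-- Second elementary symmetric function `σ₂(κ) = ∑_{i<j} κᵢ κⱼ` of the principal curvatures. -/
def sigmaTwo (u : Base n → ℝ) (x : Base n) : ℝ := (principalCurvatures u x).esymm 2

open Classical in
/-- The extension of a function `f(X, ν)` on `ℝⁿ⁺¹ × 𝕊ⁿ`, homogeneous of degree `0` in the second
variable, to `ℝⁿ⁺¹ × (ℝⁿ⁺¹ ∖ {0})` (and by the irrelevant value `0` where `p = 0`). A function on
`ℝⁿ⁺¹ × 𝕊ⁿ` is of class `C²` iff this extension is, and the derivatives of the extension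
at points `(X, ν)`, `|ν| = 1`, encode those of `f`. -/
def homExt (f : Ambient n → UnitSphere n → ℝ) (q : Ambient n × Ambient n) : ℝ :=
  if hp : q.2 ≠ 0 then f q.1 (toSphere q.2 hp) else 0

/-- `f` is of class `C²` on `(B_r × ℝ) × 𝕊ⁿ`. -/
def IsC2 (r : ℝ) (f : Ambient n → UnitSphere n → ℝ) : Prop :=
  ContDiffOn ℝ 2 (homExt f) {q | horiz q.1 ∈ ball (0 : Base n) r ∧ q.2 ≠ 0}

/-- `‖M‖_{C¹(B_r)} = sup_{B_r} |u| + sup_{B_r} |∇u|` for the graph `M` of `u` (possibly `∞`). -/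
def normC1 (r : ℝ) (u : Base n → ℝ) : ℝ≥0∞ :=
  (⨆ x ∈ ball (0 : Base n) r, ‖u x‖ₑ) + ⨆ x ∈ ball (0 : Base n) r, ‖gradient u x‖ₑ

/-- `‖f‖_{C²(B_r)}`: the sum over `k ≤ 2` of the suprema over `x ∈ B_r` of the norms of the `k`-th
derivatives of `f` (in both variables) at `(X(x), ν(x))` (possibly `∞`). -/
def normC2 (r : ℝ) (u : Base n → ℝ) (f : Ambient n → UnitSphere n → ℝ) : ℝ≥0∞ :=
  ∑ k ∈ Finset.range 3, ⨆ x ∈ ball (0 : Base n) r,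
    ‖iteratedFDeriv ℝ k (homExt f) (position u x, (normal u x : Ambient n))‖ₑ

/-- `‖1/f‖_{L^∞(B_r)}`: the supremum over `x ∈ B_r` of `|1/f|` at `(X(x), ν(x))` (possibly `∞`). -/
def normInv (r : ℝ) (u : Base n → ℝ) (f : Ambient n → UnitSphere n → ℝ) : ℝ≥0∞ :=
  ⨆ x ∈ ball (0 : Base n) r, ‖1 / f (position u x) (normal u x)‖ₑ

/-- The graph of `u` over `B_r` solves the prescribed scalar curvature equation
`σ₂(κ) = f(X, ν) > 0`. -/
def SolvesScalarCurvatureEq (r : ℝ) (u : Base n → ℝ) (f : Ambient n → UnitSphere n → ℝ) : Prop :=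
  ∀ x ∈ ball (0 : Base n) r,
    sigmaTwo u x = f (position u x) (normal u x) ∧ 0 < f (position u x) (normal u x)

end CurvEst

end

/-! ### Arithmetic of the eigenvalues of a convex solution. -/

namespace CurvEst

open Finset

/-! Let W = √(1 + |∇u|²), let λᵢ be the eigenvalues of g⁻¹D²u and H = Σ λᵢ. Convexity gives λᵢ ≥ 0,
and κᵢ = λᵢ/W with W ≥ 1, so a bound for H suffices. In these terms the equation is H² - Σ λᵢ² =
2W²f, and its linearization has the coefficients Fᵢ = H - λᵢ in a diagonalizing frame. Nonnegativity
makes the degeneracy explicit: for large H a single eigenvalue λ_{i₀} is comparable to H and the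
others are O(1/H), so F_{i₀} is of order 1/H while the other Fⱼ are of order H (`Spectrum`).

The first ingredient is a Jacobi inequality, Σ Fₖ Hₖₖ ≥ (5/4) Σ Fₖ Hₖ²/H - C H²
(`jacobi_of_equationJet`). The equation is differentiated twice along an orthonormal frame. Fourth
derivatives cancel by symmetry, and what remains is a quadratic form in third derivatives, bounded
below on the hyperplane prescribed by the once differentiated equation (`sum_second_trace_ge`,
`jacobiTerm_ge`). Since 5/4 > 1, log H is a subsolution with a positive gradient term to spare.

The second ingredient is the maximum principle for ρ² exp(βΦ) log H, where ρ = R² - |x - x₀|² and Φ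
= ½|∇u|² + K(⟨x - x₀, ∇u⟩ - u). The derivative of Φ along the k-th frame vector carries the factor
λₖ, and Σ Fₖ Φₖₖ contains Σ Fₖ λₖ², which is at least cH. At an interior maximum near x₀ this term,
multiplied by a large β, beats all errors. Where ρ ≤ R²/2, the critical point equation makes some
component of ∇(log log H) large, and the spare gradient term wins. Either way ρ² log H is bounded
(`exists_weight`), and comparison with the value at x₀ bounds H(x₀) (`exists_traceHess_le`). -/

/-- Pointwise spectral data of a convex solution: nonnegative numbers `lam i` with
`σ₂(lam) = Psi ∈ [m, M]`, the index `i₀` being one of a largest entry. -/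
structure Spectrum {ι : Type*} [Fintype ι] (m M : ℝ) (lam : ι → ℝ) (i₀ : ι) (H : ℝ) : Prop where
  m_pos : 0 < m
  nonneg : ∀ i, 0 ≤ lam i
  le_max : ∀ i, lam i ≤ lam i₀
  sum_eq : ∑ i, lam i = H
  lower : 2 * m ≤ H ^ 2 - ∑ i, lam i ^ 2
  upper : H ^ 2 - ∑ i, lam i ^ 2 ≤ 2 * M

namespace Spectrum

variable {ι : Type*} [Fintype ι] {m M H : ℝ} {lam : ι → ℝ} {i₀ : ι}

theorem le_H (h : Spectrum m M lam i₀ H) (i : ι) : lam i ≤ H := by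
  rw [← h.sum_eq]
  exact single_le_sum (fun j _ => h.nonneg j) (mem_univ i)

open Classical in
theorem add_le_H (h : Spectrum m M lam i₀ H) {i j : ι} (hij : i ≠ j) : lam i + lam j ≤ H := by
  rw [← h.sum_eq, ← sum_pair hij]
  exact sum_le_sum_of_subset_of_nonneg (subset_univ _) fun k _ _ => h.nonneg k

theorem H_nonneg (h : Spectrum m M lam i₀ H) : 0 ≤ H := (h.nonneg i₀).trans (h.le_H i₀)

theorem M_pos (h : Spectrum m M lam i₀ H) : 0 < M := by
  have := h.m_pos; have := h.lower; have := h.upper; linarith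

theorem H_pos (h : Spectrum m M lam i₀ H) : 0 < H := by
  have h1 := h.lower
  have h2 : 0 ≤ ∑ i, lam i ^ 2 := sum_nonneg fun i _ => sq_nonneg _
  have h3 := h.m_pos
  have h4 := h.H_nonneg
  by_contra hc
  have : H = 0 := le_antisymm (not_lt.mp hc) h4
  rw [this] at h1
  nlinarith

theorem H_le (h : Spectrum m M lam i₀ H) : H ≤ Fintype.card ι * lam i₀ := by
  rw [← h.sum_eq]
  calc ∑ i, lam i ≤ ∑ _i : ι, lam i₀ := sum_le_sum fun i _ => h.le_max i
    _ = _ := by simp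

theorem sum_mul_eq (h : Spectrum m M lam i₀ H) :
    ∑ i, (H - lam i) * lam i = H ^ 2 - ∑ i, lam i ^ 2 := by
  simp only [sub_mul, sum_sub_distrib, ← mul_sum, h.sum_eq]
  simp only [sq]

theorem F_nonneg (h : Spectrum m M lam i₀ H) (i : ι) : 0 ≤ H - lam i := by
  have := h.le_H i; linarith

theorem F_mul_le (h : Spectrum m M lam i₀ H) (i : ι) : (H - lam i) * lam i ≤ 2 * M := by
  refine le_trans ?_ h.upper
  rw [← h.sum_mul_eq]
  exact single_le_sum (f := fun i => (H - lam i) * lam i)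
    (fun j _ => mul_nonneg (h.F_nonneg j) (h.nonneg j)) (mem_univ i)

-- Since Fᵢ ≥ λⱼ and Fⱼ ≥ λᵢ, the i and j terms of Σ Fₖ λₖ ≤ 2M already contribute 2 λᵢ λⱼ.
open Classical in
theorem mul_le (h : Spectrum m M lam i₀ H) {i j : ι} (hij : i ≠ j) : lam i * lam j ≤ M := by
  have h1 := h.upper
  rw [← h.sum_mul_eq] at h1
  have h2 : ∑ k ∈ {i, j}, (H - lam k) * lam k ≤ ∑ k, (H - lam k) * lam k :=
    sum_le_sum_of_subset_of_nonneg (subset_univ _)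
      fun k _ _ => mul_nonneg (h.F_nonneg k) (h.nonneg k)
  rw [sum_pair hij] at h2
  have h3 := h.add_le_H hij
  nlinarith [h.nonneg i, h.nonneg j]

/-- The largest eigenvalue is at least H/N, so F_{i₀} λ_{i₀} ≤ 2M makes F_{i₀} of order at most 1/H.
With `le_gap`, all other eigenvalues are O(1/H). -/
theorem gap_mul_le (h : Spectrum m M lam i₀ H) : (H - lam i₀) * H ≤ Fintype.card ι * (2 * M) := by
  have h1 := h.F_mul_le i₀
  have h2 := h.H_le
  have h3 := h.F_nonneg i₀
  have h4 : (0 : ℝ) ≤ Fintype.card ι := by positivity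
  nlinarith

/-- From 2m ≤ H² - λ_{i₀}² = (H - λ_{i₀})(H + λ_{i₀}) ≤ 2H(H - λ_{i₀}): the degeneracy of F_{i₀} is
no worse than 1/H. -/
theorem le_gap_mul (h : Spectrum m M lam i₀ H) : m ≤ (H - lam i₀) * H := by
  have h1 := h.lower
  have h2 : lam i₀ ^ 2 ≤ ∑ i, lam i ^ 2 :=
    single_le_sum (f := fun i => lam i ^ 2) (fun j _ => sq_nonneg _) (mem_univ i₀)
  have h3 := h.le_H i₀
  nlinarith [h.nonneg i₀]

theorem le_F_mul (h : Spectrum m M lam i₀ H) (i : ι) : m ≤ (H - lam i) * H := by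
  have h1 := h.le_gap_mul
  have h2 := h.le_max i
  nlinarith [h.H_nonneg]

theorem le_gap (h : Spectrum m M lam i₀ H) {j : ι} (hj : j ≠ i₀) : lam j ≤ H - lam i₀ := by
  have := h.add_le_H hj; linarith

/-- Here Fⱼ ≥ λ_{i₀} ≥ H/N: every direction other than i₀ has full ellipticity. -/
theorem H_le_F (h : Spectrum m M lam i₀ H) {j : ι} (hj : j ≠ i₀) :
    H ≤ Fintype.card ι * (H - lam j) := by
  have h1 := h.H_le
  have h2 := h.le_gap hj
  have h4 : (0 : ℝ) ≤ Fintype.card ι := by positivity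
  nlinarith

theorem sum_F (h : Spectrum m M lam i₀ H) :
    ∑ i, (H - lam i) ≤ Fintype.card ι * H := by
  rw [sum_sub_distrib, h.sum_eq]
  have := h.H_nonneg
  simp [this]

/-- The i₀ term alone suffices: F_{i₀} ≥ m/H and λ_{i₀} ≥ H/N. This is the good term that the weight
Φ supplies. -/
theorem le_sum_F_mul_sq (h : Spectrum m M lam i₀ H) :
    m / (Fintype.card ι) ^ 2 * H ≤ ∑ i, (H - lam i) * lam i ^ 2 := by
  have h0 := h.H_pos
  have h1 : (H - lam i₀) * lam i₀ ^ 2 ≤ ∑ i, (H - lam i) * lam i ^ 2 :=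
    single_le_sum (f := fun i => (H - lam i) * lam i ^ 2)
      (fun j _ => mul_nonneg (h.F_nonneg j) (sq_nonneg _)) (mem_univ i₀)
  refine le_trans ?_ h1
  have hN : (0 : ℝ) < Fintype.card ι := by
    have : 0 < Fintype.card ι := Fintype.card_pos_iff.mpr ⟨i₀⟩
    exact_mod_cast this
  rw [div_mul_eq_mul_div, div_le_iff₀ (by positivity)]
  have h2 := h.le_gap_mul
  have h3 := h.H_le
  have h4 : H ^ 2 ≤ (Fintype.card ι * lam i₀) ^ 2 := pow_le_pow_left₀ h.H_nonneg h3 2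
  have h5 := h.F_nonneg i₀
  calc m * H ≤ (H - lam i₀) * H * H := by gcongr
    _ = (H - lam i₀) * H ^ 2 := by ring
    _ ≤ (H - lam i₀) * (Fintype.card ι * lam i₀) ^ 2 := by gcongr
    _ = _ := by ring

end Spectrum

/-! ### The quadratic form of the Jacobi inequality on the constraint hyperplane. -/

theorem two_mul_le_of_pos {k : ℝ} (hk : 0 < k) (a b : ℝ) : 2 * a * b ≤ k * a ^ 2 + b ^ 2 / k := by
  have h : k * a ^ 2 + b ^ 2 / k - 2 * a * b = k * (a - b / k) ^ 2 := by
    field_simp; ring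
  have : 0 ≤ k * (a - b / k) ^ 2 := by positivity
  linarith

set_option maxHeartbeats 1000000 in
/-- The contribution of the direction of the large principal curvature to the Jacobi
inequality, with `τ = t / H` and `σ = s H` for the slots `t`, `s` of the quadratic form. -/
theorem jacobi_large {m M' C : ℝ} (hm : 0 < m) (hM : m ≤ M') (hC : 0 ≤ C) :
    ∃ C' H₀ : ℝ, 0 ≤ C' ∧ 1 ≤ H₀ ∧ ∀ H σ l τ T ell Y D p c : ℝ, H₀ ≤ H → m ≤ σ → σ ≤ M' →
      0 ≤ l → l ≤ H → H * T = H * D - σ * τ + ell → H ^ 2 * ell ^ 2 ≤ σ ^ 2 * Y → |D| ≤ C →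
      |p| ≤ 1 → |c| ≤ C → 0 ≤ Y →
      -(C' * H ^ 2) ≤ 3 * Y - 2 * (H * τ) * T - T ^ 2 - 2 * p * l * (ell + l * T)
        + c * (H * τ + T) - 5 / 4 * (σ / H ^ 2) * (H * τ + T) ^ 2 := by
  have hM0 : 0 < M' := hm.trans_le hM
  -- The first constant collects the H² errors of `b1` to `b5` below; the threshold makes H² exceed
  -- 100M'²/m, 100M'² and 100M'.
  refine ⟨16 * C ^ 2 / m + 16 * M' ^ 2 / m + 4 * C ^ 2 / m + 2 * C + 8 * M' ^ 2 + 10 * C ^ 2,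
    1 + 100 * M' ^ 2 / m + 100 * M' ^ 2 + 100 * M', by positivity, ?_, ?_⟩
  · have : 0 ≤ 100 * M' ^ 2 / m + 100 * M' ^ 2 + 100 * M' := by positivity
    linarith
  intro H σ l τ T ell Y D p c hH hσ hσM hl hlH hT hell hD hp hc hY
  have hH1 : 1 + 100 * M' ^ 2 / m + 100 * M' ^ 2 + 100 * M' ≤ H ^ 2 := by
    have : 0 ≤ 100 * M' ^ 2 / m + 100 * M' ^ 2 + 100 * M' := by positivity
    exact hH.trans (le_self_pow₀ (by linarith) two_ne_zero)
  have e1 : 0 ≤ 100 * M' ^ 2 / m := by positivity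
  have e2 : 0 ≤ 100 * M' ^ 2 := by positivity
  have hHone : 1 ≤ H := by linarith
  have hH0 : 0 < H := by linarith
  have hHsq : 1 ≤ H ^ 2 := one_le_pow₀ hHone
  have hσ0 : 0 < σ := by linarith
  have hσsq : σ ^ 2 ≤ M' ^ 2 := pow_le_pow_left₀ hσ0.le hσM 2
  have g1 : 100 * M' ^ 2 ≤ H ^ 2 := by linarith
  have g2 : 100 * M' ^ 2 ≤ m * H ^ 2 := by
    have : 100 * M' ^ 2 / m ≤ H ^ 2 := by linarith
    rw [div_le_iff₀ hm] at this; linarith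
  have g3 : 100 * M' ≤ H ^ 2 := by linarith
  have hellM : H ^ 2 * ell ^ 2 ≤ M' ^ 2 * Y := hell.trans (by gcongr)
  have hell1 : 100 * ell ^ 2 ≤ Y := by
    by_contra hcon
    push Not at hcon
    have : 100 * M' ^ 2 * ell ^ 2 ≤ H ^ 2 * ell ^ 2 := by gcongr
    have h3 : M' ^ 2 * Y < M' ^ 2 * (100 * ell ^ 2) := by gcongr
    linarith
  have hell2 : 100 * ell ^ 2 ≤ m * Y := by
    by_contra hcon
    push Not at hcon
    have : 100 * M' ^ 2 * ell ^ 2 ≤ m * H ^ 2 * ell ^ 2 := by gcongr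
    have h3 : M' ^ 2 * (m * Y) < M' ^ 2 * (100 * ell ^ 2) := by gcongr
    have h4 : m * (H ^ 2 * ell ^ 2) ≤ m * (M' ^ 2 * Y) := by gcongr
    linarith only [this, h3, h4]
  have hDabs := abs_le.mp hD
  have hDsq : D ^ 2 ≤ C ^ 2 := sq_le_sq' hDabs.1 hDabs.2
  -- The constraint gives T = D + e with e of order 1/H, so T is bounded up to small multiples of √Y
  -- and √m·τ.
  set e := (ell - σ * τ) / H with he
  have hTe : T = D + e := by
    rw [he]; field_simp; linarith
  have heH : H * e = ell - σ * τ := by rw [he]; field_simp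
  have hesq : e ^ 2 ≤ Y / 50 + m * τ ^ 2 / 50 := by
    have h1 : H ^ 2 * e ^ 2 ≤ 2 * ell ^ 2 + 2 * (σ ^ 2 * τ ^ 2) := by
      have : H ^ 2 * e ^ 2 = (ell - σ * τ) ^ 2 := by rw [← heH]; ring
      rw [this]; linarith only [sq_nonneg (ell + σ * τ)]
    have h2 : σ ^ 2 * τ ^ 2 ≤ M' ^ 2 * τ ^ 2 := by gcongr
    have h3 : 100 * (M' ^ 2 * τ ^ 2) ≤ m * H ^ 2 * τ ^ 2 := by
      have : 100 * M' ^ 2 * τ ^ 2 ≤ m * H ^ 2 * τ ^ 2 := by gcongr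
      linarith only [this]
    have h4 : Y ≤ H ^ 2 * Y := le_mul_of_one_le_left hY hHsq
    have h5 : H ^ 2 * e ^ 2 ≤ H ^ 2 * (Y / 50 + m * τ ^ 2 / 50) := by linarith only [h1, h2, h3, h4, hell1]
    exact le_of_mul_le_mul_left h5 (by positivity)
  have hTsq : T ^ 2 ≤ 2 * C ^ 2 + Y / 25 + m * τ ^ 2 / 25 := by
    rw [hTe]; linarith only [sq_nonneg (D - e), hesq, hDsq]
  have hτm : m * τ ^ 2 ≤ σ * τ ^ 2 := by gcongr
  -- The decisive sign: by the constraint, -2tT contributes +2στ². It must absorb the (5/4)στ² of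
  -- the gradient term and all errors in τ².
  have main : 2 * (H * τ) * T = 2 * H * τ * D + 2 * τ * ell - 2 * σ * τ ^ 2 := by
    have : 2 * (H * τ) * T = 2 * τ * (H * T) := by ring
    rw [this, hT]; ring
  have b1 : 2 * H * τ * D ≤ m * τ ^ 2 / 16 + 16 * C ^ 2 / m * H ^ 2 := by
    have h1 := two_mul_le_of_pos (k := m / 16) (by positivity) τ (D * H)
    have h2 : (D * H) ^ 2 / (m / 16) ≤ (C ^ 2 * H ^ 2) / (m / 16) := by
      rw [mul_pow]; gcongr
    have h3 : (C ^ 2 * H ^ 2) / (m / 16) = 16 * C ^ 2 / m * H ^ 2 := by field_simp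
    linarith
  have b2 : 2 * τ * ell ≤ m * τ ^ 2 / 16 + Y / 4 := by
    have h1 := two_mul_le_of_pos (k := m / 16) (by positivity) τ ell
    have h2 : ell ^ 2 / (m / 16) ≤ Y / 4 := by
      have hmY : 0 ≤ m * Y := by positivity
      rw [div_le_iff₀ (by positivity)]; linarith
    linarith
  have hHell : 2 * H * |ell| ≤ Y / 4 + 4 * M' ^ 2 := by
    have h1 := two_mul_le_of_pos (k := 4 * M' ^ 2) (by positivity) 1 (H * |ell|)
    have h2 : (H * |ell|) ^ 2 / (4 * M' ^ 2) ≤ Y / 4 := by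
      rw [div_le_iff₀ (by positivity), mul_pow, sq_abs]; linarith
    linarith
  have hHτ : 2 * H * M' * |τ| ≤ m * τ ^ 2 / 16 + 16 * M' ^ 2 / m * H ^ 2 := by
    have h1 := two_mul_le_of_pos (k := m / 16) (by positivity) |τ| (M' * H)
    have h3 : (M' * H) ^ 2 / (m / 16) = 16 * M' ^ 2 / m * H ^ 2 := by field_simp
    rw [sq_abs] at h1
    linarith
  have hHT : H * |T| ≤ H * C + |ell| + M' * |τ| := by
    have : H * |T| = |H * D - σ * τ + ell| := by rw [← hT, abs_mul, abs_of_pos hH0]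
    rw [this]
    have k1 : |H * D| ≤ H * C := by rw [abs_mul, abs_of_pos hH0]; gcongr
    have k2 : |σ * τ| ≤ M' * |τ| := by rw [abs_mul, abs_of_pos hσ0]; gcongr
    have k3 := abs_add_le (H * D - σ * τ) ell
    have k4 := abs_sub (H * D) (σ * τ)
    linarith
  have b3 : 2 * p * l * (ell + l * T) ≤ 2 * C * H ^ 2 + Y / 2 + 8 * M' ^ 2 + m * τ ^ 2 / 16
      + 16 * M' ^ 2 / m * H ^ 2 := by
    have h1 : 2 * p * l * (ell + l * T) ≤ 2 * H * (|ell| + H * |T|) := by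
      calc 2 * p * l * (ell + l * T) ≤ |2 * p * l * (ell + l * T)| := le_abs_self _
        _ = 2 * |p| * l * |ell + l * T| := by
            rw [abs_mul, abs_mul, abs_mul, abs_of_nonneg hl]; simp
        _ ≤ 2 * 1 * H * (|ell| + H * |T|) := by
            gcongr
            calc |ell + l * T| ≤ |ell| + |l * T| := abs_add_le _ _
              _ ≤ |ell| + H * |T| := by rw [abs_mul, abs_of_nonneg hl]; gcongr
        _ = _ := by ring
    have h2 : 2 * H * (|ell| + H * |T|) ≤ 2 * H * (|ell| + (H * C + |ell| + M' * |τ|)) := by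
      gcongr
    linarith only [h1, h2, hHell, hHτ]
  have b4 : -(c * (H * τ + T)) ≤ m * τ ^ 2 / 16 + 4 * C ^ 2 / m * H ^ 2 + C ^ 2 + T ^ 2 := by
    have hcabs := abs_le.mp hc
    have hcsq : c ^ 2 ≤ C ^ 2 := sq_le_sq' hcabs.1 hcabs.2
    have h1 := two_mul_le_of_pos (k := m / 16) (by positivity) τ (-(c * H) / 2)
    have h2 : (-(c * H) / 2) ^ 2 / (m / 16) ≤ 4 * C ^ 2 / m * H ^ 2 := by
      have : (-(c * H) / 2) ^ 2 / (m / 16) = 4 * c ^ 2 / m * H ^ 2 := by field_simp; ring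
      rw [this]; gcongr
    have h3 : -(c * T) ≤ c ^ 2 + T ^ 2 := by
      linarith only [sq_nonneg (c + T), sq_nonneg c, sq_nonneg T]
    have h4 : -(c * (H * τ + T)) = 2 * τ * (-(c * H) / 2) + -(c * T) := by ring
    linarith
  -- Splitting the square with the factor 6/5 costs (3/2)στ², which leaves στ²/2 ≥ mτ²/2 for the
  -- remaining errors.
  have b5 : 5 / 4 * (σ / H ^ 2) * (H * τ + T) ^ 2 ≤ 3 / 2 * σ * τ ^ 2 + T ^ 2 := by
    have h1 : (H * τ + T) ^ 2 ≤ 6 / 5 * (H ^ 2 * τ ^ 2) + 6 * T ^ 2 := by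
      linarith only [sq_nonneg (H * τ - 5 * T)]
    have h2 : 5 / 4 * (σ / H ^ 2) * (H * τ + T) ^ 2
        ≤ 5 / 4 * (σ / H ^ 2) * (6 / 5 * (H ^ 2 * τ ^ 2) + 6 * T ^ 2) := by gcongr
    have h3 : 5 / 4 * (σ / H ^ 2) * (6 / 5 * (H ^ 2 * τ ^ 2) + 6 * T ^ 2)
        = 3 / 2 * σ * τ ^ 2 + 15 / 2 * (σ / H ^ 2) * T ^ 2 := by field_simp; ring
    have h4 : σ / H ^ 2 ≤ 1 / 100 := by
      rw [div_le_div_iff₀ (by positivity) (by norm_num)]; linarith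
    have h5 : (σ / H ^ 2) * T ^ 2 ≤ 1 / 100 * T ^ 2 := by gcongr
    linarith only [h2, h3, h5, sq_nonneg T]
  have hC2 : 10 * C ^ 2 ≤ 10 * C ^ 2 * H ^ 2 := le_mul_of_one_le_right (by positivity) hHsq
  have hM2 : 8 * M' ^ 2 ≤ 8 * M' ^ 2 * H ^ 2 := le_mul_of_one_le_right (by positivity) hHsq
  have hmτ : 0 ≤ m * τ ^ 2 := by positivity
  have expand : (16 * C ^ 2 / m + 16 * M' ^ 2 / m + 4 * C ^ 2 / m + 2 * C + 8 * M' ^ 2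
      + 10 * C ^ 2) * H ^ 2 = 16 * C ^ 2 / m * H ^ 2 + 16 * M' ^ 2 / m * H ^ 2
      + 4 * C ^ 2 / m * H ^ 2 + 2 * C * H ^ 2 + 8 * M' ^ 2 * H ^ 2 + 10 * C ^ 2 * H ^ 2 := by ring
  rw [expand, main]
  linarith only [b1, b2, b3, b4, b5, hTsq, hC2, hM2, hmτ, hτm, hY, sq_nonneg C]

/-- The contribution of the remaining directions to the Jacobi inequality. -/
theorem jacobi_small {m M' C : ℝ} (hm : 0 < m) (hM : m ≤ M') :
    ∃ C' H₀ : ℝ, 0 ≤ C' ∧ 1 ≤ H₀ ∧ ∀ H s t T ell Z D c : ℝ, H₀ ≤ H → 0 ≤ s → s * H ≤ M' →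
      H * T = H * D - s * t + ell → ell ^ 2 ≤ s ^ 2 * Z → |D| ≤ C → |c| ≤ C → 0 ≤ Z →
      -C' ≤ 11 / 4 * t ^ 2 + Z / 2 + c * (t + T) - 9 / 4 * (t + T) ^ 2 := by
  have hM0 : 0 < M' := hm.trans_le hM
  refine ⟨100 * C ^ 2, 1 + 100 * M', by positivity, by linarith, ?_⟩
  intro H s t T ell Z D c hH hs hsH hT hell hD hc hZ
  have hH0 : 1 ≤ H := by linarith
  have hHp : 0 < H := by linarith
  have hsmall : 100 * s ≤ H := by
    have : s ≤ s * H := le_mul_of_one_le_right hs hH0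
    linarith
  have hDabs := abs_le.mp hD
  have hDsq : D ^ 2 ≤ C ^ 2 := sq_le_sq' hDabs.1 hDabs.2
  have hcabs := abs_le.mp hc
  have hcsq : c ^ 2 ≤ C ^ 2 := sq_le_sq' hcabs.1 hcabs.2
  set e := (ell - s * t) / H with he
  have hTe : T = D + e := by
    rw [he]; field_simp; linarith
  have heH : H * e = ell - s * t := by rw [he]; field_simp
  have hesq : e ^ 2 ≤ (Z + t ^ 2) / 5000 := by
    have h1 : H ^ 2 * e ^ 2 ≤ 2 * ell ^ 2 + 2 * (s ^ 2 * t ^ 2) := by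
      have : H ^ 2 * e ^ 2 = (ell - s * t) ^ 2 := by rw [← heH]; ring
      rw [this]; linarith only [sq_nonneg (ell + s * t)]
    have h2 : (100 * s) ^ 2 ≤ H ^ 2 := pow_le_pow_left₀ (by positivity) hsmall 2
    have h5 : H ^ 2 * e ^ 2 ≤ H ^ 2 * ((Z + t ^ 2) / 5000) := by
      have h3 : (100 * s) ^ 2 * Z ≤ H ^ 2 * Z := by gcongr
      have h4 : (100 * s) ^ 2 * t ^ 2 ≤ H ^ 2 * t ^ 2 := by gcongr
      linarith only [h1, h3, h4, hell]
    exact le_of_mul_le_mul_left h5 (by positivity)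
  have hTsq : T ^ 2 ≤ 2 * C ^ 2 + (Z + t ^ 2) / 2500 := by
    rw [hTe]; linarith only [sq_nonneg (D - e), hesq, hDsq]
  -- Splitting with the factor 10/9 leaves t²/4 of the available 11/4 t² for the errors; T² is small
  -- up to a constant.
  have h1 : 9 / 4 * (t + T) ^ 2 ≤ 5 / 2 * t ^ 2 + 45 / 2 * T ^ 2 := by
    linarith only [sq_nonneg (t - 9 * T)]
  have h2 : -(c * (t + T)) ≤ 1 / 16 * t ^ 2 + 4 * C ^ 2 + C ^ 2 + T ^ 2 := by
    linarith only [sq_nonneg (t / 4 + 2 * c), sq_nonneg (c + T), hcsq, sq_nonneg c, sq_nonneg T]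
  linarith only [h1, h2, hTsq, sq_nonneg t, sq_nonneg C, hZ]

end CurvEst

namespace CurvEst

open Finset

theorem sq_sum_mul_le {ι : Type*} (s : Finset ι) (l d : ι → ℝ) (hl : ∀ i ∈ s, 0 ≤ l i) :
    (∑ i ∈ s, l i * d i) ^ 2 ≤ (∑ i ∈ s, l i) ^ 2 * ∑ i ∈ s, d i ^ 2 := by
  refine (sum_mul_sq_le_sq_mul_sq s l d).trans ?_
  exact mul_le_mul_of_nonneg_right (sum_sq_le_sq_sum_of_nonneg hl)
    (sum_nonneg fun i _ => sq_nonneg _)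

variable {ι : Type*} [Fintype ι] [DecidableEq ι]

/-- One direction `k` of the quadratic form in the Jacobi inequality. -/
def jacobiTerm (lam : ι → ℝ) (p c : ℝ) (k : ι) (d : ι → ℝ) : ℝ :=
  d k ^ 2 + 3 * ∑ i ∈ univ.erase k, d i ^ 2 - (∑ i, d i) ^ 2
    - 2 * ∑ i ∈ univ.erase k, p * lam k * (lam i + lam k) * d i + c * ∑ i, d i

/-- Without the constraint the form is indefinite because of -(Σ dᵢ)². The constraint, which is the
once differentiated equation, makes the sum of the dᵢ over i ≠ i₀ nearly bounded, so d_{i₀} governs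
the trace. For k = i₀ the gain is the cross term 2(s/H)d_{i₀}²; for k ≠ i₀ it is the coefficient 3
of d_{i₀}², against 1 + 5/4. -/
theorem jacobiTerm_ge {m M C : ℝ} (hm : 0 < m) (hM : m ≤ M) (hC : 0 ≤ C) :
    ∃ C' H₀ : ℝ, 0 ≤ C' ∧ 1 ≤ H₀ ∧ ∀ (lam : ι → ℝ) (i₀ : ι) (H p c D : ℝ) (k : ι) (d : ι → ℝ),
      Spectrum m M lam i₀ H → H₀ ≤ H → |p| ≤ 1 → |c| ≤ C → |D| ≤ C →
      ∑ i, (H - lam i) * d i = H * D →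
      5 / 4 * ((H - lam k) * (∑ i, d i) ^ 2 / H) - C' * H ^ 2 ≤ jacobiTerm lam p c k d := by
  rcases isEmpty_or_nonempty ι with hι | hι
  · exact ⟨0, 1, le_rfl, le_rfl, fun lam i₀ => (hι.false i₀).elim⟩
  have hN : (1 : ℝ) ≤ Fintype.card ι := by exact_mod_cast Fintype.card_pos (α := ι)
  set N : ℝ := (Fintype.card ι : ℝ) with hNdef
  -- N·2M is the upper bound of (H - λ_{i₀})H from `gap_mul_le`.
  have hM' : m ≤ N * (2 * M) := by nlinarith
  obtain ⟨C₁, H₁, hC₁, hH₁, key₁⟩ := jacobi_large hm hM' hC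
  obtain ⟨C₂, H₂, hC₂, hH₂, key₂⟩ := jacobi_small (C := C) hm hM'
  refine ⟨C₁ + (C₂ + N * (16 * M ^ 2)), max H₁ H₂, by positivity, hH₁.trans (le_max_left _ _), ?_⟩
  intro lam i₀ H p c D k d hS hH hp hc hD hd
  have hHp := hS.H_pos
  have hH1 : 1 ≤ H := hH₁.trans ((le_max_left _ _).trans hH)
  have hHsq : 1 ≤ H ^ 2 := one_le_pow₀ hH1
  set s := H - lam i₀ with hs
  have hs0 : 0 ≤ s := hS.F_nonneg i₀
  set T := ∑ i ∈ univ.erase i₀, d i with hTdef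
  set ell := ∑ i ∈ univ.erase i₀, lam i * d i with helldef
  set Y := ∑ i ∈ univ.erase i₀, d i ^ 2 with hYdef
  have hY0 : 0 ≤ Y := sum_nonneg fun i _ => sq_nonneg _
  have hsum : ∑ i, d i = d i₀ + T := (add_sum_erase _ _ (mem_univ i₀)).symm
  have hsumlam : ∑ i ∈ univ.erase i₀, lam i = s := by
    rw [hs, ← hS.sum_eq, ← add_sum_erase _ _ (mem_univ i₀)]; ring
  have hell : ell ^ 2 ≤ s ^ 2 * Y := by
    rw [← hsumlam]; exact sq_sum_mul_le _ _ _ fun i _ => hS.nonneg i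
  have hconstr : H * T = H * D - s * d i₀ + ell := by
    rw [← hd, ← add_sum_erase _ _ (mem_univ i₀)]
    simp only [sub_mul, sum_sub_distrib, ← mul_sum]
    rw [hs]; ring
  have hsqsum : ∑ i, d i ^ 2 = d i₀ ^ 2 + Y := (add_sum_erase _ _ (mem_univ i₀)).symm
  rcases eq_or_ne k i₀ with rfl | hk
  · have h := key₁ H (s * H) (lam k) (d k / H) T ell Y D p c ((le_max_left _ _).trans hH)
      hS.le_gap_mul hS.gap_mul_le (hS.nonneg k) (hS.le_H k)
      (by rw [hconstr]; field_simp) (by nlinarith) hD hp hc hY0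
    have e1 : H * (d k / H) = d k := by field_simp
    have e2 : s * H / H ^ 2 = s / H := by field_simp
    rw [e1, e2] at h
    have e3 : ∑ i ∈ univ.erase k, p * lam k * (lam i + lam k) * d i
        = p * lam k * (ell + lam k * T) := by
      rw [helldef, hTdef, mul_sum, ← sum_add_distrib, mul_sum]
      exact sum_congr rfl fun i _ => by ring
    rw [jacobiTerm, e3, ← hYdef, hsum]
    have e4 : 0 ≤ (C₂ + N * (16 * M ^ 2)) * H ^ 2 := by positivity
    have e5 : 5 / 4 * (s * (d k + T) ^ 2 / H) = 5 / 4 * (s / H) * (d k + T) ^ 2 := by ring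
    rw [e5]
    linarith
  · have h := key₂ H s (d i₀) T ell Y D c ((le_max_right _ _).trans hH) hs0 hS.gap_mul_le
      hconstr hell hD hc hY0
    have hM0 := hS.M_pos
    -- As k ≠ i₀, both λₖλᵢ and λₖ² ≤ λₖλ_{i₀} are at most M, so the cross terms have bounded
    -- coefficients. They use up 1/4 of the coefficient 3, which explains the 11/4 of
    -- `jacobi_small`.
    have e1 : ∀ i ∈ univ.erase k,
        2 * (p * lam k * (lam i + lam k) * d i) ≤ 1 / 4 * d i ^ 2 + 16 * M ^ 2 := by
      intro i hi
      have hik : i ≠ k := ne_of_mem_erase hi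
      have a1 : lam k * lam i ≤ M := hS.mul_le hik.symm
      have a2 : lam k * lam k ≤ M :=
        (mul_le_mul_of_nonneg_left (hS.le_max k) (hS.nonneg k)).trans (hS.mul_le hk)
      set x := lam k * (lam i + lam k) with hx
      have a3 : 0 ≤ x := mul_nonneg (hS.nonneg k) (add_nonneg (hS.nonneg i) (hS.nonneg k))
      have a4 : x ≤ 2 * M := by rw [hx]; linarith
      have a5 : (p * x) ^ 2 ≤ (2 * M) ^ 2 := by
        rw [mul_pow]
        have : p ^ 2 ≤ 1 := by rw [← sq_abs]; exact pow_le_one₀ (abs_nonneg _) hp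
        calc p ^ 2 * x ^ 2 ≤ 1 * (2 * M) ^ 2 := by gcongr
          _ = _ := one_mul _
      have a6 : p * lam k * (lam i + lam k) * d i = (p * x) * d i := by rw [hx]; ring
      rw [a6]
      linarith only [sq_nonneg (2 * (p * x) - d i / 2), a5]
    have e2 : 2 * ∑ i ∈ univ.erase k, p * lam k * (lam i + lam k) * d i
        ≤ 1 / 4 * ∑ i ∈ univ.erase k, d i ^ 2 + N * (16 * M ^ 2) := by
      rw [mul_sum]
      refine (sum_le_sum e1).trans ?_
      rw [sum_add_distrib, ← mul_sum]
      gcongr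
      rw [sum_const, nsmul_eq_mul]
      gcongr
      rw [hNdef]
      exact_mod_cast card_le_univ _
    have e3 : ∑ i, d i ^ 2 = d k ^ 2 + ∑ i ∈ univ.erase k, d i ^ 2 :=
      (add_sum_erase _ _ (mem_univ k)).symm
    have e4 : d k ^ 2 ≤ Y :=
      single_le_sum (f := fun i => d i ^ 2) (fun i _ => sq_nonneg _)
        (mem_erase.mpr ⟨hk, mem_univ k⟩)
    have e5 : (H - lam k) * (d i₀ + T) ^ 2 / H ≤ (d i₀ + T) ^ 2 := by
      rw [div_le_iff₀ hHp, mul_comm]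
      have := hS.nonneg k
      gcongr
      linarith
    rw [jacobiTerm, hsum]
    have e6 : 0 ≤ C₁ * H ^ 2 := by positivity
    have e7 : C₂ + N * (16 * M ^ 2) ≤ (C₂ + N * (16 * M ^ 2)) * H ^ 2 :=
      le_mul_of_one_le_right (by positivity) hHsq
    have e8 : 0 ≤ (d i₀ + T) ^ 2 := sq_nonneg _
    linarith only [h, e2, e3, e4, e5, e6, e7, hsqsum, hY0]

theorem jacobi {m M C : ℝ} (hm : 0 < m) (hM : m ≤ M) (hC : 0 ≤ C) :
    ∃ C' H₀ : ℝ, 0 ≤ C' ∧ 1 ≤ H₀ ∧ ∀ (lam : ι → ℝ) (i₀ : ι) (H : ℝ) (p c D : ι → ℝ)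
      (d : ι → ι → ℝ), Spectrum m M lam i₀ H → H₀ ≤ H → (∀ k, |p k| ≤ 1) → (∀ k, |c k| ≤ C) →
      (∀ k, |D k| ≤ C) → (∀ k, ∑ i, (H - lam i) * d i k = H * D k) →
      5 / 4 * ∑ k, (H - lam k) * (∑ i, d i k) ^ 2 / H - C' * H ^ 2
        ≤ ∑ k, jacobiTerm lam (p k) (c k) k (fun i => d i k) := by
  obtain ⟨C₁, H₁, hC₁, hH₁, key⟩ := jacobiTerm_ge (ι := ι) hm hM hC
  refine ⟨Fintype.card ι * C₁, H₁, by positivity, hH₁, ?_⟩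
  intro lam i₀ H p c D d hS hH hp hc hD hd
  have h := sum_le_sum fun (k : ι) (_ : k ∈ univ) =>
    key lam i₀ H (p k) (c k) (D k) k (fun i => d i k) hS hH (hp k) (hc k) (hD k) (hd k)
  rw [sum_sub_distrib, ← mul_sum] at h
  simp only [sum_const, card_univ, nsmul_eq_mul] at h
  linarith

end CurvEst

/-! ### The maximum principle as an inequality between numbers at one point. -/

namespace CurvEst

open Finset

variable {ι : Type*} [Fintype ι]

/-- The first and second order data of the test function
`2 log ρ + β Φ + log log H`, along the directions of a frame, at an interior maximum point. -/
structure MaxData (m M C R κ β : ℝ) (lam : ι → ℝ) (i₀ : ι) (H ρ : ℝ) (y Q v e h₁ h₂ Φ₂ : ι → ℝ) :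
    Prop where
  spec : Spectrum m M lam i₀ H
  rho_pos : 0 < ρ
  rho_le : ρ ≤ R ^ 2
  abs_y : ∀ i, |y i| ≤ R
  abs_Q : ∀ i, |Q i| ≤ C
  abs_v : ∀ i, |v i| ≤ C
  e_le : ∀ i, e i ≤ 1
  far : ρ ≤ R ^ 2 / 2 → κ ≤ ∑ i, y i * Q i
  one_lt_log : 1 < Real.log H
  critical : ∀ i, h₁ i / (H * Real.log H) = 4 * y i / ρ - β * (lam i * Q i)
  second : ∀ i, -4 * e i / ρ - 8 * y i ^ 2 / ρ ^ 2 + β * Φ₂ i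
    + ((h₂ i / H - (h₁ i / H) ^ 2) / Real.log H - (h₁ i / H) ^ 2 / Real.log H ^ 2) ≤ 0
  jac : 5 / 4 * ∑ i, (H - lam i) * h₁ i ^ 2 / H - C * H ^ 2 ≤ ∑ i, (H - lam i) * h₂ i
  phi : ∑ i, (H - lam i) * lam i ^ 2 - C
    ≤ ∑ i, (H - lam i) * Φ₂ i - ∑ i, v i * (lam i * Q i)

namespace MaxData

variable {m M C R κ β H ρ : ℝ} {lam : ι → ℝ} {i₀ : ι} {y Q v e h₁ h₂ Φ₂ : ι → ℝ}

theorem H_gt (h : MaxData m M C R κ β lam i₀ H ρ y Q v e h₁ h₂ Φ₂) : Real.log H ≤ H :=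
  (Real.log_le_sub_one_of_pos h.spec.H_pos).trans (by linarith)

/-- The weight `w i = (log log H)_i`. -/
theorem sum_ineq (h : MaxData m M C R κ β lam i₀ H ρ y Q v e h₁ h₂ Φ₂) (hβ : 0 ≤ β) (w : ι → ℝ)
    (hw : ∀ i, w i = 4 * y i / ρ - β * (lam i * Q i)) :
    (Real.log H / 4 - 1) * ∑ i, (H - lam i) * w i ^ 2
      + β * (∑ i, (H - lam i) * lam i ^ 2 - C) ≤
    4 * (Fintype.card ι * H) / ρ + 8 * ∑ i, (H - lam i) * (y i ^ 2 / ρ ^ 2)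
      + C * H + ∑ i, v i * (w i - 4 * y i / ρ) := by
  have hH := h.spec.H_pos
  have hb := h.one_lt_log
  have hHb := h.H_gt
  have hρ := h.rho_pos
  have hF := h.spec.F_nonneg
  set b := Real.log H with hbdef
  have hb0 : 0 < b := by linarith
  have hh1 : ∀ i, h₁ i = H * b * w i := by
    intro i; rw [hw, ← h.critical, ← hbdef]; field_simp
  have hC : 0 ≤ C := (abs_nonneg _).trans (h.abs_v i₀)
  have s2 : ∀ i, h₂ i / (H * b) ≤ 4 * e i / ρ + 8 * (y i ^ 2 / ρ ^ 2) - β * Φ₂ i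
      + (b + 1) * w i ^ 2 := by
    intro i
    have h1 := h.second i
    have h2 : (h₂ i / H - (h₁ i / H) ^ 2) / b - (h₁ i / H) ^ 2 / b ^ 2
        = h₂ i / (H * b) - (b + 1) * w i ^ 2 := by
      rw [hh1]; field_simp; ring
    rw [h2] at h1
    have h3 : -4 * e i / ρ - 8 * y i ^ 2 / ρ ^ 2 = -(4 * e i / ρ) - 8 * (y i ^ 2 / ρ ^ 2) := by ring
    rw [h3] at h1
    linarith
  have s3 : ∑ i, (H - lam i) * (h₂ i / (H * b)) ≤ 4 / ρ * ∑ i, (H - lam i) * e i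
      + 8 * ∑ i, (H - lam i) * (y i ^ 2 / ρ ^ 2) - β * ∑ i, (H - lam i) * Φ₂ i
      + (b + 1) * ∑ i, (H - lam i) * w i ^ 2 := by
    refine (sum_le_sum fun i _ => mul_le_mul_of_nonneg_left (s2 i) (hF i)).trans (le_of_eq ?_)
    simp only [mul_sum, ← sum_add_distrib, ← sum_sub_distrib]
    exact sum_congr rfl fun i _ => by ring
  have s4 : ∑ i, (H - lam i) * e i ≤ Fintype.card ι * H := by
    refine le_trans (sum_le_sum fun i _ => ?_) h.spec.sum_F
    exact mul_le_of_le_one_right (hF i) (h.e_le i)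
  have s5 : 5 / 4 * b * ∑ i, (H - lam i) * w i ^ 2 - C * H
      ≤ ∑ i, (H - lam i) * (h₂ i / (H * b)) := by
    have h1 : ∑ i, (H - lam i) * (h₂ i / (H * b)) = (∑ i, (H - lam i) * h₂ i) / (H * b) := by
      rw [sum_div]; exact sum_congr rfl fun i _ => by ring
    have h2 : ∑ i, (H - lam i) * h₁ i ^ 2 / H = H * b ^ 2 * ∑ i, (H - lam i) * w i ^ 2 := by
      rw [mul_sum]; refine sum_congr rfl fun i _ => ?_
      rw [hh1]; field_simp
    have h3 := h.jac
    rw [h2] at h3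
    rw [h1, le_div_iff₀ (by positivity)]
    have h4 : C * H ^ 2 ≤ C * H ^ 2 * b := le_mul_of_one_le_right (by positivity) hb.le
    linarith only [h3, h4]
  have s6 : 4 / ρ * ∑ i, (H - lam i) * e i ≤ 4 * (Fintype.card ι * H) / ρ := by
    rw [div_mul_eq_mul_div]; gcongr
  have s7 := mul_le_mul_of_nonneg_left h.phi hβ
  have s8 : ∑ i, v i * (w i - 4 * y i / ρ) = -(β * ∑ i, v i * (lam i * Q i)) := by
    rw [mul_sum, ← sum_neg_distrib]
    exact sum_congr rfl fun i _ => by rw [hw]; ring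
  rw [s8]
  linarith only [s3, s5, s6, s7]

/-- The terms of `sum_ineq` containing y²/ρ² and v·w are absorbed into two further copies of Σ Fᵢ
wᵢ², hence the 3. The errors that remain grow at most like H/ρ. -/
theorem main_ineq (h : MaxData m M C R κ β lam i₀ H ρ y Q v e h₁ h₂ Φ₂) (hβ : 0 ≤ β)
    (w : ι → ℝ) (hw : ∀ i, w i = 4 * y i / ρ - β * (lam i * Q i))
    (hbig : 1 ≤ Real.log H * ρ ^ 2) {N : ℝ} (hN : N = Fintype.card ι) :
    (Real.log H / 4 - 3) * ∑ i, (H - lam i) * w i ^ 2 + β * (m / N ^ 2 * H) ≤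
      (4 * N + 4 * N * C * R) * H / ρ + (N * C ^ 2 / m + C) * H
      + (β * C + N * (β ^ 2 * C ^ 2 * (4 * N * M ^ 2) + 16 * N * M * R ^ 2)) := by
  have hS := h.spec
  have hH := hS.H_pos
  have hm := hS.m_pos
  have hM := hS.M_pos
  have hb := h.one_lt_log
  have hHb := h.H_gt
  have hρ := h.rho_pos
  have hF := hS.F_nonneg
  have hC : 0 ≤ C := (abs_nonneg _).trans (h.abs_v i₀)
  have hR : 0 ≤ R := (abs_nonneg _).trans (h.abs_y i₀)
  have hN0 : 0 ≤ N := by rw [hN]; positivity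
  have hH1 : 1 ≤ H := by linarith
  have key := h.sum_ineq hβ w hw
  have gap : H - lam i₀ ≤ N * (2 * M) := by
    have h1 := hS.gap_mul_le
    rw [← hN] at h1
    exact (le_mul_of_one_le_right (hF i₀) hH1).trans h1
  -- In the direction i₀ the smallness F ≤ 2NM/H compensates 1/ρ², as Hρ² ≥ 1. In the other
  -- directions 4y/ρ is replaced by w + βλQ from the critical point equation, where F λ² is bounded.
  have t1 : ∀ i, 8 * ((H - lam i) * (y i ^ 2 / ρ ^ 2)) ≤
      (H - lam i) * w i ^ 2 + (β ^ 2 * C ^ 2 * (4 * N * M ^ 2) + 16 * N * M * R ^ 2) := by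
    intro i
    rcases eq_or_ne i i₀ with rfl | hi
    · have h1 : (H - lam i) * (y i ^ 2 / ρ ^ 2) ≤ N * (2 * M) * R ^ 2 := by
        have h2 : (H - lam i) * H ≤ N * (2 * M) := by rw [hN]; exact hS.gap_mul_le
        have h3 : 1 ≤ H * ρ ^ 2 := hbig.trans (by gcongr)
        have h4 : y i ^ 2 ≤ R ^ 2 := sq_le_sq' (abs_le.mp (h.abs_y i)).1 (abs_le.mp (h.abs_y i)).2
        rw [← mul_div_assoc, div_le_iff₀ (by positivity)]
        calc (H - lam i) * y i ^ 2 ≤ (H - lam i) * R ^ 2 := by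
              have := hF i; gcongr
          _ ≤ (H - lam i) * R ^ 2 * (H * ρ ^ 2) :=
              le_mul_of_one_le_right (mul_nonneg (hF i) (sq_nonneg _)) h3
          _ = (H - lam i) * H * R ^ 2 * ρ ^ 2 := by ring
          _ ≤ _ := by gcongr
      have h5 : 0 ≤ (H - lam i) * w i ^ 2 := mul_nonneg (hF i) (sq_nonneg _)
      have h6 : 0 ≤ β ^ 2 * C ^ 2 * (4 * N * M ^ 2) := by positivity
      linarith only [h1, h5, h6]
    · have h1 : 8 * (y i ^ 2 / ρ ^ 2) ≤ w i ^ 2 + β ^ 2 * C ^ 2 * lam i ^ 2 := by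
        have h2 : 4 * (y i / ρ) = w i + β * (lam i * Q i) := by rw [hw]; ring
        have h3 : 16 * (y i ^ 2 / ρ ^ 2) = (w i + β * (lam i * Q i)) ^ 2 := by
          rw [← h2]; ring
        have h4 : Q i ^ 2 ≤ C ^ 2 := sq_le_sq' (abs_le.mp (h.abs_Q i)).1 (abs_le.mp (h.abs_Q i)).2
        have h5 : (β * (lam i * Q i)) ^ 2 ≤ β ^ 2 * C ^ 2 * lam i ^ 2 := by
          calc (β * (lam i * Q i)) ^ 2 = β ^ 2 * lam i ^ 2 * Q i ^ 2 := by ring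
            _ ≤ β ^ 2 * lam i ^ 2 * C ^ 2 := by gcongr
            _ = _ := by ring
        linarith only [h3, h5, sq_nonneg (w i - β * (lam i * Q i))]
      have h6 : (H - lam i) * lam i ^ 2 ≤ 4 * N * M ^ 2 := by
        have h7 : lam i ≤ N * (2 * M) := (hS.le_gap hi).trans gap
        calc (H - lam i) * lam i ^ 2 = ((H - lam i) * lam i) * lam i := by ring
          _ ≤ (2 * M) * (N * (2 * M)) := by
              have := hS.nonneg i
              exact mul_le_mul (hS.F_mul_le i) h7 this (by positivity)
          _ = _ := by ring
      have h8 := mul_le_mul_of_nonneg_left h1 (hF i)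
      have h9 : β ^ 2 * C ^ 2 * ((H - lam i) * lam i ^ 2) ≤ β ^ 2 * C ^ 2 * (4 * N * M ^ 2) := by
        gcongr
      have h10 : 0 ≤ 16 * N * M * R ^ 2 := by positivity
      linarith only [h8, h9, h10]
  have t2 : 8 * ∑ i, (H - lam i) * (y i ^ 2 / ρ ^ 2) ≤ ∑ i, (H - lam i) * w i ^ 2
      + N * (β ^ 2 * C ^ 2 * (4 * N * M ^ 2) + 16 * N * M * R ^ 2) := by
    rw [mul_sum]
    refine (sum_le_sum fun i _ => t1 i).trans (le_of_eq ?_)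
    rw [sum_add_distrib, sum_const, card_univ, nsmul_eq_mul, ← hN]
  -- Young's inequality with weight Fᵢ; 1/Fᵢ ≤ H/m yields the term linear in H.
  have t3 : ∀ i, v i * (w i - 4 * y i / ρ) ≤ (H - lam i) * w i ^ 2 + C ^ 2 / m * H
      + 4 * C * R * H / ρ := by
    intro i
    have hFp : 0 < H - lam i := by
      have := hS.le_F_mul i
      by_contra hc
      have h0 : H - lam i = 0 := le_antisymm (not_lt.mp hc) (hF i)
      rw [h0] at this; linarith
    have h1 : v i * w i ≤ (H - lam i) * w i ^ 2 + C ^ 2 / m * H := by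
      have h2 := two_mul_le_of_pos hFp (w i) (v i / 2)
      have h3 : (v i / 2) ^ 2 / (H - lam i) ≤ C ^ 2 / m * H := by
        have h4 : v i ^ 2 ≤ C ^ 2 := sq_le_sq' (abs_le.mp (h.abs_v i)).1 (abs_le.mp (h.abs_v i)).2
        rw [div_le_iff₀ hFp]
        calc (v i / 2) ^ 2 ≤ C ^ 2 := by linarith only [h4, sq_nonneg (v i)]
          _ = C ^ 2 / m * m := by field_simp
          _ ≤ C ^ 2 / m * ((H - lam i) * H) := by gcongr; exact hS.le_F_mul i
          _ = _ := by ring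
      linarith only [h2, h3]
    have h5 : -(v i * (4 * y i / ρ)) ≤ 4 * C * R * H / ρ := by
      have h6 : -(v i * (4 * y i / ρ)) = 4 * (-(v i * y i)) / ρ := by ring
      rw [h6, div_le_div_iff_of_pos_right hρ]
      have h7 : -(v i * y i) ≤ C * R := by
        refine (neg_le_abs _).trans ?_
        rw [abs_mul]
        exact mul_le_mul (h.abs_v i) (h.abs_y i) (abs_nonneg _) hC
      have h8 : C * R ≤ C * R * H := le_mul_of_one_le_right (by positivity) hH1
      linarith
    linarith only [h1, h5]
  have t4 : ∑ i, v i * (w i - 4 * y i / ρ) ≤ ∑ i, (H - lam i) * w i ^ 2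
      + N * (C ^ 2 / m * H + 4 * C * R * H / ρ) := by
    refine (sum_le_sum fun i _ => t3 i).trans (le_of_eq ?_)
    simp only [sum_add_distrib, sum_const, card_univ, nsmul_eq_mul, ← hN]
    ring
  have t5 := mul_le_mul_of_nonneg_left hS.le_sum_F_mul_sq hβ
  rw [← hN] at t5 key
  have t6 : (4 * N + 4 * N * C * R) * H / ρ = 4 * (N * H) / ρ + N * (4 * C * R * H / ρ) := by
    ring
  have t7 : N * C ^ 2 / m = N * (C ^ 2 / m) := by ring
  rw [t6, t7]
  linarith only [key, t2, t4, t5]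

/-- Some direction has yᵢQᵢ ≥ κ/N, so yᵢ and Qᵢ are both bounded away from zero there. The two terms
of wᵢ = 4yᵢ/ρ - βλᵢQᵢ then have different sizes and cannot cancel, whichever direction it is. -/
theorem sum_w_ge (h : MaxData m M C R κ β lam i₀ H ρ y Q v e h₁ h₂ Φ₂) (hβ : 0 < β)
    (hC : 0 < C) (hR : 0 < R) (hκ : 0 < κ) (w : ι → ℝ)
    (hw : ∀ i, w i = 4 * y i / ρ - β * (lam i * Q i)) {N : ℝ} (hN : N = Fintype.card ι)
    (hfar : κ ≤ ∑ i, y i * Q i) (hH₁ : 8 * R ^ 2 * N ^ 2 / (β * κ) ≤ H * ρ)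
    (hH₂ : β * C ^ 2 * N ^ 2 * M * R ^ 2 / κ ≤ H) :
    min (β ^ 2 * κ ^ 2 * m / (4 * N ^ 4 * R ^ 2)) (4 * κ ^ 2 / (N ^ 3 * C ^ 2 * R ^ 4)) * H
      ≤ ∑ i, (H - lam i) * w i ^ 2 := by
  have hS := h.spec
  have hH := hS.H_pos
  have hm := hS.m_pos
  have hM := hS.M_pos
  have hρ := h.rho_pos
  have hF := hS.F_nonneg
  have hN0 : 0 < N := by
    rw [hN]
    have : 0 < Fintype.card ι := Fintype.card_pos_iff.mpr ⟨i₀⟩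
    exact_mod_cast this
  obtain ⟨i, hi⟩ : ∃ i, κ / N ≤ y i * Q i := by
    by_contra hcon
    push Not at hcon
    have h1 : ∑ i, y i * Q i < ∑ _i : ι, κ / N :=
      sum_lt_sum_of_nonempty ⟨i₀, mem_univ _⟩ fun i _ => hcon i
    rw [sum_const, card_univ, nsmul_eq_mul, ← hN, mul_div_cancel₀ _ hN0.ne'] at h1
    linarith
  have hyQ : κ / N ≤ |y i| * |Q i| := by
    rw [← abs_mul]; exact hi.trans (le_abs_self _)
  have hy : κ / (N * C) ≤ |y i| := by
    rw [← div_div, div_le_iff₀ hC]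
    exact hyQ.trans (mul_le_mul_of_nonneg_left (h.abs_Q i) (abs_nonneg _))
  have hQ : κ / (N * R) ≤ |Q i| := by
    rw [← div_div, div_le_iff₀ hR, mul_comm]
    exact hyQ.trans (mul_le_mul_of_nonneg_right (h.abs_y i) (abs_nonneg _))
  refine le_trans ?_ (single_le_sum (f := fun i => (H - lam i) * w i ^ 2)
    (fun j _ => mul_nonneg (hF j) (sq_nonneg _)) (mem_univ i))
  have hlam := hS.nonneg i
  have a1 : |4 * y i / ρ| = 4 * |y i| / ρ := by
    rw [abs_div, abs_mul, abs_of_pos hρ]; norm_num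
  have a2 : |β * (lam i * Q i)| = β * (lam i * |Q i|) := by
    rw [abs_mul, abs_mul, abs_of_pos hβ, abs_of_nonneg hlam]
  rcases eq_or_ne i i₀ with rfl | hne
  -- Direction i₀: λᵢ is of order H, so βλᵢQᵢ dominates 4yᵢ/ρ once Hρ is large, and Fᵢλᵢ² is at
  -- least a multiple of H.
  · have hlamH : H / N ≤ lam i := by
      rw [div_le_iff₀ hN0, mul_comm, hN]; exact hS.H_le
    have b1 : β * lam i * (κ / (N * R)) ≤ β * (lam i * |Q i|) := by
      rw [mul_assoc]; gcongr
    have b2 : 4 * |y i| / ρ ≤ β * lam i * (κ / (N * R)) / 2 := by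
      calc 4 * |y i| / ρ ≤ 4 * R / ρ := by gcongr; exact h.abs_y i
        _ ≤ β * (H / N) * (κ / (N * R)) / 2 := by
          rw [div_le_iff₀ hρ]
          rw [div_le_iff₀ (by positivity)] at hH₁
          have : β * (H / N) * (κ / (N * R)) / 2 * ρ = H * ρ * (β * κ) / (2 * N ^ 2 * R) := by
            field_simp
          rw [this, le_div_iff₀ (by positivity)]
          linarith
        _ ≤ _ := by gcongr
    have b3 : β * lam i * (κ / (N * R)) / 2 ≤ |w i| := by
      have h1 := abs_sub_abs_le_abs_sub (β * (lam i * Q i)) (4 * y i / ρ)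
      rw [abs_sub_comm, ← hw, a1, a2] at h1
      linarith
    have b4 : (β * lam i * (κ / (N * R)) / 2) ^ 2 ≤ w i ^ 2 := by
      rw [← sq_abs (w i)]; gcongr
    calc _ ≤ β ^ 2 * κ ^ 2 * m / (4 * N ^ 4 * R ^ 2) * H := by gcongr; exact min_le_left _ _
      _ = (m / N ^ 2 * H) * (β ^ 2 * κ ^ 2 / (4 * N ^ 2 * R ^ 2)) := by field_simp
      _ ≤ ((H - lam i) * lam i ^ 2) * (β ^ 2 * κ ^ 2 / (4 * N ^ 2 * R ^ 2)) := by
          refine mul_le_mul_of_nonneg_right ?_ (by positivity)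
          calc m / N ^ 2 * H ≤ ((H - lam i) * H) / N ^ 2 * H := by
                gcongr; exact hS.le_gap_mul
            _ = (H - lam i) * (H / N) ^ 2 := by field_simp
            _ ≤ _ := by
              have := hF i
              gcongr
      _ = (H - lam i) * (β * lam i * (κ / (N * R)) / 2) ^ 2 := by field_simp; ring
      _ ≤ _ := mul_le_mul_of_nonneg_left b4 (hF i)
  -- Other directions: λᵢ is O(1/H), so 4yᵢ/ρ dominates, and Fᵢ ≥ H/N.
  · have hlamH : lam i * H ≤ N * (2 * M) := by
      rw [hN]
      exact (mul_le_mul_of_nonneg_right (hS.le_gap hne) hH.le).trans hS.gap_mul_le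
    have b1 : 4 * (κ / (N * C)) / ρ ≤ 4 * |y i| / ρ := by gcongr
    have b2 : β * (lam i * |Q i|) ≤ 2 * (κ / (N * C)) / ρ := by
      calc β * (lam i * |Q i|) ≤ β * (lam i * C) := by gcongr; exact h.abs_Q i
        _ ≤ β * (N * (2 * M) / H * C) := by
          gcongr; rw [le_div_iff₀ hH]; exact hlamH
        _ ≤ 2 * (κ / (N * C)) / R ^ 2 := by
          rw [div_le_iff₀ hκ] at hH₂
          have e1 : β * (N * (2 * M) / H * C) = β * N * (2 * M) * C / H := by ring
          rw [e1, div_le_div_iff₀ hH (by positivity)]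
          have e2 : 2 * (κ / (N * C)) * H = 2 * (κ * H) / (N * C) := by ring
          rw [e2, le_div_iff₀ (by positivity)]
          linarith
        _ ≤ _ := by gcongr; exact h.rho_le
    have b3 : 2 * (κ / (N * C)) / R ^ 2 ≤ |w i| := by
      have h1 := abs_sub_abs_le_abs_sub (4 * y i / ρ) (β * (lam i * Q i))
      rw [← hw, a1, a2] at h1
      have h2 : 2 * (κ / (N * C)) / R ^ 2 ≤ 2 * (κ / (N * C)) / ρ := by gcongr; exact h.rho_le
      have h3 : 4 * (κ / (N * C)) / ρ = 2 * (κ / (N * C)) / ρ + 2 * (κ / (N * C)) / ρ := by ring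
      linarith
    have b4 : (2 * (κ / (N * C)) / R ^ 2) ^ 2 ≤ w i ^ 2 := by
      rw [← sq_abs (w i)]; gcongr
    have b5 : H / N ≤ H - lam i := by
      rw [div_le_iff₀ hN0, mul_comm, hN]; exact hS.H_le_F hne
    calc _ ≤ 4 * κ ^ 2 / (N ^ 3 * C ^ 2 * R ^ 4) * H := by gcongr; exact min_le_right _ _
      _ = H / N * (2 * (κ / (N * C)) / R ^ 2) ^ 2 := by field_simp; ring
      _ ≤ _ := mul_le_mul b5 b4 (by positivity) (hF i)

end MaxData

/-- At an interior maximum point of the test function, `ρ² log H` is bounded by a constant,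
provided that the weight `β` is large enough. -/
theorem exists_weight (ι : Type*) [Fintype ι] {m M C R κ : ℝ} (hm : 0 < m) (hM : 0 < M)
    (hC : 0 < C) (hR : 0 < R) (hκ : 0 < κ) :
    ∃ β Λ : ℝ, 0 < β ∧ 0 ≤ Λ ∧
      ∀ (lam : ι → ℝ) (i₀ : ι) (H ρ : ℝ) (y Q v e h₁ h₂ Φ₂ : ι → ℝ),
        MaxData m M C R κ β lam i₀ H ρ y Q v e h₁ h₂ Φ₂ → Real.log H * ρ ^ 2 ≤ Λ := by
  rcases isEmpty_or_nonempty ι with hι | hι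
  · exact ⟨1, 0, one_pos, le_rfl, fun lam i₀ => (hι.false i₀).elim⟩
  obtain ⟨N, hN⟩ : ∃ N : ℝ, N = Fintype.card ι := ⟨_, rfl⟩
  have hN0 : 0 < N := by rw [hN]; exact_mod_cast Fintype.card_pos (α := ι)
  -- E is the coefficient of H among the errors when ρ ≥ R²/2; β is then chosen so that the good
  -- term equals (E + 1)H. The choice of β depends neither on the point nor on the solution.
  set E := (4 * N + 4 * N * C * R) * (2 / R ^ 2) + (N * C ^ 2 / m + C) with hE
  have hE0 : 0 ≤ E := by positivity
  set β := (E + 1) / (m / N ^ 2) with hβdef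
  have hβ : 0 < β := by positivity
  have hβE : β * (m / N ^ 2) = E + 1 := by rw [hβdef]; field_simp
  set B := β * C + N * (β ^ 2 * C ^ 2 * (4 * N * M ^ 2) + 16 * N * M * R ^ 2) with hB
  have hB0 : 0 ≤ B := by positivity
  set c₃ := min (β ^ 2 * κ ^ 2 * m / (4 * N ^ 4 * R ^ 2)) (4 * κ ^ 2 / (N ^ 3 * C ^ 2 * R ^ 4))
    with hc₃
  have hc₃0 : 0 < c₃ := lt_min (by positivity) (by positivity)
  set E₃ := (4 * N + 4 * N * C * R) + ((N * C ^ 2 / m + C) + B) * R ^ 2 with hE₃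
  have hE₃0 : 0 ≤ E₃ := by positivity
  set A₁ := 8 * R ^ 2 * N ^ 2 / (β * κ) with hA₁
  set A₂ := β * C ^ 2 * N ^ 2 * M * R ^ 2 / κ with hA₂
  have hA₁0 : 0 ≤ A₁ := by positivity
  have hA₂0 : 0 ≤ A₂ := by positivity
  set S := B + 24 + A₂ with hSdef
  -- If this bound fails, ρ ≤ R² turns the three summands into log H·ρ² ≥ 1, log H ≥ S and log H·ρ >
  -- A₁ + 8E₃/c₃. The 24 in S gives log H/4 - 3 ≥ log H/8.
  refine ⟨β, 1 + S * R ^ 4 + (A₁ + 8 * E₃ / c₃) * R ^ 2, hβ, by positivity, ?_⟩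
  intro lam i₀ H ρ y Q v e h₁ h₂ Φ₂ h
  by_contra hcon
  push Not at hcon
  have hS := h.spec
  have hH := hS.H_pos
  have hb := h.one_lt_log
  have hHb := h.H_gt
  have hρ := h.rho_pos
  have hF := hS.F_nonneg
  have hρR := h.rho_le
  set b := Real.log H with hbdef
  have hb0 : 0 < b := by linarith
  have p1 : 0 ≤ S * R ^ 4 := by positivity
  have p2 : 0 ≤ (A₁ + 8 * E₃ / c₃) * R ^ 2 := by positivity
  have big1 : 1 ≤ b * ρ ^ 2 := by linarith
  have big2 : S ≤ b := by
    have h1 : S * R ^ 4 ≤ b * R ^ 4 := by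
      calc S * R ^ 4 ≤ b * ρ ^ 2 := by linarith
        _ ≤ b * (R ^ 2) ^ 2 := by gcongr
        _ = _ := by ring
    exact le_of_mul_le_mul_right h1 (by positivity)
  have big3 : A₁ + 8 * E₃ / c₃ < b * ρ := by
    have h1 : (A₁ + 8 * E₃ / c₃) * R ^ 2 < b * ρ * R ^ 2 := by
      calc (A₁ + 8 * E₃ / c₃) * R ^ 2 < b * ρ ^ 2 := by linarith
        _ = b * ρ * ρ := by ring
        _ ≤ _ := by gcongr
    exact lt_of_mul_lt_mul_right h1 (by positivity)
  have hH1 : 1 ≤ H := by linarith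
  obtain ⟨w, hw⟩ : ∃ w : ι → ℝ, ∀ i, w i = 4 * y i / ρ - β * (lam i * Q i) := ⟨_, fun _ => rfl⟩
  have key := h.main_ineq hβ.le w hw big1 hN
  have hW : 0 ≤ ∑ i, (H - lam i) * w i ^ 2 :=
    sum_nonneg fun i _ => mul_nonneg (hF i) (sq_nonneg _)
  have hb8 : b / 8 * ∑ i, (H - lam i) * w i ^ 2 ≤ (b / 4 - 3) * ∑ i, (H - lam i) * w i ^ 2 := by
    gcongr; linarith
  rw [← mul_assoc, hβE, ← hB] at key
  -- Away from the centre the gradient term is at least (log H/8)c₃H, against errors E₃H/ρ, which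
  -- contradicts the size of ρ log H.
  by_cases hfar : ρ ≤ R ^ 2 / 2
  · have h1 := h.sum_w_ge hβ hC hR hκ w hw hN (h.far hfar)
      (by
        have : 0 ≤ 8 * E₃ / c₃ := by positivity
        have h2 : b * ρ ≤ H * ρ := by gcongr
        linarith) (by linarith)
    rw [← hc₃] at h1
    have h2 : b / 8 * (c₃ * H) ≤ (4 * N + 4 * N * C * R) * H / ρ + (N * C ^ 2 / m + C) * H + B := by
      have h3 : b / 8 * (c₃ * H) ≤ b / 8 * ∑ i, (H - lam i) * w i ^ 2 := by gcongr
      have h4 : 0 ≤ (E + 1) * H := by positivity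
      linarith
    have h5 : b * ρ * c₃ / 8 * H ≤ E₃ * H := by
      calc b * ρ * c₃ / 8 * H = (b / 8 * (c₃ * H)) * ρ := by ring
        _ ≤ ((4 * N + 4 * N * C * R) * H / ρ + (N * C ^ 2 / m + C) * H + B) * ρ := by gcongr
        _ = (4 * N + 4 * N * C * R) * H + ((N * C ^ 2 / m + C) * H + B) * ρ := by field_simp; ring
        _ ≤ (4 * N + 4 * N * C * R) * H + ((N * C ^ 2 / m + C) * H + B * H) * R ^ 2 := by
            gcongr; exact le_mul_of_one_le_right hB0 hH1
        _ = _ := by rw [hE₃]; ring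
    have h6 := le_of_mul_le_mul_right h5 hH
    have h7 : b * ρ ≤ 8 * E₃ / c₃ := by
      rw [le_div_iff₀ hc₃0]; linarith
    linarith
  -- Near the centre the β term alone gives (E + 1)H ≤ EH + B, hence H ≤ B, against H ≥ log H ≥ S >
  -- B.
  · push Not at hfar
    have h1 : (4 * N + 4 * N * C * R) * H / ρ ≤ (4 * N + 4 * N * C * R) * (2 / R ^ 2) * H := by
      rw [div_le_iff₀ hρ]
      have h2 : 1 ≤ 2 / R ^ 2 * ρ := by
        rw [div_mul_eq_mul_div, le_div_iff₀ (by positivity)]; linarith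
      calc (4 * N + 4 * N * C * R) * H ≤ (4 * N + 4 * N * C * R) * H * (2 / R ^ 2 * ρ) :=
            le_mul_of_one_le_right (by positivity) h2
        _ = _ := by ring
    have h3 : 0 ≤ b / 8 * ∑ i, (H - lam i) * w i ^ 2 := by positivity
    have h4 : E * H = (4 * N + 4 * N * C * R) * (2 / R ^ 2) * H + (N * C ^ 2 / m + C) * H := by
      rw [hE]; ring
    linarith

end CurvEst

/-! ### Second order jets along lines and commuting directional derivatives. -/

namespace CurvEst

open Filter Topology

section Jet

variable {V : Type*} [NormedAddCommGroup V] [NormedSpace ℝ V]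

/-- `f` is twice differentiable at `0` with value `a` and derivatives `b` and `c`. -/
def HasJet (f : ℝ → V) (a b c : V) : Prop :=
  ∃ f' : ℝ → V, (∀ᶠ t in 𝓝 0, HasDerivAt f (f' t) t) ∧ f 0 = a ∧ f' 0 = b ∧ HasDerivAt f' c 0

namespace HasJet

variable {f g : ℝ → V} {a b c a₂ b₂ c₂ : V}

/-- This is how an identity is differentiated twice: compute the jet of each side and compare. -/
theorem unique (hf : HasJet f a b c) (hg : HasJet g a₂ b₂ c₂) (hfg : f =ᶠ[𝓝 0] g) :
    a = a₂ ∧ b = b₂ ∧ c = c₂ := by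
  obtain ⟨f', hf', rfl, rfl, hf2⟩ := hf
  obtain ⟨g', hg', rfl, rfl, hg2⟩ := hg
  have h : f' =ᶠ[𝓝 0] g' := by
    filter_upwards [hf', hg', hfg.eventuallyEq_nhds] with t h1 h2 h3
    exact h1.unique (h2.congr_of_eventuallyEq h3)
  exact ⟨hfg.eq_of_nhds, h.eq_of_nhds, hf2.unique (hg2.congr_of_eventuallyEq h)⟩

theorem congr (hf : HasJet f a b c) (hfg : g =ᶠ[𝓝 0] f) : HasJet g a b c := by
  obtain ⟨f', hf', rfl, rfl, hf2⟩ := hf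
  refine ⟨f', ?_, hfg.eq_of_nhds, rfl, hf2⟩
  filter_upwards [hf', hfg.eventuallyEq_nhds] with t h1 h3
  exact h1.congr_of_eventuallyEq h3

theorem of_eq (hf : HasJet f a b c) (ha : a = a₂) (hb : b = b₂) (hc : c = c₂) :
    HasJet f a₂ b₂ c₂ := by subst ha hb hc; exact hf

theorem const (a : V) : HasJet (fun _ => a) a 0 0 :=
  ⟨fun _ => 0, Eventually.of_forall fun t => hasDerivAt_const t a, rfl, rfl, hasDerivAt_const 0 0⟩

theorem affine (a b : V) : HasJet (fun t : ℝ => a + t • b) a b 0 :=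
  ⟨fun _ => b, Eventually.of_forall fun t => by
    simpa using ((hasDerivAt_id t).smul_const b).const_add a, by simp, rfl, hasDerivAt_const 0 b⟩

theorem add (hf : HasJet f a b c) (hg : HasJet g a₂ b₂ c₂) :
    HasJet (fun t => f t + g t) (a + a₂) (b + b₂) (c + c₂) := by
  obtain ⟨f', hf', rfl, rfl, hf2⟩ := hf
  obtain ⟨g', hg', rfl, rfl, hg2⟩ := hg
  refine ⟨fun t => f' t + g' t, ?_, rfl, rfl, hf2.add hg2⟩
  filter_upwards [hf', hg'] with t h1 h2 using h1.add h2

theorem sub (hf : HasJet f a b c) (hg : HasJet g a₂ b₂ c₂) :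
    HasJet (fun t => f t - g t) (a - a₂) (b - b₂) (c - c₂) := by
  obtain ⟨f', hf', rfl, rfl, hf2⟩ := hf
  obtain ⟨g', hg', rfl, rfl, hg2⟩ := hg
  refine ⟨fun t => f' t - g' t, ?_, rfl, rfl, hf2.sub hg2⟩
  filter_upwards [hf', hg'] with t h1 h2 using h1.sub h2

theorem const_smul (r : ℝ) (hf : HasJet f a b c) :
    HasJet (fun t => r • f t) (r • a) (r • b) (r • c) := by
  obtain ⟨f', hf', rfl, rfl, hf2⟩ := hf
  refine ⟨fun t => r • f' t, ?_, rfl, rfl, hf2.const_smul r⟩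
  filter_upwards [hf'] with t h1 using h1.const_smul r

theorem smul_const {φ : ℝ → ℝ} {x y z : ℝ} (hf : HasJet φ x y z) (v : V) :
    HasJet (fun t => φ t • v) (x • v) (y • v) (z • v) := by
  obtain ⟨f', hf', rfl, rfl, hf2⟩ := hf
  refine ⟨fun t => f' t • v, ?_, rfl, rfl, hf2.smul_const v⟩
  filter_upwards [hf'] with t h1 using h1.smul_const v

theorem sum {ι : Type*} (s : Finset ι) {f : ι → ℝ → V} {a b c : ι → V}
    (h : ∀ i ∈ s, HasJet (f i) (a i) (b i) (c i)) :
    HasJet (fun t => ∑ i ∈ s, f i t) (∑ i ∈ s, a i) (∑ i ∈ s, b i) (∑ i ∈ s, c i) := by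
  classical
  induction s using Finset.induction_on with
  | empty => simpa using const (0 : V)
  | insert i s hi ih =>
    simp only [Finset.sum_insert hi]
    exact (h i (Finset.mem_insert_self i s)).add
      (ih fun j hj => h j (Finset.mem_insert_of_mem hj))

theorem prodMk {W : Type*} [NormedAddCommGroup W] [NormedSpace ℝ W] {g : ℝ → W} {a₂ b₂ c₂ : W}
    (hf : HasJet f a b c) (hg : HasJet g a₂ b₂ c₂) :
    HasJet (fun t => (f t, g t)) (a, a₂) (b, b₂) (c, c₂) := by
  obtain ⟨f', hf', rfl, rfl, hf2⟩ := hf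
  obtain ⟨g', hg', rfl, rfl, hg2⟩ := hg
  refine ⟨fun t => (f' t, g' t), ?_, rfl, rfl, hf2.prodMk hg2⟩
  filter_upwards [hf', hg'] with t h1 h2 using h1.prodMk h2

theorem mul {φ ψ : ℝ → ℝ} {x y z x₂ y₂ z₂ : ℝ} (hf : HasJet φ x y z) (hg : HasJet ψ x₂ y₂ z₂) :
    HasJet (fun t => φ t * ψ t) (x * x₂) (y * x₂ + x * y₂) (z * x₂ + 2 * (y * y₂) + x * z₂) := by
  obtain ⟨f', hf', rfl, rfl, hf2⟩ := hf
  obtain ⟨g', hg', rfl, rfl, hg2⟩ := hg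
  refine ⟨fun t => f' t * ψ t + φ t * g' t, ?_, rfl, rfl, ?_⟩
  · filter_upwards [hf', hg'] with t h1 h2 using h1.mul h2
  · exact ((hf2.mul hg'.self_of_nhds).add (hf'.self_of_nhds.mul hg2)).congr_deriv (by ring)

theorem continuousAt (hf : HasJet f a b c) : ContinuousAt f 0 := by
  obtain ⟨f', hf', -⟩ := hf
  exact hf'.self_of_nhds.continuousAt

theorem comp_fun {W : Type*} [NormedAddCommGroup W] [NormedSpace ℝ W] {F : V → W}
    (hf : HasJet f a b c) (hF : ContDiffAt ℝ 2 F a) :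
    HasJet (fun t => F (f t)) (F a) (fderiv ℝ F a b)
      (fderiv ℝ (fderiv ℝ F) a b b + fderiv ℝ F a c) := by
  have hcont := hf.continuousAt
  obtain ⟨f', hf', rfl, rfl, hf2⟩ := hf
  refine ⟨fun t => fderiv ℝ F (f t) (f' t), ?_, rfl, rfl, ?_⟩
  · have h1 : ∀ᶠ x in 𝓝 (f 0), ContDiffAt ℝ 2 F x := hF.eventually (by simp)
    filter_upwards [hf', hcont.eventually h1] with t ht h2
    exact (h2.differentiableAt (by simp)).hasFDerivAt.comp_hasDerivAt t ht
  · have h1 : ContDiffAt ℝ 1 (fderiv ℝ F) (f 0) := hF.fderiv_right (by norm_num)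
    have h2 := (h1.differentiableAt (by simp)).hasFDerivAt.comp_hasDerivAt 0 hf'.self_of_nhds
    exact h2.clm_apply hf2

theorem log {φ : ℝ → ℝ} {x y z : ℝ} (hf : HasJet φ x y z) (hx : x ≠ 0) :
    HasJet (fun t => Real.log (φ t)) (Real.log x) (y / x) (z / x - (y / x) ^ 2) := by
  have hcont := hf.continuousAt
  obtain ⟨f', hf', rfl, rfl, hf2⟩ := hf
  refine ⟨fun t => f' t / φ t, ?_, rfl, rfl, ?_⟩
  · filter_upwards [hf', hcont.eventually_ne hx] with t h1 h2 using h1.log h2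
  · exact (hf2.div hf'.self_of_nhds hx).congr_deriv (by field_simp)

/-- A positive second derivative would make 0 a local minimum too; the function would then be
locally constant, with vanishing second derivative. -/
theorem isLocalMax {φ : ℝ → ℝ} {x y z : ℝ} (hf : HasJet φ x y z) (h : IsLocalMax φ 0) :
    y = 0 ∧ z ≤ 0 := by
  obtain ⟨f', hf', rfl, rfl, hf2⟩ := hf
  have h0 : f' 0 = 0 := h.hasDerivAt_eq_zero hf'.self_of_nhds
  refine ⟨h0, ?_⟩
  by_contra hz
  push Not at hz
  have hd : deriv φ =ᶠ[𝓝 0] f' := hf'.mono fun t ht => ht.deriv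
  have h1 : deriv (deriv φ) 0 = z := by rw [hd.deriv_eq]; exact hf2.deriv
  have h2 : IsLocalMin φ 0 := isLocalMin_of_deriv_deriv_pos (by rw [h1]; exact hz)
    (by rw [hd.eq_of_nhds, h0]) hf'.self_of_nhds.continuousAt
  have h3 : φ =ᶠ[𝓝 0] fun _ => φ 0 := by
    filter_upwards [h, h2] with t h4 h5 using le_antisymm h4 h5
  have h4 : HasJet φ (φ 0) (f' 0) z := ⟨f', hf', rfl, rfl, hf2⟩
  have := (h4.unique (const (φ 0)) h3).2.2
  linarith

end HasJet

end Jet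

section Directional

variable {E : Type*} [NormedAddCommGroup E] [NormedSpace ℝ E]

/-- The derivative of `F` in the direction `v`. -/
noncomputable def dd (v : E) (F : E → ℝ) (x : E) : ℝ := fderiv ℝ F x v

variable {F G : E → ℝ} {x : E}

theorem contDiffAt_dd {k l : ℕ∞} (hF : ContDiffAt ℝ l F x) (hkl : (k : WithTop ℕ∞) + 1 ≤ l)
    (v : E) : ContDiffAt ℝ k (dd v F) x :=
  (hF.fderiv_right hkl).clm_apply contDiffAt_const

theorem dd_congr (h : F =ᶠ[𝓝 x] G) (v : E) : dd v F =ᶠ[𝓝 x] dd v G := by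
  filter_upwards [h.eventuallyEq_nhds] with y hy
  rw [dd, dd, hy.fderiv_eq]

theorem dd_comm (hF : ContDiffAt ℝ 2 F x) (v w : E) : dd v (dd w F) x = dd w (dd v F) x := by
  have h1 : ContDiffAt ℝ 1 (fderiv ℝ F) x := hF.fderiv_right (by norm_num)
  have h2 : ∀ a b : E, dd a (dd b F) x = fderiv ℝ (fderiv ℝ F) x a b := by
    intro a b
    have : HasFDerivAt (fun y => fderiv ℝ F y b)
        ((ContinuousLinearMap.apply ℝ ℝ b).comp (fderiv ℝ (fderiv ℝ F) x)) x :=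
      (ContinuousLinearMap.apply ℝ ℝ b).hasFDerivAt.comp x
        (h1.differentiableAt (by simp)).hasFDerivAt
    change fderiv ℝ (fun y => fderiv ℝ F y b) x a = _
    rw [this.fderiv]; rfl
  rw [h2, h2]
  exact hF.isSymmSndFDerivAt (by simp) v w

theorem dd_comm_eventually (hF : ContDiffAt ℝ 2 F x) (v w : E) :
    dd v (dd w F) =ᶠ[𝓝 x] dd w (dd v F) := by
  filter_upwards [hF.eventually (by simp)] with y hy using dd_comm hy v w

theorem dd_comm_three (hF : ContDiffAt ℝ 3 F x) (v w : E) :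
    dd v (dd w (dd w F)) =ᶠ[𝓝 x] dd w (dd w (dd v F)) := by
  have h1 : ContDiffAt ℝ 2 (dd w F) x := contDiffAt_dd (k := 2) (l := 3) hF (by norm_num) w
  have h2 : ContDiffAt ℝ 2 F x := hF.of_le (by norm_num)
  exact (dd_comm_eventually h1 v w).trans (dd_congr (dd_comm_eventually h2 v w) w)

theorem dd_comm_four (hF : ContDiffAt ℝ 4 F x) (v w : E) :
    dd v (dd v (dd w (dd w F))) x = dd w (dd w (dd v (dd v F))) x := by
  have h1 : ContDiffAt ℝ 3 (dd v F) x := contDiffAt_dd (k := 3) (l := 4) hF (by norm_num) v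
  have h2 : ContDiffAt ℝ 3 F x := hF.of_le (by norm_num)
  exact (dd_congr (dd_comm_three h2 v w) v).eq_of_nhds.trans (dd_comm_three h1 v w).eq_of_nhds

theorem HasJet.of_contDiffAt (hF : ContDiffAt ℝ 2 F x) (v : E) :
    HasJet (fun t : ℝ => F (x + t • v)) (F x) (dd v F x) (dd v (dd v F) x) := by
  refine ((HasJet.affine x v).comp_fun hF).of_eq rfl rfl ?_
  have h1 : ContDiffAt ℝ 1 (fderiv ℝ F) x := hF.fderiv_right (by norm_num)
  have : HasFDerivAt (fun y => fderiv ℝ F y v)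
      ((ContinuousLinearMap.apply ℝ ℝ v).comp (fderiv ℝ (fderiv ℝ F) x)) x :=
    (ContinuousLinearMap.apply ℝ ℝ v).hasFDerivAt.comp x
      (h1.differentiableAt (by simp)).hasFDerivAt
  change _ = fderiv ℝ (fun y => fderiv ℝ F y v) x v
  rw [this.fderiv, map_zero, add_zero]; rfl

theorem dd_sum_smul {ι : Type*} (s : Finset ι) (c : ι → ℝ) (v : ι → E) :
    dd (∑ i ∈ s, c i • v i) F x = ∑ i ∈ s, c i * dd (v i) F x := by
  simp [dd, map_sum]

end Directional

end CurvEst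

/-! ### The twice differentiated equation and the Jacobi inequality. -/

namespace CurvEst

open Finset Filter Topology

variable {ι : Type*} [Fintype ι] [DecidableEq ι]

/-- The derivative in direction `k` of the metric coefficients `g i j` at the centre of an
orthonormal frame diagonalizing the Hessian. -/
def metricDeriv (lam p : ι → ℝ) (k i j : ι) : ℝ :=
  lam k * ((if i = k then p j else 0) + if j = k then p i else 0)

/-- Differentiating `g B = A` twice in direction `k`, where `g i j = mm i j + P i * P j` is the
identity and `A` is diagonal at the centre. -/
theorem jet_of_mul_eq (k : ι) {P : ι → ℝ → ℝ} {A Bf : ι → ι → ℝ → ℝ} {lam p q : ι → ℝ}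
    {mm a₁ a₂ B₀ B₁ B₂ : ι → ι → ℝ}
    (hP : ∀ i, HasJet (P i) (p i) (if i = k then lam k else 0) (q i))
    (hA : ∀ i j, HasJet (A i j) (if i = j then lam i else 0) (a₁ i j) (a₂ i j))
    (hB : ∀ i j, HasJet (Bf i j) (B₀ i j) (B₁ i j) (B₂ i j))
    (hid : ∀ i j, (fun t => ∑ l, (mm i l + P i t * P l t) * Bf l j t) =ᶠ[𝓝 0] A i j)
    (hm : ∀ i j, mm i j + p i * p j = if i = j then 1 else 0) :
    (∀ i j, B₀ i j = if i = j then lam i else 0) ∧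
    (∀ i j, B₁ i j = a₁ i j - metricDeriv lam p k i j * lam j) ∧
    ∀ i, B₂ i i = a₂ i i - (2 * (q i * p i) + if i = k then 2 * lam k ^ 2 else 0) * lam i
      - 2 * ∑ j, metricDeriv lam p k i j * B₁ j i := by
  have key : ∀ i j, HasJet (fun t => ∑ l, (mm i l + P i t * P l t) * Bf l j t)
      (∑ l, (if i = l then 1 else 0) * B₀ l j)
      (∑ l, (metricDeriv lam p k i l * B₀ l j + (if i = l then 1 else 0) * B₁ l j))
      (∑ l, ((q i * p l + 2 * ((if i = k then lam k else 0) * (if l = k then lam k else 0))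
          + p i * q l) * B₀ l j + 2 * (metricDeriv lam p k i l * B₁ l j)
          + (if i = l then 1 else 0) * B₂ l j)) := by
    intro i j
    refine HasJet.sum _ fun l _ => ?_
    have h1 := (((HasJet.const (mm i l)).add ((hP i).mul (hP l))).mul (hB l j))
    refine h1.of_eq ?_ ?_ ?_
    · rw [hm]
    · rw [hm, metricDeriv, zero_add]; split_ifs <;> ring
    · rw [hm, metricDeriv]; split_ifs <;> ring
  have h := fun i j => (key i j).unique (hA i j) (hid i j)
  have h0 : ∀ i j, B₀ i j = if i = j then lam i else 0 := by
    intro i j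
    have := (h i j).1
    simpa using this
  refine ⟨h0, ?_, ?_⟩
  · intro i j
    have := (h i j).2.1
    simp only [h0, sum_add_distrib, ite_mul, one_mul, zero_mul, sum_ite_eq, mem_univ, if_true,
      mul_ite, mul_zero, sum_ite_eq'] at this
    linarith
  · intro i
    have := (h i i).2.2
    simp only [h0, sum_add_distrib, ite_mul, one_mul, zero_mul, sum_ite_eq, mem_univ, if_true,
      mul_ite, mul_zero, sum_ite_eq', ← mul_sum] at this
    have e : (2 * if i = k then if i = k then lam k * lam k else 0 else 0)
        = if i = k then 2 * lam k ^ 2 else 0 := by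
      split_ifs <;> ring
    split_ifs at this ⊢ <;> linarith


theorem sum_antisymm {κ : Type*} [Fintype κ] {f : κ → κ → ℝ} (h : ∀ i k, f i k = -f k i) : ∑ k, ∑ i, f i k = 0 := by
  have h1 : ∑ k, ∑ i, f i k = -∑ k, ∑ i, f i k := by
    conv_lhs => rw [sum_comm]
    rw [← sum_neg_distrib]
    refine sum_congr rfl fun k _ => ?_
    rw [← sum_neg_distrib]
    exact sum_congr rfl fun i _ => h k i
  linarith

/-- The twice differentiated equation, summed over all directions: the commutator terms combine
with the square of the derivative of the Weingarten map to a quadratic form in the third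
derivatives. -/
theorem sum_second_trace_ge {lam p : ι → ℝ} {H : ℝ} {u₃ : ι → ι → ι → ℝ} {u₄ : ι → ι → ℝ}
    {b₁ : ι → ι → ι → ℝ} {b₂ : ι → ι → ℝ} {Ψ₂ : ι → ℝ}
    (hs₁ : ∀ i j k, u₃ i j k = u₃ j i k) (hs₂ : ∀ i j k, u₃ i j k = u₃ i k j)
    (hs₄ : ∀ i k, u₄ i k = u₄ k i)
    (hb₁ : ∀ k i j, b₁ k i j = u₃ i j k - metricDeriv lam p k i j * lam j)
    (hb₂ : ∀ k i, b₂ k i = u₄ i k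
      - (2 * (u₃ i k k * p i) + if i = k then 2 * lam k ^ 2 else 0) * lam i
      - 2 * ∑ j, metricDeriv lam p k i j * b₁ k j i)
    (hΨ : ∀ k, ∑ i, (H - lam i) * b₂ k i + (∑ i, b₁ k i i) ^ 2 - ∑ i, ∑ j, b₁ k i j * b₁ k j i
      = Ψ₂ k) :
    ∑ k, Ψ₂ k + ∑ k, jacobiTerm lam (p k) 0 k (fun i => b₁ k i i)
      ≤ ∑ k, (H - lam k) * ∑ i, b₂ k i := by
  -- Interchanging the roles of i and k leaves (λᵢ - λₖ)u₄ᵢₖ, which is antisymmetric and sums to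
  -- zero. Only third derivatives and curvature terms survive.
  have comm : ∑ k, (H - lam k) * ∑ i, b₂ k i - ∑ k, ∑ i, (H - lam i) * b₂ k i
      = ∑ k, ∑ i, (lam k - lam i) * (2 * p i) *
        ((lam k + lam i) * u₃ k k i - lam k ^ 2 * p i * lam i) := by
    have e1 : ∑ k, (H - lam k) * ∑ i, b₂ k i - ∑ k, ∑ i, (H - lam i) * b₂ k i
        = ∑ k, ∑ i, (lam i - lam k) * b₂ k i := by
      rw [← sum_sub_distrib]
      refine sum_congr rfl fun k _ => ?_
      rw [mul_sum, ← sum_sub_distrib]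
      exact sum_congr rfl fun i _ => by ring
    have e2 : ∑ k, ∑ i, (lam i - lam k) * u₄ i k = 0 :=
      sum_antisymm fun i k => by rw [hs₄ i k]; ring
    rw [e1, ← add_zero (∑ k, ∑ i, (lam k - lam i) * (2 * p i) *
        ((lam k + lam i) * u₃ k k i - lam k ^ 2 * p i * lam i)), ← e2, ← sum_add_distrib]
    refine sum_congr rfl fun k _ => ?_
    rw [← sum_add_distrib]
    refine sum_congr rfl fun i _ => ?_
    rcases eq_or_ne i k with rfl | hik
    · simp
    · have e3 : ∑ j, metricDeriv lam p k i j * b₁ k j i = lam k * p i * b₁ k k i := by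
        simp only [metricDeriv, if_neg hik, zero_add, mul_ite, mul_zero, ite_mul, zero_mul,
          sum_ite_eq', mem_univ, if_true]
      rw [hb₂, e3, hb₁, metricDeriv, if_neg hik, if_neg hik, if_pos rfl, hs₁ i k k, hs₂ k i k]
      ring
  -- For i, j ≠ k the metric correction vanishes, so b₁ᵢⱼ is symmetric and the terms with i ≠ j are
  -- squares that can be dropped. Entries with one index k are not symmetric and are kept as
  -- products.
  have quad : ∀ k, b₁ k k k ^ 2 + ∑ i ∈ univ.erase k, b₁ k i i ^ 2
      + 2 * ∑ i ∈ univ.erase k, b₁ k k i * b₁ k i k ≤ ∑ i, ∑ j, b₁ k i j * b₁ k j i := by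
    intro k
    have h1 : ∀ i ∈ univ.erase k, b₁ k i i ^ 2 + b₁ k i k * b₁ k k i
        ≤ ∑ j, b₁ k i j * b₁ k j i := by
      intro i hi
      have hik : i ≠ k := ne_of_mem_erase hi
      have h2 : ∀ j, j ≠ k → 0 ≤ b₁ k i j * b₁ k j i := by
        intro j hj
        rw [hb₁, hb₁, metricDeriv, metricDeriv, if_neg hik, if_neg hj, hs₁ j i k]
        simp only [add_zero, mul_zero, zero_mul, sub_zero]
        exact mul_self_nonneg _
      rw [← add_sum_erase _ _ (mem_univ k), add_comm]
      gcongr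
      rw [sq]
      exact single_le_sum (f := fun j => b₁ k i j * b₁ k j i)
        (fun j hj => h2 j (ne_of_mem_erase hj)) (mem_erase.mpr ⟨hik, mem_univ i⟩)
    have h3 : ∑ i, ∑ j, b₁ k i j * b₁ k j i = b₁ k k k ^ 2
        + ∑ i ∈ univ.erase k, b₁ k k i * b₁ k i k
        + ∑ i ∈ univ.erase k, ∑ j, b₁ k i j * b₁ k j i := by
      rw [← add_sum_erase _ _ (mem_univ k), ← add_sum_erase (a := k) univ
        (fun j => b₁ k k j * b₁ k j k) (mem_univ k)]
      ring
    have h4 := sum_le_sum h1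
    rw [sum_add_distrib] at h4
    have h5 : ∑ i ∈ univ.erase k, b₁ k i k * b₁ k k i
        = ∑ i ∈ univ.erase k, b₁ k k i * b₁ k i k := sum_congr rfl fun i _ => mul_comm _ _
    rw [h5] at h4
    rw [h3]
    linarith
  have swap : ∀ f : ι → ι → ℝ, ∑ k, ∑ i ∈ univ.erase k, f i k = ∑ k, ∑ i ∈ univ.erase k, f k i := by
    intro f
    have : ∀ g : ι → ι → ℝ, ∑ k, ∑ i ∈ univ.erase k, g i k
        = ∑ k, ∑ i, if i = k then 0 else g i k := by
      intro g
      refine sum_congr rfl fun k _ => ?_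
      rw [← add_sum_erase _ _ (mem_univ k), if_pos rfl, zero_add]
      exact sum_congr rfl fun i hi => by rw [if_neg (ne_of_mem_erase hi)]
    rw [this f, this fun i k => f k i, sum_comm]
    refine sum_congr rfl fun k _ => sum_congr rfl fun i _ => ?_
    simp only [eq_comm]
  -- Two of the three copies of d² come from these mixed products: u₃ₖₖᵢ is, after exchanging i and
  -- k, a diagonal entry of the derivative in the other direction.
  have jac : ∑ k, jacobiTerm lam (p k) 0 k (fun i => b₁ k i i)
      = ∑ k, (b₁ k k k ^ 2 + ∑ i ∈ univ.erase k, b₁ k i i ^ 2 - (∑ i, b₁ k i i) ^ 2)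
        + ∑ k, ∑ i ∈ univ.erase k, (2 * u₃ k k i ^ 2
          - 2 * (p i * lam i * (lam k + lam i) * u₃ k k i)) := by
    have h1 : ∑ k, ∑ i ∈ univ.erase k, (2 * u₃ k k i ^ 2
          - 2 * (p i * lam i * (lam k + lam i) * u₃ k k i))
        = ∑ k, ∑ i ∈ univ.erase k, (2 * b₁ k i i ^ 2
          - 2 * (p k * lam k * (lam i + lam k) * b₁ k i i)) := by
      rw [swap fun i k => 2 * b₁ k i i ^ 2 - 2 * (p k * lam k * (lam i + lam k) * b₁ k i i)]
      refine sum_congr rfl fun k _ => sum_congr rfl fun i hi => ?_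
      have hik : k ≠ i := (ne_of_mem_erase hi).symm
      rw [hb₁, metricDeriv, if_neg hik]
      simp
    rw [h1, ← sum_add_distrib]
    refine sum_congr rfl fun k _ => ?_
    rw [jacobiTerm, sum_sub_distrib, ← mul_sum, ← mul_sum]
    ring
  -- For each i the two sides differ by exactly 2(pᵢλₖλᵢ)².
  have pair : ∀ k, ∑ i ∈ univ.erase k, (2 * u₃ k k i ^ 2
          - 2 * (p i * lam i * (lam k + lam i) * u₃ k k i)) ≤
      2 * ∑ i ∈ univ.erase k, b₁ k k i * b₁ k i k + ∑ i, (lam k - lam i) * (2 * p i) *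
        ((lam k + lam i) * u₃ k k i - lam k ^ 2 * p i * lam i) := by
    intro k
    rw [← add_sum_erase (a := k) univ (fun i => (lam k - lam i) * (2 * p i) *
        ((lam k + lam i) * u₃ k k i - lam k ^ 2 * p i * lam i)) (mem_univ k)]
    simp only [sub_self, zero_mul, zero_add]
    rw [mul_sum, ← sum_add_distrib]
    refine sum_le_sum fun i hi => ?_
    have hik : i ≠ k := ne_of_mem_erase hi
    rw [hb₁, hb₁, metricDeriv, metricDeriv, if_pos rfl, if_neg hik, hs₁ i k k, hs₂ k i k]
    nlinarith only [sq_nonneg (p i * lam k * lam i)]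
  have total : ∑ k, ∑ i, (H - lam i) * b₂ k i = ∑ k, Ψ₂ k
      + ∑ k, (∑ i, ∑ j, b₁ k i j * b₁ k j i - (∑ i, b₁ k i i) ^ 2) := by
    rw [← sum_add_distrib]
    exact sum_congr rfl fun k _ => by rw [← hΨ k]; ring
  have h1 := sum_le_sum fun k (_ : k ∈ univ) => quad k
  have h2 := sum_le_sum fun k (_ : k ∈ univ) => pair k
  simp only [sum_add_distrib, sum_sub_distrib] at h1 h2 jac total comm ⊢
  linarith

end CurvEst

namespace CurvEst

open Finset Filter Topology

variable {ι : Type*} [Fintype ι] [DecidableEq ι]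

/-- The algebraic relations between the derivatives of a solution up to order four, in an
orthonormal frame diagonalizing the Hessian: `u₃` and `u₄` are the third and (some) fourth
derivatives of the solution, `b₁`, `b₂` the first and second derivatives of the Weingarten map and
`a`, `c`, `r` describe the derivatives of the right-hand side. -/
structure EquationJet (C : ℝ) (lam p : ι → ℝ) (H : ℝ) (u₃ : ι → ι → ι → ℝ) (u₄ : ι → ι → ℝ)
    (b₁ : ι → ι → ι → ℝ) (b₂ : ι → ι → ℝ) (a c r : ι → ℝ) : Prop where
  symm₁ : ∀ i j k, u₃ i j k = u₃ j i k
  symm₂ : ∀ i j k, u₃ i j k = u₃ i k j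
  symm₄ : ∀ i k, u₄ i k = u₄ k i
  b₁_eq : ∀ k i j, b₁ k i j = u₃ i j k - metricDeriv lam p k i j * lam j
  b₂_eq : ∀ k i, b₂ k i = u₄ i k
      - (2 * (u₃ i k k * p i) + if i = k then 2 * lam k ^ 2 else 0) * lam i
      - 2 * ∑ j, metricDeriv lam p k i j * b₁ k j i
  first : ∀ k, ∑ i, (H - lam i) * b₁ k i i = a k + c k * lam k
  second : ∀ k, ∑ i, (H - lam i) * b₂ k i + (∑ i, b₁ k i i) ^ 2
      - ∑ i, ∑ j, b₁ k i j * b₁ k j i = ∑ m, c m * u₃ m k k + r k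
  abs_a : ∀ k, |a k| ≤ C
  abs_c : ∀ k, |c k| ≤ C
  abs_r : ∀ k, |r k| ≤ C * (1 + lam k) ^ 2
  abs_p : ∀ k, |p k| ≤ 1

namespace EquationJet

variable {C H : ℝ} {lam p : ι → ℝ} {u₃ : ι → ι → ι → ℝ} {u₄ : ι → ι → ℝ}
  {b₁ : ι → ι → ι → ℝ} {b₂ : ι → ι → ℝ} {a c r : ι → ℝ}

theorem diag (h : EquationJet C lam p H u₃ u₄ b₁ b₂ a c r) (k i : ι) :
    b₁ k i i = u₃ i i k - if i = k then 2 * lam k ^ 2 * p k else 0 := by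
  rw [h.b₁_eq, metricDeriv]
  split_ifs with hik
  · subst hik; ring
  · ring

theorem symm_swap (h : EquationJet C lam p H u₃ u₄ b₁ b₂ a c r) (m k : ι) :
    u₃ m k k = u₃ k k m := by rw [h.symm₁, h.symm₂]

theorem sum_diag (h : EquationJet C lam p H u₃ u₄ b₁ b₂ a c r) (k : ι) :
    ∑ i, u₃ k i i = ∑ i, b₁ k i i + 2 * lam k ^ 2 * p k := by
  simp only [h.diag, sum_sub_distrib, sum_ite_eq', mem_univ, if_true, h.symm_swap k]
  ring

/-- The linearized equation for the first derivatives of the solution. -/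
theorem linearized (h : EquationJet C lam p H u₃ u₄ b₁ b₂ a c r) (k : ι) :
    ∑ i, (H - lam i) * u₃ k i i = a k + (c k + 2 * ((H - lam k) * lam k) * p k) * lam k := by
  have h1 := h.first k
  simp only [h.diag, mul_sub, sum_sub_distrib, mul_ite, mul_zero, sum_ite_eq', mem_univ,
    if_true] at h1
  simp only [h.symm_swap k]
  linarith

end EquationJet

/-- The Jacobi inequality. -/
theorem jacobi_of_equationJet {m M C : ℝ} (hm : 0 < m) (hM : m ≤ M) (hC : 0 ≤ C) :
    ∃ C' H₀ : ℝ, 0 ≤ C' ∧ 1 ≤ H₀ ∧ ∀ (lam : ι → ℝ) (i₀ : ι) (H : ℝ) (p : ι → ℝ)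
      (u₃ : ι → ι → ι → ℝ) (u₄ : ι → ι → ℝ) (b₁ : ι → ι → ι → ℝ) (b₂ : ι → ι → ℝ) (a c r : ι → ℝ),
      Spectrum m M lam i₀ H → H₀ ≤ H → EquationJet C lam p H u₃ u₄ b₁ b₂ a c r →
      5 / 4 * ∑ k, (H - lam k) * (∑ i, b₁ k i i) ^ 2 / H - C' * H ^ 2
        ≤ ∑ k, (H - lam k) * ∑ i, b₂ k i := by
  obtain ⟨C₁, H₁, hC₁, hH₁, key⟩ := jacobi (ι := ι) hm hM (C := 2 * C) (by positivity)
  refine ⟨C₁ + Fintype.card ι * (6 * C), H₁, by positivity, hH₁, ?_⟩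
  intro lam i₀ H p u₃ u₄ b₁ b₂ a c r hS hH h
  have hH1 : 1 ≤ H := hH₁.trans hH
  have hH0 : 0 < H := by linarith
  -- The first derivative of the right-hand side grows linearly in λₖ ≤ H, so its quotient by H is
  -- at most 2C.
  have h1 := key lam i₀ H p c (fun k => (a k + c k * lam k) / H) (fun i k => b₁ k i i) hS hH
    h.abs_p (fun k => (h.abs_c k).trans (by linarith))
    (fun k => by
      rw [abs_div, abs_of_pos hH0, div_le_iff₀ hH0]
      have e1 := abs_add_le (a k) (c k * lam k)
      have e2 : |c k * lam k| ≤ C * H := by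
        rw [abs_mul, abs_of_nonneg (hS.nonneg k)]
        exact mul_le_mul (h.abs_c k) (hS.le_H k) (hS.nonneg k) hC
      have e3 : C ≤ C * H := le_mul_of_one_le_right hC hH1
      linarith [h.abs_a k])
    (fun k => by rw [h.first]; field_simp)
  have h2 := sum_second_trace_ge (Ψ₂ := fun k => ∑ m, c m * u₃ m k k + r k) h.symm₁ h.symm₂ h.symm₄
    h.b₁_eq h.b₂_eq h.second
  have h3 : ∀ k, jacobiTerm lam (p k) (c k) k (fun i => b₁ k i i)
      = jacobiTerm lam (p k) 0 k (fun i => b₁ k i i) + c k * ∑ i, b₁ k i i := by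
    intro k; rw [jacobiTerm, jacobiTerm]; ring
  simp only [h3, sum_add_distrib] at h1
  -- The third derivatives on the right-hand side reassemble into Σ cₖ Hₖ up to O(H²). That is the
  -- linear term of `jacobiTerm`.
  have h4 : ∑ k, ∑ m, c m * u₃ m k k
      = ∑ k, c k * ∑ i, b₁ k i i + ∑ k, c k * (2 * lam k ^ 2 * p k) := by
    rw [sum_comm, ← sum_add_distrib]
    refine sum_congr rfl fun k _ => ?_
    rw [← mul_sum, h.sum_diag, mul_add]
  have h5 : -(Fintype.card ι * (2 * C * H ^ 2)) ≤ ∑ k, c k * (2 * lam k ^ 2 * p k) := by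
    have : ∀ k ∈ (univ : Finset ι), -(2 * C * H ^ 2) ≤ c k * (2 * lam k ^ 2 * p k) := by
      intro k _
      refine (neg_le_neg ?_).trans (neg_abs_le _)
      rw [abs_mul, abs_mul, abs_of_nonneg (by positivity : 0 ≤ 2 * lam k ^ 2)]
      have e1 : lam k ^ 2 ≤ H ^ 2 := pow_le_pow_left₀ (hS.nonneg k) (hS.le_H k) 2
      calc |c k| * (2 * lam k ^ 2 * |p k|) ≤ C * (2 * H ^ 2 * 1) := by
            have := h.abs_c k
            have := h.abs_p k
            gcongr
        _ = _ := by ring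
    refine le_trans (le_of_eq ?_) (sum_le_sum this)
    rw [sum_const, card_univ, nsmul_eq_mul]; ring
  have h6 : -(Fintype.card ι * (4 * C * H ^ 2)) ≤ ∑ k, r k := by
    have : ∀ k ∈ (univ : Finset ι), -(4 * C * H ^ 2) ≤ r k := by
      intro k _
      refine (neg_le_neg ((h.abs_r k).trans ?_)).trans (neg_abs_le _)
      have e1 : (1 + lam k) ^ 2 ≤ (2 * H) ^ 2 :=
        pow_le_pow_left₀ (by linarith [hS.nonneg k]) (by linarith [hS.le_H k]) 2
      calc C * (1 + lam k) ^ 2 ≤ C * (2 * H) ^ 2 := by gcongr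
        _ = _ := by ring
    refine le_trans (le_of_eq ?_) (sum_le_sum this)
    rw [sum_const, card_univ, nsmul_eq_mul]; ring
  simp only [sum_add_distrib] at h2
  linarith

end CurvEst

/-! ### Linear algebra of the graph metric and its diagonalizing frames. -/

namespace CurvEst

open Finset Matrix

section Frame

theorem dotProduct_self_nonneg' {ι : Type*} [Fintype ι] (p : ι → ℝ) : 0 ≤ p ⬝ᵥ p :=
  sum_nonneg fun i _ => mul_self_nonneg (p i)

/-- The metric `1 + p pᵀ` of a graph with gradient `p`. -/
def metricMat {ι : Type*} [DecidableEq ι] (p : ι → ℝ) : Matrix ι ι ℝ := 1 + vecMulVec p p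

theorem transpose_metricMat {ι : Type*} [DecidableEq ι] (p : ι → ℝ) : (metricMat p)ᵀ = metricMat p := by
  rw [metricMat, transpose_add, transpose_one, transpose_vecMulVec]

variable {ι : Type*} [Fintype ι] [DecidableEq ι]

/-- The inverse of the metric of a graph with gradient `p`. -/
noncomputable def metricInv (p : ι → ℝ) : Matrix ι ι ℝ := 1 - (1 + p ⬝ᵥ p)⁻¹ • vecMulVec p p

theorem one_add_smul_vecMulVec_mul (p : ι → ℝ) (a b : ℝ) :
    (1 + a • vecMulVec p p) * (1 + b • vecMulVec p p)
      = 1 + (a + b + a * b * (p ⬝ᵥ p)) • vecMulVec p p := by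
  have h : vecMulVec p p * vecMulVec p p = (p ⬝ᵥ p) • vecMulVec p p := by
    rw [vecMulVec_mul_vecMulVec]
    ext i j; simp [vecMulVec_apply]; ring
  rw [add_mul, mul_add, mul_add, smul_mul_smul_comm, h]
  simp only [mul_one, one_mul]
  module

theorem metricMat_mul_metricInv (p : ι → ℝ) : metricMat p * metricInv p = 1 := by
  have h := one_add_smul_vecMulVec_mul p 1 (-(1 + p ⬝ᵥ p)⁻¹)
  have h0 : 1 + p ⬝ᵥ p ≠ 0 := by have := dotProduct_self_nonneg' p; positivity
  have h1 : 1 + -(1 + p ⬝ᵥ p)⁻¹ + 1 * -(1 + p ⬝ᵥ p)⁻¹ * (p ⬝ᵥ p) = 0 := by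
    field_simp; ring
  rw [h1, zero_smul, add_zero, one_smul, neg_smul, ← sub_eq_add_neg] at h
  exact h

theorem inv_metricMat (p : ι → ℝ) : (metricMat p)⁻¹ = metricInv p :=
  inv_eq_right_inv (metricMat_mul_metricInv p)

/-- An orthonormal frame (the columns of `E`) for the metric of the graph that diagonalizes the
symmetric matrix `A`. -/
theorem exists_frame (p : ι → ℝ) {A : Matrix ι ι ℝ} (hA : Aᵀ = A) :
    ∃ (E : Matrix ι ι ℝ) (lam : ι → ℝ), Eᵀ * metricMat p * E = 1 ∧ Eᵀ * A * E = diagonal lam := by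
  set s := p ⬝ᵥ p with hs
  have hs0 : 0 ≤ s := dotProduct_self_nonneg' p
  set W := √(1 + s) with hW
  have hW0 : 0 < W := Real.sqrt_pos.mpr (by linarith)
  have hWs : s = W ^ 2 - 1 := by rw [hW, Real.sq_sqrt (by linarith)]; ring
  -- S is the inverse square root of 1 + ppᵀ. Diagonalizing SAS by an orthogonal U, the frame SU is
  -- orthonormal for the metric and diagonalizes A.
  set S : Matrix ι ι ℝ := 1 + (-(1 / (W * (1 + W)))) • vecMulVec p p with hSdef
  have hST : Sᵀ = S := by
    rw [hSdef, transpose_add, transpose_one, transpose_smul, transpose_vecMulVec]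
  have hSgS : S * metricMat p * S = 1 := by
    have h1 : metricMat p = 1 + (1 : ℝ) • vecMulVec p p := by rw [one_smul]; rfl
    rw [h1, hSdef, one_add_smul_vecMulVec_mul, one_add_smul_vecMulVec_mul, ← hs, hWs]
    convert add_zero (1 : Matrix ι ι ℝ)
    convert zero_smul ℝ (vecMulVec p p)
    field_simp
    ring
  have hherm : (S * A * S).IsHermitian := by
    rw [IsHermitian, conjTranspose_eq_transpose_of_trivial, transpose_mul, transpose_mul, hST, hA,
      Matrix.mul_assoc]
  obtain ⟨U, hU⟩ : ∃ U : Matrix ι ι ℝ, U = hherm.eigenvectorUnitary := ⟨_, rfl⟩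
  have hUU : Uᵀ * U = 1 := by
    have := Unitary.coe_star_mul_self hherm.eigenvectorUnitary
    rw [← hU, star_eq_conjTranspose, conjTranspose_eq_transpose_of_trivial] at this
    exact this
  have hspec : S * A * S = U * diagonal hherm.eigenvalues * Uᵀ := by
    have := hherm.spectral_theorem
    rw [Unitary.conjStarAlgAut_apply, ← hU, star_eq_conjTranspose,
      conjTranspose_eq_transpose_of_trivial] at this
    exact this
  obtain ⟨lam, hlam⟩ : ∃ lam, lam = hherm.eigenvalues := ⟨_, rfl⟩
  rw [← hlam] at hspec
  refine ⟨S * U, lam, ?_, ?_⟩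
  · rw [transpose_mul, hST]
    calc Uᵀ * S * metricMat p * (S * U) = Uᵀ * (S * metricMat p * S) * U := by
          simp only [Matrix.mul_assoc]
      _ = 1 := by rw [hSgS, Matrix.mul_one, hUU]
  · rw [transpose_mul, hST]
    calc Uᵀ * S * A * (S * U) = Uᵀ * (S * A * S) * U := by simp only [Matrix.mul_assoc]
      _ = (Uᵀ * U) * diagonal lam * (Uᵀ * U) := by
          rw [hspec]; simp only [Matrix.mul_assoc]
      _ = _ := by rw [hUU, Matrix.one_mul, Matrix.mul_one]

variable {p : ι → ℝ} {E A : Matrix ι ι ℝ} {lam : ι → ℝ}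

theorem frame_mul (hE : Eᵀ * metricMat p * E = 1) : E * (metricMat p * E)ᵀ = 1 := by
  rw [transpose_mul, transpose_metricMat]
  exact mul_eq_one_comm.mp hE

theorem metricInv_eq (hE : Eᵀ * metricMat p * E = 1) : metricInv p = E * Eᵀ := by
  have h := frame_mul hE
  rw [transpose_mul, transpose_metricMat, ← Matrix.mul_assoc] at h
  calc metricInv p = (E * Eᵀ * metricMat p) * metricInv p := by rw [h, Matrix.one_mul]
    _ = E * Eᵀ := by rw [Matrix.mul_assoc, metricMat_mul_metricInv, Matrix.mul_one]

theorem metricInv_mul_eq (hE : Eᵀ * metricMat p * E = 1) (hA : Eᵀ * A * E = diagonal lam) :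
    metricInv p * A = E * diagonal lam * (metricMat p * E)ᵀ := by
  rw [metricInv_eq hE, ← hA]
  calc E * Eᵀ * A = E * Eᵀ * A * (E * (metricMat p * E)ᵀ) := by
        rw [frame_mul hE, Matrix.mul_one]
    _ = _ := by simp only [Matrix.mul_assoc]

theorem trace_metricInv_mul (hE : Eᵀ * metricMat p * E = 1) (hA : Eᵀ * A * E = diagonal lam) :
    (metricInv p * A).trace = ∑ i, lam i := by
  rw [metricInv_mul_eq hE hA, Matrix.mul_assoc, Matrix.trace_mul_comm, Matrix.mul_assoc,
    transpose_mul, transpose_metricMat, hE, Matrix.mul_one, trace_diagonal]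

theorem trace_metricInv_mul_sq (hE : Eᵀ * metricMat p * E = 1) (hA : Eᵀ * A * E = diagonal lam) :
    (metricInv p * A * (metricInv p * A)).trace = ∑ i, lam i ^ 2 := by
  have h1 : (metricMat p * E)ᵀ * E = 1 := by rw [transpose_mul, transpose_metricMat]; exact hE
  rw [metricInv_mul_eq hE hA]
  calc (E * diagonal lam * (metricMat p * E)ᵀ * (E * diagonal lam * (metricMat p * E)ᵀ)).trace
      = (E * (diagonal lam * ((metricMat p * E)ᵀ * E) * diagonal lam * (metricMat p * E)ᵀ)).trace := by
        simp only [Matrix.mul_assoc]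
    _ = (diagonal lam * diagonal lam * ((metricMat p * E)ᵀ * E)).trace := by
        rw [Matrix.trace_mul_comm]
        simp only [h1, Matrix.mul_assoc, Matrix.mul_one]
    _ = ∑ i, lam i ^ 2 := by
        rw [h1, Matrix.mul_one, diagonal_mul_diagonal, trace_diagonal]
        exact sum_congr rfl fun i _ => by ring

/-- Cyclic invariance of the characteristic polynomial moves E to the right, where it cancels
against the dual frame (gE)ᵀ. -/
theorem roots_charpoly_smul (hE : Eᵀ * metricMat p * E = 1) (hA : Eᵀ * A * E = diagonal lam)
    (w : ℝ) : (w • (metricInv p * A)).charpoly.roots = univ.val.map fun i => w * lam i := by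
  have h1 : w • (metricInv p * A) = E * (diagonal (fun i => w * lam i) * (metricMat p * E)ᵀ) := by
    rw [metricInv_mul_eq hE hA, ← Matrix.mul_assoc, ← smul_mul_assoc, ← mul_smul_comm]
    congr 2
    ext i j; simp [diagonal_apply]
  rw [h1, charpoly_mul_comm, Matrix.mul_assoc, transpose_mul, transpose_metricMat, hE,
    Matrix.mul_one, charpoly_diagonal]
  have h2 : ∏ i, (Polynomial.X - Polynomial.C (w * lam i))
      = ((univ.val.map fun i => w * lam i).map fun a => Polynomial.X - Polynomial.C a).prod := by
    rw [Multiset.map_map]; rfl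
  rw [h2, Polynomial.roots_multiset_prod_X_sub_C]

end Frame

theorem two_mul_esymm_two (s : Multiset ℝ) :
    2 * s.esymm 2 = s.sum ^ 2 - (s.map fun x => x ^ 2).sum := by
  induction s using Multiset.induction_on with
  | empty => simp [Multiset.esymm, Multiset.powersetCard_zero_right]
  | cons a s ih =>
    have h : (a ::ₘ s).esymm 2 = s.esymm 2 + a * s.sum := by
      simp only [Multiset.esymm]
      rw [Multiset.powersetCard_cons, Multiset.map_add, Multiset.sum_add,
        Multiset.powersetCard_one, Multiset.map_map, Multiset.map_map]
      have h2 := Multiset.sum_map_mul_left (s := s) (a := a) (f := fun x => x)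
      rw [Multiset.map_id'] at h2
      simp [h2]
    rw [h, mul_add, ih, Multiset.sum_cons, Multiset.map_cons, Multiset.sum_cons]
    ring

end CurvEst

/-! ### Geometry of the graph in terms of the gradient and Hessian of u. -/

noncomputable section

namespace CurvEst

open Finset Matrix Filter Topology

variable {n : ℕ}

theorem inner_pair (v w : Base n) (s t : ℝ) :
    inner ℝ (pair v s) (pair w t) = inner ℝ v w + s * t := by
  simp only [PiLp.inner_apply, Fin.sum_univ_castSucc, pair, Fin.snoc_castSucc, Fin.snoc_last]
  simp [mul_comm]

theorem norm_pair_sq (v : Base n) (t : ℝ) : ‖pair v t‖ ^ 2 = ‖v‖ ^ 2 + t ^ 2 := by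
  rw [← real_inner_self_eq_norm_sq, inner_pair, real_inner_self_eq_norm_sq, sq t]

/-- `pair` as a continuous linear map. -/
def pairL (n : ℕ) : Base n × ℝ →L[ℝ] Ambient n :=
  LinearMap.toContinuousLinearMap
    { toFun := fun q => pair q.1 q.2
      map_add' := fun q q' => by
        ext i
        refine Fin.lastCases ?_ (fun j => ?_) i <;> simp [pair]
      map_smul' := fun c q => by
        ext i
        refine Fin.lastCases ?_ (fun j => ?_) i <;> simp [pair] }

@[simp] theorem pairL_apply (q : Base n × ℝ) : pairL n q = pair q.1 q.2 := rfl

/-- The vector of first partial derivatives. -/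
def gradVec (u : Base n → ℝ) (x : Base n) (i : Fin n) : ℝ := dd (coordVec i) u x

/-- The matrix of second partial derivatives. -/
def hess (u : Base n → ℝ) (x : Base n) : Matrix (Fin n) (Fin n) ℝ :=
  Matrix.of fun i j => dd (coordVec j) (dd (coordVec i) u) x

theorem inner_gradient (u : Base n → ℝ) (x v : Base n) :
    inner ℝ (gradient u x) v = dd v u x := inner_gradient_left

theorem gradient_apply (u : Base n → ℝ) (x : Base n) (i : Fin n) :
    gradient u x i = gradVec u x i := by
  rw [gradVec, ← inner_gradient, coordVec, EuclideanSpace.inner_single_right]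
  simp

theorem norm_gradient_sq (u : Base n → ℝ) (x : Base n) :
    ‖gradient u x‖ ^ 2 = gradVec u x ⬝ᵥ gradVec u x := by
  rw [EuclideanSpace.norm_sq_eq]
  exact sum_congr rfl fun i _ => by rw [gradient_apply, Real.norm_eq_abs, sq_abs, sq]

/-- The area element `√(1 + |∇u|²)`. -/
def areaElt (u : Base n → ℝ) (x : Base n) : ℝ := √(1 + gradVec u x ⬝ᵥ gradVec u x)

theorem areaElt_sq (u : Base n → ℝ) (x : Base n) :
    areaElt u x ^ 2 = 1 + gradVec u x ⬝ᵥ gradVec u x :=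
  Real.sq_sqrt (by have := dotProduct_self_nonneg' (gradVec u x); linarith)

theorem areaElt_pos (u : Base n → ℝ) (x : Base n) : 0 < areaElt u x :=
  Real.sqrt_pos.mpr (by have := dotProduct_self_nonneg' (gradVec u x); linarith)

theorem one_le_areaElt (u : Base n → ℝ) (x : Base n) : 1 ≤ areaElt u x :=
  Real.one_le_sqrt.mpr (by have := dotProduct_self_nonneg' (gradVec u x); linarith)

theorem norm_rawNormal (u : Base n → ℝ) (x : Base n) : ‖rawNormal u x‖ = areaElt u x := by
  rw [← sq_eq_sq₀ (norm_nonneg _) (areaElt_pos u x).le, areaElt_sq, rawNormal, norm_pair_sq,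
    norm_gradient_sq]
  ring

theorem normal_eq (u : Base n → ℝ) (x : Base n) :
    (normal u x : Ambient n) = (areaElt u x)⁻¹ • rawNormal u x := by
  rw [← norm_rawNormal]; rfl

variable {u : Base n → ℝ} {x : Base n}

theorem fderiv_position (hu : DifferentiableAt ℝ u x) :
    HasFDerivAt (position u)
      ((pairL n).comp ((ContinuousLinearMap.id ℝ (Base n)).prod (fderiv ℝ u x))) x :=
  (pairL n).hasFDerivAt.comp x ((hasFDerivAt_id x).prodMk hu.hasFDerivAt)

theorem firstForm_eq (hu : DifferentiableAt ℝ u x) : firstForm u x = metricMat (gradVec u x) := by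
  ext i j
  rw [firstForm, Matrix.of_apply, (fderiv_position hu).fderiv]
  simp only [ContinuousLinearMap.comp_apply, ContinuousLinearMap.prod_apply, pairL_apply,
    ContinuousLinearMap.id_apply, inner_pair]
  rw [metricMat, Matrix.add_apply, vecMulVec_apply, Matrix.one_apply]
  congr 1
  simp [coordVec, EuclideanSpace.inner_single_left, PiLp.single_apply]

/-- The second derivative of the position vector is vertical, (0, D²u), and the last component of
the normal is -1/W. -/
theorem secondForm_eq (hu : ContDiffAt ℝ 2 u x) :
    secondForm u x = (areaElt u x)⁻¹ • hess u x := by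
  have h1 : ∀ᶠ y in 𝓝 x, DifferentiableAt ℝ u y :=
    (hu.eventually (by simp)).mono fun y hy => hy.differentiableAt (by simp)
  have h2 : fderiv ℝ (position u) =ᶠ[𝓝 x] fun y =>
      (pairL n).comp ((ContinuousLinearMap.id ℝ (Base n)).prod (fderiv ℝ u y)) :=
    h1.mono fun y hy => (fderiv_position hy).fderiv
  have h3 : ∀ v w : Base n, fderiv ℝ (fderiv ℝ (position u)) x v w
      = pair 0 (dd v (dd w u) x) := by
    intro v w
    have hd : DifferentiableAt ℝ (fderiv ℝ u) x :=
      (hu.fderiv_right (m := 1) (by norm_num)).differentiableAt (by simp)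
    have e1 : HasFDerivAt (fun y => (pairL n).comp
        ((ContinuousLinearMap.id ℝ (Base n)).prod (fderiv ℝ u y)))
        (fderiv ℝ (fderiv ℝ (position u)) x) x := by
      rw [h2.fderiv_eq]
      refine DifferentiableAt.hasFDerivAt ?_
      have : (fun y => (pairL n).comp ((ContinuousLinearMap.id ℝ (Base n)).prod (fderiv ℝ u y)))
          = fun y => (pairL n).comp (ContinuousLinearMap.inl ℝ (Base n) ℝ)
            + ((pairL n).comp (ContinuousLinearMap.inr ℝ (Base n) ℝ)).comp (fderiv ℝ u y) := by
        ext1 y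
        refine ContinuousLinearMap.ext fun z => ?_
        simp only [ContinuousLinearMap.comp_apply, _root_.add_apply, ← map_add]
        simp
      rw [this]
      exact (differentiableAt_const _).add ((differentiableAt_const _).clm_comp hd)
    have e2 := (ContinuousLinearMap.apply ℝ (Ambient n) w).hasFDerivAt.comp x e1
    have e3 : HasFDerivAt (fun y => pairL n (w, dd w u y))
        ((pairL n).comp ((0 : Base n →L[ℝ] Base n).prod (fderiv ℝ (dd w u) x))) x := by
      have hdw : DifferentiableAt ℝ (dd w u) x := hd.clm_apply (differentiableAt_const _)
      exact (pairL n).hasFDerivAt.comp x ((hasFDerivAt_const w x).prodMk hdw.hasFDerivAt)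
    have e4 := e2.unique e3
    have e5 := DFunLike.congr_fun e4 v
    simpa [dd] using e5
  ext i j
  rw [secondForm, Matrix.of_apply, iteratedFDeriv_two_apply, h3, normal_eq, inner_smul_right,
    rawNormal, inner_pair]
  have h4 : dd (coordVec i) (dd (coordVec j) u) x = dd (coordVec j) (dd (coordVec i) u) x :=
    dd_comm hu _ _
  simp [hess, h4]

theorem transpose_hess (hu : ContDiffAt ℝ 2 u x) : (hess u x)ᵀ = hess u x := by
  ext i j
  exact dd_comm hu _ _

/-- The vector of `ℝⁿ` with components in the `i`-th column of `E`. -/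
def frameVec (E : Matrix (Fin n) (Fin n) ℝ) (i : Fin n) : Base n := ∑ α, E α i • coordVec α

theorem dd_frameVec (E : Matrix (Fin n) (Fin n) ℝ) (i : Fin n) (F : Base n → ℝ) :
    dd (frameVec E i) F x = ∑ α, E α i * dd (coordVec α) F x := dd_sum_smul _ _ _

theorem dd_dd_frameVec (hu : ContDiffAt ℝ 2 u x) (E : Matrix (Fin n) (Fin n) ℝ) (i j : Fin n) :
    dd (frameVec E j) (dd (frameVec E i) u) x = (Eᵀ * hess u x * E) i j := by
  rw [dd_frameVec, Matrix.mul_apply]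
  refine sum_congr rfl fun β _ => ?_
  rw [dd_comm hu, dd_frameVec, Matrix.mul_apply, mul_comm]
  congr 1
  exact sum_congr rfl fun α _ => by
    rw [hess, Matrix.transpose_apply, Matrix.of_apply, dd_comm hu]

/-- By midpoint convexity u(x + tv) + u(x - tv) has a minimum at t = 0, where its second derivative
is twice the one sought. -/
theorem dd_dd_nonneg {s : Set (Base n)} (hs : s ∈ 𝓝 x) (hconv : ConvexOn ℝ s u)
    (hu : ContDiffAt ℝ 2 u x) (v : Base n) : 0 ≤ dd v (dd v u) x := by
  have h1 := HasJet.of_contDiffAt hu v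
  have h2 := HasJet.of_contDiffAt hu (-v)
  have h3 := h1.add h2
  have h4 : dd (-v) (dd (-v) u) x = dd v (dd v u) x := by
    have e : dd (-v) u = fun y => -dd v u y := by ext y; simp [dd]
    rw [e]
    simp only [dd, map_neg]
    rw [show (fun y => -fderiv ℝ u y v) = -(fun y => fderiv ℝ u y v) from rfl, fderiv_neg]
    simp only [_root_.neg_neg, _root_.neg_apply]
    rfl
  have hcont : ∀ w : Base n, ∀ᶠ t : ℝ in 𝓝 0, x + t • w ∈ s := by
    intro w
    have : ContinuousAt (fun t : ℝ => x + t • w) 0 := by fun_prop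
    exact this.eventually_mem (by simpa using hs)
  have h5 : IsLocalMin (fun t : ℝ => u (x + t • v) + u (x + t • (-v))) 0 := by
    filter_upwards [hcont v, hcont (-v)] with t ht1 ht2
    have := hconv.2 ht1 ht2 (by norm_num : (0 : ℝ) ≤ 1 / 2) (by norm_num : (0 : ℝ) ≤ 1 / 2)
      (by norm_num)
    have e : (1 / 2 : ℝ) • (x + t • v) + (1 / 2 : ℝ) • (x + t • -v) = x := by module
    rw [e] at this
    simp only [zero_smul, add_zero, smul_eq_mul] at this ⊢
    linarith
  have h6 := (h3.const_smul (-1)).isLocalMax (by simpa using h5.neg)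
  rw [h4] at h6
  have := h6.2
  simp only [smul_eq_mul] at this
  linarith

/-- The trace of `g⁻¹ D²u`, which is the mean curvature times the area element. -/
def traceHess (u : Base n → ℝ) (x : Base n) : ℝ := (metricInv (gradVec u x) * hess u x).trace

/-- The trace of the square of `g⁻¹ D²u`. -/
def traceHessSq (u : Base n → ℝ) (x : Base n) : ℝ :=
  (metricInv (gradVec u x) * hess u x * (metricInv (gradVec u x) * hess u x)).trace

theorem weingarten_eq (hu : ContDiffAt ℝ 2 u x) :
    weingarten u x = (areaElt u x)⁻¹ • (metricInv (gradVec u x) * hess u x) := by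
  rw [weingarten, firstForm_eq (hu.differentiableAt (by simp)), secondForm_eq hu, inv_metricMat,
    mul_smul_comm]

variable {E : Matrix (Fin n) (Fin n) ℝ} {lam : Fin n → ℝ}

theorem principalCurvatures_eq (hu : ContDiffAt ℝ 2 u x)
    (hE : Eᵀ * metricMat (gradVec u x) * E = 1) (hA : Eᵀ * hess u x * E = diagonal lam) :
    principalCurvatures u x = univ.val.map fun i => (areaElt u x)⁻¹ * lam i := by
  rw [principalCurvatures, weingarten_eq hu, roots_charpoly_smul hE hA]

/-- Replaces roots of the characteristic polynomial by traces, which can be differentiated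
regardless of multiplicities. -/
theorem two_mul_sigmaTwo (hu : ContDiffAt ℝ 2 u x) :
    2 * (areaElt u x ^ 2 * sigmaTwo u x) = traceHess u x ^ 2 - traceHessSq u x := by
  obtain ⟨E, lam, hE, hA⟩ := exists_frame (gradVec u x) (transpose_hess hu)
  have hW := areaElt_pos u x
  rw [sigmaTwo, mul_left_comm, two_mul_esymm_two, principalCurvatures_eq hu hE hA, traceHess,
    traceHessSq, trace_metricInv_mul hE hA, trace_metricInv_mul_sq hE hA, Multiset.map_map]
  change areaElt u x ^ 2 * ((∑ i, (areaElt u x)⁻¹ * lam i) ^ 2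
    - ∑ i, ((areaElt u x)⁻¹ * lam i) ^ 2) = _
  rw [← mul_sum]
  simp only [mul_pow, ← mul_sum]
  field_simp

theorem nonneg_of_frame {s : Set (Base n)} (hs : s ∈ 𝓝 x) (hconv : ConvexOn ℝ s u)
    (hu : ContDiffAt ℝ 2 u x) (hA : Eᵀ * hess u x * E = diagonal lam) (i : Fin n) :
    0 ≤ lam i := by
  have h := dd_dd_nonneg hs hconv hu (frameVec E i)
  rwa [dd_dd_frameVec hu, hA, diagonal_apply_eq] at h

/-- By convexity each eigenvalue is at most the trace, and κᵢ = λᵢ/W with W ≥ 1. -/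
theorem abs_principalCurvature_le {s : Set (Base n)} (hs : s ∈ 𝓝 x) (hconv : ConvexOn ℝ s u)
    (hu : ContDiffAt ℝ 2 u x) {κ : ℝ} (hκ : κ ∈ principalCurvatures u x) :
    |κ| ≤ traceHess u x := by
  obtain ⟨E, lam, hE, hA⟩ := exists_frame (gradVec u x) (transpose_hess hu)
  rw [principalCurvatures_eq hu hE hA] at hκ
  obtain ⟨i, -, rfl⟩ := Multiset.mem_map.mp hκ
  have h0 := nonneg_of_frame hs hconv hu hA
  rw [traceHess, trace_metricInv_mul hE hA, abs_mul, abs_of_nonneg (h0 i),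
    abs_of_pos (inv_pos.mpr (areaElt_pos u x))]
  calc (areaElt u x)⁻¹ * lam i ≤ 1 * lam i := by
        gcongr
        · exact h0 i
        · exact inv_le_one_of_one_le₀ (one_le_areaElt u x)
    _ = lam i := one_mul _
    _ ≤ ∑ i, lam i := single_le_sum (fun j _ => h0 j) (mem_univ i)

end CurvEst

end

/-! ### Frames at a point and the jets of gradient and right-hand side. -/

noncomputable section

namespace CurvEst

open Finset Matrix Filter Topology

theorem HasJet.clm {V W : Type*} [NormedAddCommGroup V] [NormedSpace ℝ V] [NormedAddCommGroup W]
    [NormedSpace ℝ W] {f : ℝ → V} {a b c : V} (hf : HasJet f a b c) (L : V →L[ℝ] W) :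
    HasJet (fun t => L (f t)) (L a) (L b) (L c) := by
  obtain ⟨f', hf', rfl, rfl, hf2⟩ := hf
  refine ⟨fun t => L (f' t), ?_, rfl, rfl, L.hasFDerivAt.comp_hasDerivAt 0 hf2⟩
  filter_upwards [hf'] with t h1 using L.hasFDerivAt.comp_hasDerivAt t h1

theorem HasJet.inner_mul {V : Type*} [NormedAddCommGroup V] [InnerProductSpace ℝ V]
    {f g : ℝ → V} {a b c a₂ b₂ c₂ : V} (hf : HasJet f a b c) (hg : HasJet g a₂ b₂ c₂) :
    HasJet (fun t => inner ℝ (f t) (g t)) (inner ℝ a a₂) (inner ℝ b a₂ + inner ℝ a b₂)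
      (inner ℝ c a₂ + 2 * inner ℝ b b₂ + inner ℝ a c₂) := by
  obtain ⟨f', hf', rfl, rfl, hf2⟩ := hf
  obtain ⟨g', hg', rfl, rfl, hg2⟩ := hg
  refine ⟨fun t => inner ℝ (f' t) (g t) + inner ℝ (f t) (g' t), ?_, rfl, rfl, ?_⟩
  · filter_upwards [hf', hg'] with t h1 h2 using (h1.inner ℝ h2).congr_deriv (add_comm _ _)
  · exact ((hf2.inner ℝ hg'.self_of_nhds).add (hf'.self_of_nhds.inner ℝ hg2)).congr_deriv (by ring)

variable {n : ℕ}

/-- The columns of `E` are an orthonormal frame, for the metric of the graph of `u` at `x`, that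
diagonalizes the Hessian, with eigenvalues `lam`. -/
structure FrameAt (u : Base n → ℝ) (x : Base n) (E : Matrix (Fin n) (Fin n) ℝ) (lam : Fin n → ℝ) :
    Prop where
  orth : Eᵀ * metricMat (gradVec u x) * E = 1
  diag : Eᵀ * hess u x * E = diagonal lam

namespace FrameAt

variable {u : Base n → ℝ} {x : Base n} {E : Matrix (Fin n) (Fin n) ℝ} {lam : Fin n → ℝ}

/-- The columns of gE form the dual frame, since E(gE)ᵀ = 1. -/
theorem coordVec_eq (h : FrameAt u x E lam) (α : Fin n) :
    coordVec α = ∑ m, (metricMat (gradVec u x) * E) α m • frameVec E m := by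
  have h1 : (metricMat (gradVec u x) * E) * Eᵀ = 1 := by
    rw [← transpose_transpose (metricMat (gradVec u x) * E), ← transpose_mul, frame_mul h.orth,
      transpose_one]
  simp only [frameVec, smul_sum, smul_smul]
  rw [sum_comm]
  simp only [← sum_smul]
  have h2 : ∀ β, ∑ m, (metricMat (gradVec u x) * E) α m * E β m = (1 : Matrix _ _ ℝ) α β := by
    intro β; rw [← h1, Matrix.mul_apply]; rfl
  simp [h2, Matrix.one_apply]

theorem dd_coordVec (h : FrameAt u x E lam) (α : Fin n) (F : Base n → ℝ) :
    dd (coordVec α) F x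
      = ∑ m, (metricMat (gradVec u x) * E) α m * dd (frameVec E m) F x := by
  rw [h.coordVec_eq, dd_sum_smul]

theorem dd_dd (h : FrameAt u x E lam) (hu : ContDiffAt ℝ 2 u x) (i j : Fin n) :
    dd (frameVec E j) (dd (frameVec E i) u) x = if i = j then lam i else 0 := by
  rw [dd_dd_frameVec hu, h.diag, diagonal_apply]

theorem gram (h : FrameAt u x E lam) (i j : Fin n) :
    (Eᵀ * E) i j + dd (frameVec E i) u x * dd (frameVec E j) u x = if i = j then 1 else 0 := by
  have h1 := congrFun (congrFun h.orth i) j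
  rw [Matrix.one_apply, metricMat, Matrix.mul_add, Matrix.mul_one, Matrix.add_mul,
    Matrix.add_apply] at h1
  rw [← h1]
  congr 1
  rw [mul_vecMulVec, vecMulVec_mul, vecMulVec_apply, dd_frameVec, dd_frameVec]
  congr 1
  exact sum_congr rfl fun α _ => mul_comm _ _

theorem frameVec_apply (E : Matrix (Fin n) (Fin n) ℝ) (i α : Fin n) : frameVec E i α = E α i := by
  simp [frameVec, coordVec, Pi.single_apply]

theorem norm_frameVec_sq (E : Matrix (Fin n) (Fin n) ℝ) (i : Fin n) :
    ‖frameVec E i‖ ^ 2 = (Eᵀ * E) i i := by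
  rw [EuclideanSpace.norm_sq_eq, Matrix.mul_apply]
  refine sum_congr rfl fun α _ => ?_
  rw [frameVec_apply, Real.norm_eq_abs, sq_abs, sq]; rfl

theorem norm_sq_add (h : FrameAt u x E lam) (i : Fin n) :
    ‖frameVec E i‖ ^ 2 + dd (frameVec E i) u x ^ 2 = 1 := by
  rw [norm_frameVec_sq, sq (dd _ _ _), h.gram, if_pos rfl]

theorem norm_le (h : FrameAt u x E lam) (i : Fin n) : ‖frameVec E i‖ ≤ 1 := by
  have := h.norm_sq_add i
  have h2 := sq_nonneg (dd (frameVec E i) u x)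
  exact (sq_le_one_iff₀ (norm_nonneg _)).mp (by linarith)

theorem abs_dd_le (h : FrameAt u x E lam) (i : Fin n) : |dd (frameVec E i) u x| ≤ 1 := by
  have := h.norm_sq_add i
  have h2 := sq_nonneg ‖frameVec E i‖
  rw [← sq_abs (dd _ _ _)] at this
  exact (sq_le_one_iff₀ (abs_nonneg _)).mp (by linarith)

theorem dual_eq (u : Base n → ℝ) (x : Base n) (E : Matrix (Fin n) (Fin n) ℝ) (i : Fin n) :
    frameVec (metricMat (gradVec u x) * E) i
      = frameVec E i + dd (frameVec E i) u x • gradient u x := by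
  ext α
  rw [PiLp.add_apply, PiLp.smul_apply, frameVec_apply, frameVec_apply, gradient_apply, metricMat,
    Matrix.add_mul, Matrix.one_mul, Matrix.add_apply, vecMulVec_mul, vecMulVec_apply, dd_frameVec,
    smul_eq_mul, mul_comm (gradVec u x α)]
  congr 2
  exact (sum_congr rfl fun β _ => mul_comm (gradVec u x β) (E β i) :
    ∑ β, gradVec u x β * E β i = _)

theorem norm_dual_le (h : FrameAt u x E lam) (i : Fin n) :
    ‖frameVec (metricMat (gradVec u x) * E) i‖ ≤ 1 + ‖gradient u x‖ := by
  rw [dual_eq]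
  refine (norm_add_le _ _).trans (add_le_add (h.norm_le i) ?_)
  rw [norm_smul, Real.norm_eq_abs]
  exact mul_le_of_le_one_left (norm_nonneg _) (h.abs_dd_le i)

/-- `⟨eᵢ, g eᵢ⟩ = 1`. -/
theorem inner_dual (h : FrameAt u x E lam) (i : Fin n) :
    inner ℝ (frameVec E i) (frameVec (metricMat (gradVec u x) * E) i) = 1 := by
  rw [dual_eq, inner_add_right, inner_smul_right, real_inner_self_eq_norm_sq, real_inner_comm,
    inner_gradient, ← sq, h.norm_sq_add]

/-- Cauchy–Schwarz in ⟨eᵢ, g eᵢ⟩ = 1 with |eᵢ| ≤ 1. It keeps the coefficient of λᵢ² in the second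
derivative of the weight at least 1. -/
theorem one_le_norm_dual (h : FrameAt u x E lam) (i : Fin n) :
    1 ≤ ‖frameVec (metricMat (gradVec u x) * E) i‖ := by
  have h1 := h.inner_dual i
  have h2 := real_inner_le_norm (frameVec E i) (frameVec (metricMat (gradVec u x) * E) i)
  have h3 := mul_le_of_le_one_left
    (norm_nonneg (frameVec (metricMat (gradVec u x) * E) i)) (h.norm_le i)
  linarith

/-- Expansion of an inner product in the frame and its dual. -/
theorem sum_inner_mul_inner (h : FrameAt u x E lam) (v w : Base n) :
    ∑ i, inner ℝ v (frameVec E i) * inner ℝ w (frameVec (metricMat (gradVec u x) * E) i)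
      = inner ℝ w v := by
  have h1 : ∑ i, inner ℝ w (frameVec (metricMat (gradVec u x) * E) i) • frameVec E i = w := by
    have h2 := frame_mul h.orth
    ext α
    simp only [WithLp.ofLp_sum, WithLp.ofLp_smul, Finset.sum_apply, Pi.smul_apply, smul_eq_mul,
      frameVec_apply, PiLp.inner_apply]
    have h3 : ∀ β, ∑ i, E α i * (metricMat (gradVec u x) * E) β i = (1 : Matrix _ _ ℝ) α β := by
      intro β; rw [← h2, Matrix.mul_apply]; rfl
    simp only [sum_mul]
    rw [sum_comm]
    have h4 : ∀ β, ∑ i, inner ℝ (w β) ((metricMat (gradVec u x) * E) β i) * E α i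
        = w β * (1 : Matrix _ _ ℝ) α β := by
      intro β
      rw [← h3, mul_sum]
      refine sum_congr rfl fun i _ => ?_
      simp only [RCLike.inner_apply, conj_trivial]; ring
    simp only [h4, Matrix.one_apply]
    simp
  conv_rhs => rw [← h1]
  rw [sum_inner]
  refine sum_congr rfl fun i _ => ?_
  rw [real_inner_smul_left, real_inner_comm, mul_comm]

theorem jet_gradVec (h : FrameAt u x E lam) (hu : ContDiffAt ℝ 4 u x) (α k : Fin n) :
    HasJet (fun t : ℝ => gradVec u (x + t • frameVec E k) α) (gradVec u x α)
      (lam k * (metricMat (gradVec u x) * E) α k)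
      (∑ m, dd (frameVec E k) (dd (frameVec E k) (dd (frameVec E m) u)) x
        * (metricMat (gradVec u x) * E) α m) := by
  have hu3 : ContDiffAt ℝ 3 u x := hu.of_le (by norm_num)
  have hu2 : ContDiffAt ℝ 2 u x := hu.of_le (by norm_num)
  have h1 : ContDiffAt ℝ 2 (dd (coordVec α) u) x := contDiffAt_dd (k := 2) (l := 4) hu (by norm_num) _
  refine (HasJet.of_contDiffAt h1 (frameVec E k)).of_eq rfl ?_ ?_
  · rw [dd_comm hu2, h.dd_coordVec]
    simp only [h.dd_dd hu2, mul_ite, mul_zero, sum_ite_eq, mem_univ, if_true, mul_comm]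
  · rw [← (dd_comm_three hu3 (coordVec α) (frameVec E k)).eq_of_nhds, h.dd_coordVec]
    refine sum_congr rfl fun m _ => ?_
    rw [(dd_comm_three hu3 (frameVec E m) (frameVec E k)).eq_of_nhds, mul_comm]

theorem gradient_eq_sum (u : Base n → ℝ) (y : Base n) :
    gradient u y = ∑ α, gradVec u y α • coordVec α := by
  ext β
  simp [gradient_apply, coordVec, Pi.single_apply]

/-- Diagonalization means D²u eₖ = λₖ g eₖ, so the first derivative of the gradient is λₖ times a
dual frame vector. The second involves third derivatives of u only through the components uₘₖₖ. -/
theorem jet_gradient (h : FrameAt u x E lam) (hu : ContDiffAt ℝ 4 u x) (k : Fin n) :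
    HasJet (fun t : ℝ => gradient u (x + t • frameVec E k)) (gradient u x)
      (lam k • frameVec (metricMat (gradVec u x) * E) k)
      (∑ m, dd (frameVec E k) (dd (frameVec E k) (dd (frameVec E m) u)) x
        • frameVec (metricMat (gradVec u x) * E) m) := by
  simp only [gradient_eq_sum]
  refine (HasJet.sum univ fun α _ => (h.jet_gradVec hu α k).smul_const (coordVec α)).of_eq rfl ?_ ?_
  · rw [frameVec, smul_sum]
    exact sum_congr rfl fun α _ => by rw [smul_smul]
  · simp only [frameVec, smul_sum, sum_smul, smul_smul]
    rw [sum_comm]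

/-- The jet of the right-hand side `W² h(X, c ν)` of the equation in a frame direction. -/
theorem jet_rhs (h : FrameAt u x E lam) (hu : ContDiffAt ℝ 4 u x) (hlam : ∀ i, 0 ≤ lam i)
    {A b c₀ : ℝ} (hA : ‖gradient u x‖ ≤ A) (hc₀ : 0 ≤ c₀) (hc₁ : c₀ ≤ 1)
    {f : Ambient n × Ambient n → ℝ} (hf : ContDiffAt ℝ 2 f (position u x, c₀ • rawNormal u x))
    (hf0 : |f (position u x, c₀ • rawNormal u x)| ≤ b)
    (hf1 : ‖fderiv ℝ f (position u x, c₀ • rawNormal u x)‖ ≤ b)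
    (hf2 : ‖fderiv ℝ (fderiv ℝ f) (position u x, c₀ • rawNormal u x)‖ ≤ b) :
    ∃ a c r : Fin n → ℝ, (∀ k, |a k| ≤ 10 * b * (1 + A) ^ 4) ∧
      (∀ k, |c k| ≤ 10 * b * (1 + A) ^ 4) ∧
      (∀ k, |r k| ≤ 10 * b * (1 + A) ^ 4 * (1 + lam k) ^ 2) ∧
      ∀ k, HasJet (fun t : ℝ => (1 + ‖gradient u (x + t • frameVec E k)‖ ^ 2)
          * f (position u (x + t • frameVec E k), c₀ • rawNormal u (x + t • frameVec E k)))
        ((1 + ‖gradient u x‖ ^ 2) * f (position u x, c₀ • rawNormal u x)) (a k + c k * lam k)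
        (∑ m, c m * dd (frameVec E k) (dd (frameVec E k) (dd (frameVec E m) u)) x + r k) := by
  have hu2 : ContDiffAt ℝ 2 u x := hu.of_le (by norm_num)
  have hA0 : 0 ≤ A := (norm_nonneg _).trans hA
  have hb : 0 ≤ b := (abs_nonneg _).trans hf0
  set z := (position u x, c₀ • rawNormal u x) with hz
  set h₁ := fderiv ℝ f z with hh₁
  set h₂ := fderiv ℝ (fderiv ℝ f) z with hh₂
  set e := frameVec E with he
  set g := frameVec (metricMat (gradVec u x) * E) with hg
  set W := 1 + ‖gradient u x‖ ^ 2 with hW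
  have hg_le : ∀ k, ‖g k‖ ≤ 1 + A := fun k => (h.norm_dual_le k).trans (by linarith)
  have hW0 : 0 ≤ W := by positivity
  have hW_le : W ≤ (1 + A) ^ 2 := by
    have : ‖gradient u x‖ ^ 2 ≤ A ^ 2 := by gcongr
    nlinarith
  set t₃ : Fin n → Fin n → ℝ := fun m k => dd (e k) (dd (e k) (dd (e m) u)) x with ht₃
  set s : Fin n → ℝ := fun m => 2 * inner ℝ (gradient u x) (g m) with hs
  have hs_le : ∀ k, |s k| ≤ 2 * (1 + A) ^ 2 := by
    intro k
    have h1 := abs_real_inner_le_norm (gradient u x) (g k)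
    have h2 : ‖gradient u x‖ * ‖g k‖ ≤ (1 + A) * (1 + A) :=
      mul_le_mul (by linarith) (hg_le k) (norm_nonneg _) (by linarith)
    rw [hs, abs_mul, abs_two]
    nlinarith
  -- The argument (X, c₀(∇u, -1)) of f has first derivative γ₁ₖ + λₖδₖ, tangential motion plus
  -- turning of the normal, and second derivative λₖζ + Σₘ uₘₖₖ δₘ.
  set γ₁ : Fin n → Ambient n × Ambient n := fun k =>
    (pair (e k) (dd (e k) u x), (0 : Ambient n)) with hγ₁
  set δ : Fin n → Ambient n × Ambient n := fun m => ((0 : Ambient n), c₀ • pair (g m) 0) with hδ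
  set ζ : Ambient n × Ambient n := (pair (0 : Base n) 1, (0 : Ambient n)) with hζ
  have hγ₁_le : ∀ k, ‖γ₁ k‖ ≤ 1 := by
    intro k
    have h1 : ‖pair (e k) (dd (e k) u x)‖ ≤ 1 := by
      have := norm_pair_sq (e k) (dd (e k) u x)
      rw [h.norm_sq_add] at this
      exact (sq_le_one_iff₀ (norm_nonneg _)).mp this.le
    rw [hγ₁, Prod.norm_def]
    simpa using h1
  have hδ_le : ∀ k, ‖δ k‖ ≤ 1 + A := by
    intro k
    have h1 : ‖pair (g k) 0‖ = ‖g k‖ := by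
      rw [← sq_eq_sq₀ (norm_nonneg _) (norm_nonneg _), norm_pair_sq]; ring
    have h2 : ‖c₀ • pair (g k) 0‖ ≤ 1 + A := by
      rw [norm_smul, h1, Real.norm_eq_abs, abs_of_nonneg hc₀]
      exact (mul_le_of_le_one_left (norm_nonneg _) hc₁).trans (hg_le k)
    rw [hδ, Prod.norm_def]
    simp only [norm_zero]
    exact max_le (by linarith) h2
  have hζ_le : ‖ζ‖ ≤ 1 := by
    have h1 : ‖pair (0 : Base n) 1‖ ≤ 1 := by
      have := norm_pair_sq (0 : Base n) 1
      rw [norm_zero] at this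
      exact (sq_le_one_iff₀ (norm_nonneg _)).mp (by rw [this]; norm_num)
    rw [hζ, Prod.norm_def]
    simpa using h1
  have bd₁ : ∀ v : Ambient n × Ambient n, |h₁ v| ≤ b * ‖v‖ := fun v =>
    (h₁.le_opNorm v).trans (by gcongr)
  have bd₂ : ∀ v w : Ambient n × Ambient n, |h₂ v w| ≤ b * ‖v‖ * ‖w‖ := fun v w =>
    ((h₂ v).le_opNorm w).trans
      (mul_le_mul_of_nonneg_right ((h₂.le_opNorm v).trans (by gcongr)) (norm_nonneg _))
  set Γ : Fin n → Ambient n × Ambient n := fun k => γ₁ k + lam k • δ k with hΓ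
  have hΓ_le : ∀ k, ‖Γ k‖ ≤ (1 + A) * (1 + lam k) := by
    intro k
    have h1 : ‖lam k • δ k‖ ≤ lam k * (1 + A) := by
      rw [norm_smul, Real.norm_eq_abs, abs_of_nonneg (hlam k)]
      exact mul_le_mul_of_nonneg_left (hδ_le k) (hlam k)
    have h2 := norm_add_le (γ₁ k) (lam k • δ k)
    have h3 := hγ₁_le k
    have h4 := hlam k
    rw [hΓ]
    linarith
  have jg := fun k => h.jet_gradient hu k
  have jγ : ∀ k, HasJet (fun t : ℝ => ((position u (x + t • e k),
      c₀ • rawNormal u (x + t • e k)) : Ambient n × Ambient n)) z (Γ k)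
      (lam k • ζ + ∑ m, t₃ m k • δ m) := by
    intro k
    have j1 : HasJet (fun t : ℝ => position u (x + t • e k)) (position u x)
        (pair (e k) (dd (e k) u x)) (pair 0 (lam k)) := by
      have j := ((HasJet.affine x (e k)).prodMk (HasJet.of_contDiffAt hu2 (e k))).clm (pairL n)
      refine j.of_eq rfl rfl ?_
      rw [pairL_apply, h.dd_dd hu2, if_pos rfl]
    have j2 : HasJet (fun t : ℝ => c₀ • rawNormal u (x + t • e k)) (c₀ • rawNormal u x)
        (lam k • c₀ • pair (g k) 0) (∑ m, t₃ m k • c₀ • pair (g m) 0) := by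
      have j := (((jg k).prodMk (HasJet.const (-1 : ℝ))).clm (pairL n)).const_smul c₀
      refine j.of_eq rfl ?_ ?_
      · have e1 : ((lam k • g k, 0) : Base n × ℝ) = lam k • (g k, (0 : ℝ)) := by simp
        rw [e1, map_smul, smul_comm]; rfl
      · have e1 : ((∑ m, t₃ m k • g m, 0) : Base n × ℝ) = ∑ m, t₃ m k • (g m, (0 : ℝ)) := by
          refine Prod.ext ?_ ?_
          · simp [Prod.fst_sum]
          · simp [Prod.snd_sum]
        change c₀ • pairL n (∑ m, t₃ m k • g m, 0) = _
        rw [e1, map_sum, smul_sum]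
        refine sum_congr rfl fun m _ => ?_
        rw [map_smul, smul_comm]; rfl
    refine (j1.prodMk j2).of_eq rfl ?_ ?_
    · rw [hΓ, hγ₁, hδ]; simp
    · have e1 : pair (0 : Base n) (lam k) = lam k • pair (0 : Base n) 1 := by
        have : ((0, lam k) : Base n × ℝ) = lam k • (0, (1 : ℝ)) := by simp
        rw [← pairL_apply (0, lam k), this, map_smul]; rfl
      refine Prod.ext ?_ ?_
      · simp [hζ, hδ, e1, Prod.fst_sum]
      · simp [hζ, hδ, Prod.snd_sum]
  have jW : ∀ k, HasJet (fun t : ℝ => 1 + ‖gradient u (x + t • e k)‖ ^ 2) W (lam k * s k)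
      (2 * lam k ^ 2 * ‖g k‖ ^ 2 + ∑ m, t₃ m k * s m) := by
    intro k
    have j := (HasJet.const (1 : ℝ)).add ((jg k).inner_mul (jg k))
    have hfun : (fun t : ℝ => 1 + ‖gradient u (x + t • e k)‖ ^ 2)
        = fun t : ℝ => 1 + inner ℝ (gradient u (x + t • e k)) (gradient u (x + t • e k)) := by
      ext t; rw [real_inner_self_eq_norm_sq]
    rw [hfun]
    refine j.of_eq ?_ ?_ ?_
    · rw [hW, real_inner_self_eq_norm_sq]
    · rw [real_inner_comm, inner_smul_right, hs]; ring
    · rw [real_inner_comm (gradient u x), inner_sum, inner_smul_left, inner_smul_right,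
        real_inner_self_eq_norm_sq, hs]
      have e1 : ∀ i, t₃ i k * (2 * inner ℝ (gradient u x) (g i))
          = 2 * inner ℝ (gradient u x) (t₃ i k • g i) := by
        intro i; rw [inner_smul_right]; ring
      simp only [e1, ← mul_sum, conj_trivial]
      ring
  have jf := fun k => (jγ k).comp_fun hf
  -- c is the derivative of the right-hand side with respect to the gradient. The same c multiplies
  -- λₖ at first order and the third derivatives at second order; the rest, r, is quadratic in λₖ.
  refine ⟨fun k => W * h₁ (γ₁ k), fun k => s k * f z + W * h₁ (δ k),
    fun k => 2 * lam k ^ 2 * ‖g k‖ ^ 2 * f z + 2 * (lam k * s k * h₁ (Γ k))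
      + W * (h₂ (Γ k) (Γ k) + lam k * h₁ ζ), ?_, ?_, ?_, ?_⟩
  · intro k
    have h1 : |h₁ (γ₁ k)| ≤ b := (bd₁ _).trans (mul_le_of_le_one_right hb (hγ₁_le k))
    rw [abs_mul, abs_of_nonneg hW0]
    calc W * |h₁ (γ₁ k)| ≤ (1 + A) ^ 2 * b := by gcongr
      _ ≤ (1 + A) ^ 4 * b := by gcongr <;> linarith
      _ ≤ 10 * b * (1 + A) ^ 4 := by
        have : 0 ≤ (1 + A) ^ 4 * b := by positivity
        linarith
  · intro k
    have h1 : |h₁ (δ k)| ≤ b * (1 + A) := (bd₁ _).trans (by gcongr; exact hδ_le k)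
    have e1 : (1 + A) ^ 2 ≤ (1 + A) ^ 4 := by gcongr <;> linarith
    have e2 : (1 + A) ^ 3 ≤ (1 + A) ^ 4 := by gcongr <;> linarith
    calc |s k * f z + W * h₁ (δ k)| ≤ |s k| * |f z| + W * |h₁ (δ k)| := by
          refine (abs_add_le _ _).trans ?_
          rw [abs_mul (s k), abs_mul W, abs_of_nonneg hW0]
      _ ≤ 2 * (1 + A) ^ 2 * b + (1 + A) ^ 2 * (b * (1 + A)) := by
          have := hs_le k
          gcongr
      _ = 2 * b * (1 + A) ^ 2 + b * (1 + A) ^ 3 := by ring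
      _ ≤ 2 * b * (1 + A) ^ 4 + b * (1 + A) ^ 4 := by gcongr
      _ ≤ _ := by
          have : 0 ≤ b * (1 + A) ^ 4 := by positivity
          linarith
  · intro k
    have hl := hlam k
    have h1 : |h₁ (Γ k)| ≤ b * ((1 + A) * (1 + lam k)) := (bd₁ _).trans (by gcongr; exact hΓ_le k)
    have h2 : |h₂ (Γ k) (Γ k)| ≤ b * ((1 + A) * (1 + lam k)) * ((1 + A) * (1 + lam k)) :=
      (bd₂ _ _).trans (by
        have := hΓ_le k
        gcongr)
    have h3 : |h₁ ζ| ≤ b := (bd₁ _).trans (mul_le_of_le_one_right hb hζ_le)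
    set L := 1 + lam k with hL
    have hL1 : 1 ≤ L := by linarith
    have hlL : lam k ≤ L := by linarith
    have hgk := hg_le k
    have hsk := hs_le k
    have t1 : |2 * lam k ^ 2 * ‖g k‖ ^ 2 * f z| ≤ 2 * L ^ 2 * (1 + A) ^ 2 * b := by
      rw [abs_mul, abs_of_nonneg (by positivity)]
      gcongr
    have t2 : |2 * (lam k * s k * h₁ (Γ k))| ≤ 2 * (L * (2 * (1 + A) ^ 2) * (b * ((1 + A) * L))) := by
      rw [abs_mul, abs_mul, abs_mul, abs_two, abs_of_nonneg hl]
      gcongr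
    have t3 : |W * (h₂ (Γ k) (Γ k) + lam k * h₁ ζ)|
        ≤ (1 + A) ^ 2 * (b * ((1 + A) * L) * ((1 + A) * L) + L * b) := by
      rw [abs_mul, abs_of_nonneg hW0]
      gcongr
      refine (abs_add_le _ _).trans (add_le_add h2 ?_)
      rw [abs_mul, abs_of_nonneg hl]
      gcongr
    have t4 := abs_add_three (2 * lam k ^ 2 * ‖g k‖ ^ 2 * f z) (2 * (lam k * s k * h₁ (Γ k)))
      (W * (h₂ (Γ k) (Γ k) + lam k * h₁ ζ))
    have e1 : (1 + A) ^ 2 ≤ (1 + A) ^ 4 := by gcongr <;> linarith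
    have e2 : (1 + A) ^ 3 ≤ (1 + A) ^ 4 := by gcongr <;> linarith
    have u1 : L ^ 2 * b * (1 + A) ^ 2 ≤ L ^ 2 * b * (1 + A) ^ 4 := by gcongr
    have u2 : L ^ 2 * b * (1 + A) ^ 3 ≤ L ^ 2 * b * (1 + A) ^ 4 := by gcongr
    have u3 : (1 + A) ^ 2 * (L * b) ≤ L ^ 2 * b * (1 + A) ^ 2 := by
      have : L ≤ L ^ 2 := le_self_pow₀ hL1 two_ne_zero
      calc (1 + A) ^ 2 * (L * b) ≤ (1 + A) ^ 2 * (L ^ 2 * b) := by gcongr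
        _ = _ := by ring
    have u4 : 0 ≤ L ^ 2 * b * (1 + A) ^ 4 := by positivity
    refine t4.trans ?_
    linarith
  · intro k
    refine ((jW k).mul (jf k)).of_eq rfl ?_ ?_
    · simp only [hΓ, map_add, map_smul, smul_eq_mul]; ring
    · simp only [map_add, map_sum, map_smul, smul_eq_mul]
      rw [add_mul, sum_mul, mul_add W, mul_add W, mul_sum]
      have e1 : ∑ m, (s m * f z + W * h₁ (δ m)) * t₃ m k
          = ∑ m, t₃ m k * s m * f z + ∑ m, W * (t₃ m k * h₁ (δ m)) := by
        rw [← sum_add_distrib]; exact sum_congr rfl fun m _ => by ring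
      simp only [ht₃] at e1 ⊢
      rw [e1]
      ring

end FrameAt

end CurvEst

end

/-! ### From the equation near a point to its algebraic jet. -/

noncomputable section

namespace CurvEst

open Finset Matrix Filter Topology

variable {n : ℕ} {u : Base n → ℝ} {x : Base n} {E : Matrix (Fin n) (Fin n) ℝ} {lam : Fin n → ℝ}

theorem contDiffAt_gradVec (hu : ContDiffAt ℝ 4 u x) (α : Fin n) :
    ContDiffAt ℝ 3 (fun y => gradVec u y α) x := contDiffAt_dd (k := 3) (l := 4) hu (by norm_num) _

theorem contDiffAt_hess (hu : ContDiffAt ℝ 4 u x) (α β : Fin n) :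
    ContDiffAt ℝ 2 (fun y => hess u y α β) x :=
  contDiffAt_dd (k := 2) (l := 3) (contDiffAt_gradVec hu α) (by norm_num) _

theorem contDiffAt_metricInv_mul_hess (hu : ContDiffAt ℝ 4 u x) (α β : Fin n) :
    ContDiffAt ℝ 2 (fun y => (metricInv (gradVec u y) * hess u y) α β) x := by
  have hp : ∀ γ, ContDiffAt ℝ 2 (fun y => gradVec u y γ) x := fun γ =>
    (contDiffAt_gradVec hu γ).of_le (by norm_num)
  have hdot : ContDiffAt ℝ 2 (fun y => (1 + gradVec u y ⬝ᵥ gradVec u y)⁻¹) x := by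
    refine ContDiffAt.inv ?_ ?_
    · exact contDiffAt_const.add (ContDiffAt.sum fun γ _ => (hp γ).mul (hp γ))
    · have := dotProduct_self_nonneg' (gradVec u x); positivity
  have hfun : (fun y => (metricInv (gradVec u y) * hess u y) α β) = fun y =>
      ∑ γ, ((1 : Matrix (Fin n) (Fin n) ℝ) α γ
        - (1 + gradVec u y ⬝ᵥ gradVec u y)⁻¹ * (gradVec u y α * gradVec u y γ)) * hess u y γ β := by
    ext y; rfl
  rw [hfun]
  exact ContDiffAt.sum fun γ _ =>
    (contDiffAt_const.sub (hdot.mul ((hp α).mul (hp γ)))).mul (contDiffAt_hess hu γ β)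

theorem contDiffAt_traceHess (hu : ContDiffAt ℝ 4 u x) : ContDiffAt ℝ 2 (traceHess u) x := by
  have hfun : traceHess u = fun y => ∑ α, (metricInv (gradVec u y) * hess u y) α α := rfl
  rw [hfun]
  exact ContDiffAt.sum fun α _ => contDiffAt_metricInv_mul_hess hu α α

theorem frame_metric (u : Base n → ℝ) (y : Base n) (E : Matrix (Fin n) (Fin n) ℝ) (i j : Fin n) :
    (Eᵀ * metricMat (gradVec u y) * E) i j
      = (Eᵀ * E) i j + dd (frameVec E i) u y * dd (frameVec E j) u y := by
  rw [metricMat, Matrix.mul_add, Matrix.mul_one, Matrix.add_mul, Matrix.add_apply]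
  congr 1
  rw [mul_vecMulVec, vecMulVec_mul, vecMulVec_apply, dd_frameVec, dd_frameVec]
  congr 1
  exact (sum_congr rfl fun β _ => mul_comm (gradVec u y β) (E β j) :
    ∑ β, gradVec u y β * E β j = _)

namespace FrameAt

/-- The matrix of the map `g⁻¹ D²u` at `y` in the frame `E` at `x`. -/
def frameWeingarten (u : Base n → ℝ) (x : Base n) (E : Matrix (Fin n) (Fin n) ℝ) (y : Base n) :
    Matrix (Fin n) (Fin n) ℝ :=
  (metricMat (gradVec u x) * E)ᵀ * (metricInv (gradVec u y) * hess u y) * E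

theorem contDiffAt_frameWeingarten (hu : ContDiffAt ℝ 4 u x) (i j : Fin n) :
    ContDiffAt ℝ 2 (fun y => frameWeingarten u x E y i j) x := by
  have hfun : (fun y => frameWeingarten u x E y i j) = fun y =>
      ∑ β, (∑ α, (metricMat (gradVec u x) * E)ᵀ i α
        * (metricInv (gradVec u y) * hess u y) α β) * E β j := by
    ext y; simp only [frameWeingarten, Matrix.mul_apply (M := _ * _) (N := E)]
    exact sum_congr rfl fun β _ => by rw [Matrix.mul_apply]
  rw [hfun]
  exact ContDiffAt.sum fun β _ => (ContDiffAt.sum fun α _ =>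
    contDiffAt_const.mul (contDiffAt_metricInv_mul_hess hu α β)).mul contDiffAt_const

/-- The frame is frozen at x while y varies. Differentiating this product identity replaces
differentiating the inverse metric. -/
theorem metric_mul_frameWeingarten (h : FrameAt u x E lam) (y : Base n) :
    (Eᵀ * metricMat (gradVec u y) * E) * frameWeingarten u x E y = Eᵀ * hess u y * E := by
  rw [frameWeingarten]
  calc Eᵀ * metricMat (gradVec u y) * E *
        ((metricMat (gradVec u x) * E)ᵀ * (metricInv (gradVec u y) * hess u y) * E)
      = Eᵀ * (metricMat (gradVec u y) * ((E * (metricMat (gradVec u x) * E)ᵀ)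
          * metricInv (gradVec u y))) * hess u y * E := by simp only [Matrix.mul_assoc]
    _ = _ := by rw [frame_mul h.orth, Matrix.one_mul, metricMat_mul_metricInv, Matrix.mul_one]

theorem trace_frameWeingarten (h : FrameAt u x E lam) (y : Base n) :
    ∑ i, frameWeingarten u x E y i i = traceHess u y := by
  change (frameWeingarten u x E y).trace = _
  rw [frameWeingarten, Matrix.mul_assoc, Matrix.trace_mul_comm, Matrix.mul_assoc,
    frame_mul h.orth, Matrix.mul_one, traceHess]

theorem trace_frameWeingarten_sq (h : FrameAt u x E lam) (y : Base n) :
    ∑ i, ∑ j, frameWeingarten u x E y i j * frameWeingarten u x E y j i = traceHessSq u y := by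
  have h1 : ∑ i, ∑ j, frameWeingarten u x E y i j * frameWeingarten u x E y j i
      = (frameWeingarten u x E y * frameWeingarten u x E y).trace :=
    sum_congr rfl fun i _ => by rw [Matrix.diag_apply, Matrix.mul_apply]
  set B := metricInv (gradVec u y) * hess u y with hB
  set F := (metricMat (gradVec u x) * E)ᵀ with hF
  have h2 : E * F = 1 := frame_mul h.orth
  have h3 : frameWeingarten u x E y * frameWeingarten u x E y = F * (B * (E * F) * B * E) := by
    rw [frameWeingarten, ← hB, ← hF]; simp only [Matrix.mul_assoc]
  rw [h1, h3, Matrix.trace_mul_comm, h2, Matrix.mul_one, Matrix.mul_assoc, h2, Matrix.mul_one,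
    traceHessSq]

/-- A solution of the equation provides an `EquationJet` in every diagonalizing frame. -/
theorem exists_equationJet (h : FrameAt u x E lam) (hu : ContDiffAt ℝ 4 u x)
    (hlam : ∀ i, 0 ≤ lam i) {A b c₀ : ℝ} (hA : ‖gradient u x‖ ≤ A) (hc₀ : 0 ≤ c₀) (hc₁ : c₀ ≤ 1)
    {f : Ambient n × Ambient n → ℝ} (hf : ContDiffAt ℝ 2 f (position u x, c₀ • rawNormal u x))
    (hf0 : |f (position u x, c₀ • rawNormal u x)| ≤ b)
    (hf1 : ‖fderiv ℝ f (position u x, c₀ • rawNormal u x)‖ ≤ b)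
    (hf2 : ‖fderiv ℝ (fderiv ℝ f) (position u x, c₀ • rawNormal u x)‖ ≤ b)
    (heq : ∀ᶠ y in 𝓝 x, 2 * ((1 + ‖gradient u y‖ ^ 2) * f (position u y, c₀ • rawNormal u y))
      = traceHess u y ^ 2 - traceHessSq u y) :
    ∃ (u₄ : Fin n → Fin n → ℝ) (b₁ : Fin n → Fin n → Fin n → ℝ) (b₂ : Fin n → Fin n → ℝ)
      (a c r : Fin n → ℝ),
      EquationJet (10 * b * (1 + A) ^ 4) lam (fun i => dd (frameVec E i) u x) (∑ i, lam i)
        (fun i j k => dd (frameVec E k) (dd (frameVec E j) (dd (frameVec E i) u)) x)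
        u₄ b₁ b₂ a c r ∧
      ∀ k, HasJet (fun t : ℝ => traceHess u (x + t • frameVec E k)) (∑ i, lam i)
        (∑ i, b₁ k i i) (∑ i, b₂ k i) := by
  obtain ⟨a, c, r, ha, hc, hr, hjet⟩ := h.jet_rhs hu hlam hA hc₀ hc₁ hf hf0 hf1 hf2
  have hu3 : ContDiffAt ℝ 3 u x := hu.of_le (by norm_num)
  have hu2 : ContDiffAt ℝ 2 u x := hu.of_le (by norm_num)
  have hd3 : ∀ v, ContDiffAt ℝ 3 (dd v u) x := fun v =>
    contDiffAt_dd (k := 3) (l := 4) hu (by norm_num) v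
  have hd2 : ∀ v, ContDiffAt ℝ 2 (dd v u) x := fun v => (hd3 v).of_le (by norm_num)
  have hdd2 : ∀ v w, ContDiffAt ℝ 2 (dd w (dd v u)) x := fun v w =>
    contDiffAt_dd (k := 2) (l := 3) (hd3 v) (by norm_num) w
  set e := frameVec E with he
  set Bf : Fin n → Fin n → Base n → ℝ := fun i j y => frameWeingarten u x E y i j with hBf
  have hline : ∀ k, Tendsto (fun t : ℝ => x + t • e k) (𝓝 0) (𝓝 x) := by
    intro k
    have : ContinuousAt (fun t : ℝ => x + t • e k) 0 := by fun_prop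
    simpa [ContinuousAt] using this
  have hB : ∀ k i j, HasJet (fun t : ℝ => Bf i j (x + t • e k)) (Bf i j x) (dd (e k) (Bf i j) x)
      (dd (e k) (dd (e k) (Bf i j)) x) := fun k i j =>
    HasJet.of_contDiffAt (contDiffAt_frameWeingarten hu i j) (e k)
  -- Along each frame direction the product identity g B = D²u is differentiated twice, which
  -- expresses the jet of B by derivatives of u.
  have key := fun k => jet_of_mul_eq (lam := lam) k
    (P := fun i t => dd (e i) u (x + t • e k))
    (A := fun i j t => (Eᵀ * hess u (x + t • e k) * E) i j)
    (a₁ := fun i j => dd (e k) (dd (e j) (dd (e i) u)) x)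
    (a₂ := fun i j => dd (e k) (dd (e k) (dd (e j) (dd (e i) u))) x)
    (mm := fun i j => (Eᵀ * E) i j)
    (fun i => (HasJet.of_contDiffAt (hd2 (e i)) (e k)).of_eq rfl
      (by rw [h.dd_dd hu2]; split_ifs with hik <;> simp [hik]) rfl)
    (fun i j => ((HasJet.of_contDiffAt (hdd2 (e i) (e j)) (e k)).congr (by
      filter_upwards [(hline k).eventually (hu2.eventually (by simp))] with t ht
      rw [dd_dd_frameVec ht])).of_eq (h.dd_dd hu2 i j) rfl rfl)
    (hB k)
    (fun i j => Eventually.of_forall fun t => by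
      have h1 := congrFun (congrFun (h.metric_mul_frameWeingarten (x + t • e k)) i) j
      rw [Matrix.mul_apply] at h1
      simp only [frame_metric] at h1
      exact h1)
    (fun i j => h.gram i j)
  have jT : ∀ k, HasJet (fun t : ℝ => traceHess u (x + t • e k)) (∑ i, lam i)
      (∑ i, dd (e k) (Bf i i) x) (∑ i, dd (e k) (dd (e k) (Bf i i)) x) := by
    intro k
    have hfun : (fun t : ℝ => traceHess u (x + t • e k))
        = fun t : ℝ => ∑ i, Bf i i (x + t • e k) := by
      ext t; rw [h.trace_frameWeingarten]
    rw [hfun]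
    refine (HasJet.sum univ fun i _ => hB k i i).of_eq ?_ rfl rfl
    exact sum_congr rfl fun i _ => by rw [(key k).1 i i, if_pos rfl]
  have jS : ∀ k, HasJet (fun t : ℝ => traceHessSq u (x + t • e k)) (∑ i, lam i ^ 2)
      (2 * ∑ i, lam i * dd (e k) (Bf i i) x)
      (2 * ∑ i, lam i * dd (e k) (dd (e k) (Bf i i)) x
        + 2 * ∑ i, ∑ j, dd (e k) (Bf i j) x * dd (e k) (Bf j i) x) := by
    intro k
    have hfun : (fun t : ℝ => traceHessSq u (x + t • e k))
        = fun t : ℝ => ∑ i, ∑ j, Bf i j (x + t • e k) * Bf j i (x + t • e k) := by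
      ext t; rw [h.trace_frameWeingarten_sq]
    rw [hfun]
    refine (HasJet.sum univ fun i _ => HasJet.sum univ fun j _ =>
      (hB k i j).mul (hB k j i)).of_eq ?_ ?_ ?_
    · refine sum_congr rfl fun i _ => ?_
      simp only [(key k).1, ite_mul, mul_ite, mul_zero, zero_mul]
      simp [sq]
    · rw [mul_sum]
      refine sum_congr rfl fun i _ => ?_
      simp only [(key k).1, ite_mul, mul_ite, mul_zero, zero_mul, sum_ite_eq, sum_ite_eq', mem_univ,
        if_true, sum_add_distrib]
      ring
    · rw [mul_sum, mul_sum, ← sum_add_distrib]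
      refine sum_congr rfl fun i _ => ?_
      simp only [(key k).1, ite_mul, mul_ite, mul_zero, zero_mul, sum_ite_eq, sum_ite_eq', mem_univ,
        if_true, sum_add_distrib, ← mul_sum]
      ring
  have hev : ∀ k, (fun t : ℝ => 2 * ((1 + ‖gradient u (x + t • e k)‖ ^ 2)
          * f (position u (x + t • e k), c₀ • rawNormal u (x + t • e k))))
      =ᶠ[𝓝 0] fun t : ℝ => traceHess u (x + t • e k) * traceHess u (x + t • e k)
        - traceHessSq u (x + t • e k) := by
    intro k
    filter_upwards [(hline k).eventually heq] with t ht
    rw [ht, sq]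
  have hEq := fun k => ((hjet k).const_smul 2).unique (((jT k).mul (jT k)).sub (jS k)) (hev k)
  refine ⟨fun i k => dd (e k) (dd (e k) (dd (e i) (dd (e i) u))) x, fun k i j => dd (e k) (Bf i j) x,
    fun k i => dd (e k) (dd (e k) (Bf i i)) x, a, c, r, ⟨?_, ?_, ?_, ?_, ?_, ?_, ?_, ha, hc, hr, ?_⟩,
    jT⟩
  · intro i j k
    exact (dd_congr (dd_comm_eventually hu2 (e j) (e i)) (e k)).eq_of_nhds
  · intro i j k
    exact dd_comm (hd2 (e i)) (e k) (e j)
  · intro i k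
    exact dd_comm_four hu (e k) (e i)
  · intro k i j
    exact (key k).2.1 i j
  · intro k i
    exact (key k).2.2 i
  · intro k
    have h1 := (hEq k).2.1
    simp only [smul_eq_mul] at h1
    simp only [sub_mul, sum_sub_distrib, ← mul_sum]
    linarith
  · intro k
    have h1 := (hEq k).2.2
    simp only [smul_eq_mul] at h1
    simp only [sub_mul, sum_sub_distrib, ← mul_sum]
    linarith
  · intro k
    exact h.abs_dd_le k

end FrameAt

end CurvEst

end

/-! ### Quantitative solutions, the weight and the cutoff. -/

noncomputable section

namespace CurvEst

open Finset Matrix Filter Topology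

variable {n : ℕ}

/-- Homogeneity allows the normalizing factor c₀ = 1/W to be frozen at the point under study. The
argument is then the unit normal there, and W is never differentiated inside f. -/
theorem homExt_smul (f : Ambient n → UnitSphere n → ℝ) {c : ℝ} (hc : 0 < c) (X p : Ambient n) :
    homExt f (X, c • p) = homExt f (X, p) := by
  by_cases hp : p = 0
  · simp [hp]
  · have hcp : c • p ≠ 0 := smul_ne_zero hc.ne' hp
    have h : toSphere (c • p) hcp = toSphere p hp := by
      refine Subtype.ext ?_
      change ‖c • p‖⁻¹ • c • p = ‖p‖⁻¹ • p
      rw [norm_smul, Real.norm_of_nonneg hc.le, smul_smul]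
      congr 1
      have := norm_ne_zero_iff.mpr hp
      field_simp
    rw [homExt, homExt, dif_pos hcp, dif_pos hp, h]

theorem homExt_rawNormal (f : Ambient n → UnitSphere n → ℝ) (X : Ambient n) (u : Base n → ℝ)
    (x : Base n) : homExt f (X, rawNormal u x) = f X (normal u x) := by
  rw [homExt, dif_pos (rawNormal_ne_zero u x)]; rfl

theorem homExt_normal (f : Ambient n → UnitSphere n → ℝ) (X : Ambient n) (u : Base n → ℝ)
    (x : Base n) : homExt f (X, (normal u x : Ambient n)) = f X (normal u x) := by
  rw [normal_eq, homExt_smul f (inv_pos.mpr (areaElt_pos u x)), homExt_rawNormal]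

/-- A convex solution of `σ₂(κ) = F(X, ν)` over the ball of radius `r`, with quantitative control
on its `C¹` norm and on `F`, which is homogeneous of degree `0` along the normal. -/
structure ControlledSolution (r a b m : ℝ) (u : Base n → ℝ) (F : Ambient n × Ambient n → ℝ) :
    Prop where
  contDiffAt : ∀ x ∈ ball (0 : Base n) r, ContDiffAt ℝ 4 u x
  convex : ConvexOn ℝ (ball (0 : Base n) r) u
  abs_le : ∀ x ∈ ball (0 : Base n) r, |u x| ≤ a
  norm_gradient_le : ∀ x ∈ ball (0 : Base n) r, ‖gradient u x‖ ≤ a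
  contDiffAt_rhs : ∀ x ∈ ball (0 : Base n) r,
    ContDiffAt ℝ 2 F (position u x, (normal u x : Ambient n))
  abs_rhs_le : ∀ x ∈ ball (0 : Base n) r, |F (position u x, (normal u x : Ambient n))| ≤ b
  norm_fderiv_le : ∀ x ∈ ball (0 : Base n) r,
    ‖fderiv ℝ F (position u x, (normal u x : Ambient n))‖ ≤ b
  norm_fderiv_fderiv_le : ∀ x ∈ ball (0 : Base n) r,
    ‖fderiv ℝ (fderiv ℝ F) (position u x, (normal u x : Ambient n))‖ ≤ b
  le_rhs : ∀ x ∈ ball (0 : Base n) r, m ≤ F (position u x, (normal u x : Ambient n))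
  equation : ∀ x ∈ ball (0 : Base n) r, ∀ c₀ : ℝ, 0 < c₀ →
    2 * ((1 + ‖gradient u x‖ ^ 2) * F (position u x, c₀ • rawNormal u x))
      = traceHess u x ^ 2 - traceHessSq u x

theorem norm_le_of_iSup_enorm_le {α V : Type*} [NormedAddCommGroup V] {s : Set α} {g : α → V}
    {a : ℝ≥0} (h : ⨆ x ∈ s, ‖g x‖ₑ ≤ a) {x : α} (hx : x ∈ s) : ‖g x‖ ≤ a := by
  have h1 : ‖g x‖ₑ ≤ a := (le_iSup₂_of_le x hx le_rfl).trans h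
  rw [enorm_le_coe] at h1
  exact_mod_cast h1

theorem controlledSolution_of_norms {r : ℝ} {a b c : ℝ≥0} {u : Base n → ℝ}
    {f : Ambient n → UnitSphere n → ℝ} (hu : ContDiffOn ℝ 4 u (ball 0 r))
    (hconv : ConvexOn ℝ (ball 0 r) u) (hf : IsC2 r f) (heq : SolvesScalarCurvatureEq r u f)
    (ha : normC1 r u ≤ a) (hb : normC2 r u f ≤ b) (hc : normInv r u f ≤ c) :
    ControlledSolution r a b (1 / (c + 1)) u (homExt f) := by
  have hC2 : ∀ k ∈ Finset.range 3, ∀ x ∈ ball (0 : Base n) r,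
      ‖iteratedFDeriv ℝ k (homExt f) (position u x, (normal u x : Ambient n))‖ ≤ b := by
    intro k hk x hx
    refine norm_le_of_iSup_enorm_le (g := fun x =>
      iteratedFDeriv ℝ k (homExt f) (position u x, (normal u x : Ambient n))) (le_trans ?_ hb) hx
    exact single_le_sum (f := fun k => ⨆ x ∈ ball (0 : Base n) r,
      ‖iteratedFDeriv ℝ k (homExt f) (position u x, (normal u x : Ambient n))‖ₑ)
      (fun _ _ => zero_le) hk
  have hu' : ∀ x ∈ ball (0 : Base n) r, ContDiffAt ℝ 4 u x := fun x hx =>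
    hu.contDiffAt (isOpen_ball.mem_nhds hx)
  refine ⟨hu', hconv, ?_, ?_, ?_, ?_, ?_, ?_, ?_, ?_⟩
  · intro x hx
    exact norm_le_of_iSup_enorm_le (g := u) (le_self_add.trans ha) hx
  · intro x hx
    exact norm_le_of_iSup_enorm_le (g := gradient u) (le_add_self.trans ha) hx
  · intro x hx
    refine hf.contDiffAt (IsOpen.mem_nhds ?_ ⟨?_, ?_⟩)
    · have hcont : Continuous (horiz : Ambient n → Base n) :=
        (PiLp.continuous_toLp 2 _).comp
          (continuous_pi fun i => (EuclideanSpace.proj (i.castSucc)).continuous)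
      exact (isOpen_ball.preimage (hcont.comp continuous_fst)).inter
        (isOpen_ne.preimage continuous_snd)
    · have : horiz (position u x) = x := by
        ext i; simp [horiz, position, pair]
      simpa [this] using hx
    · exact ne_of_mem_of_not_mem (normal u x).2 (by simp)
  · intro x hx
    have := hC2 0 (by simp) x hx
    rwa [norm_iteratedFDeriv_zero] at this
  · intro x hx
    have := hC2 1 (by simp) x hx
    rwa [norm_iteratedFDeriv_one] at this
  · intro x hx
    have := hC2 2 (by simp) x hx
    rwa [← norm_iteratedFDeriv_fderiv (n := 1), norm_iteratedFDeriv_one] at this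
  · intro x hx
    rw [homExt_normal]
    have h0 := (heq x hx).2
    have h1 : ‖1 / f (position u x) (normal u x)‖ ≤ c :=
      norm_le_of_iSup_enorm_le (g := fun x => 1 / f (position u x) (normal u x)) hc hx
    rw [Real.norm_of_nonneg (by positivity), div_le_iff₀ h0] at h1
    rw [div_le_iff₀ (by positivity)]
    linarith
  · intro x hx c₀ hc₀
    rw [homExt_smul f hc₀, homExt_rawNormal, ← (heq x hx).1, norm_gradient_sq, ← areaElt_sq,
      two_mul_sigmaTwo ((hu' x hx).of_le (by norm_num))]

namespace ControlledSolution

variable {r a b m : ℝ} {u : Base n → ℝ} {F : Ambient n × Ambient n → ℝ} {x : Base n}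

/-- The bounds follow from 2W²F = H² - Σ λᵢ² with 1 ≤ W² ≤ 1 + a². The summand m in the upper bound
makes it at least m by construction. -/
theorem exists_spectrum (h : ControlledSolution r a b m u F) (hn : 0 < n) (hm : 0 < m)
    (hx : x ∈ ball (0 : Base n) r) :
    ∃ (E : Matrix (Fin n) (Fin n) ℝ) (lam : Fin n → ℝ) (i₀ : Fin n), FrameAt u x E lam ∧
      Spectrum m (m + (1 + a ^ 2) * b) lam i₀ (traceHess u x) := by
  have hu2 : ContDiffAt ℝ 2 u x := (h.contDiffAt x hx).of_le (by norm_num)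
  obtain ⟨E, lam, hE, hA⟩ := exists_frame (gradVec u x) (transpose_hess hu2)
  have : Nonempty (Fin n) := ⟨⟨0, hn⟩⟩
  obtain ⟨i₀, hi₀⟩ := Finite.exists_max lam
  have hW := areaElt_pos u x
  have heq := h.equation x hx (areaElt u x)⁻¹ (inv_pos.mpr hW)
  rw [← normal_eq] at heq
  have h1 := h.le_rhs x hx
  have h2 := (le_abs_self _).trans (h.abs_rhs_le x hx)
  have h3 : ‖gradient u x‖ ^ 2 ≤ a ^ 2 := by
    have := h.norm_gradient_le x hx
    gcongr
  have h4 := sq_nonneg ‖gradient u x‖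
  have hsq : ∑ i, lam i ^ 2 = traceHessSq u x := (trace_metricInv_mul_sq hE hA).symm
  refine ⟨E, lam, i₀, ⟨hE, hA⟩, hm,
    nonneg_of_frame (isOpen_ball.mem_nhds hx) h.convex hu2 hA, hi₀,
    (trace_metricInv_mul hE hA).symm, ?_, ?_⟩
  · rw [hsq, ← heq]
    have : 1 * m ≤ (1 + ‖gradient u x‖ ^ 2) * F (position u x, (normal u x : Ambient n)) :=
      mul_le_mul (by linarith) h1 hm.le (by linarith)
    linarith
  · rw [hsq, ← heq]
    have : (1 + ‖gradient u x‖ ^ 2) * F (position u x, (normal u x : Ambient n))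
        ≤ (1 + a ^ 2) * b :=
      mul_le_mul (by linarith) h2 (hm.le.trans h1) (by positivity)
    linarith

end ControlledSolution

/-- The weight `½ |∇u|² + K (⟨x - x₀, ∇u⟩ - u)`. -/
def weight (K : ℝ) (x₀ : Base n) (u : Base n → ℝ) (x : Base n) : ℝ :=
  1 / 2 * inner ℝ (gradient u x) (gradient u x) + K * (inner ℝ (x - x₀) (gradient u x) - u x)

/-- The cutoff function `R² - |x - x₀|²`. -/
def cutoff (R : ℝ) (x₀ x : Base n) : ℝ := R ^ 2 - inner ℝ (x - x₀) (x - x₀)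

section

variable {u : Base n → ℝ} {x x₀ : Base n} {E : Matrix (Fin n) (Fin n) ℝ} {lam : Fin n → ℝ}
  {K R : ℝ}

theorem abs_weight_le {a : ℝ} (hK : 0 ≤ K) (hR : ‖x - x₀‖ ≤ R) (hu : |u x| ≤ a)
    (hg : ‖gradient u x‖ ≤ a) : |weight K x₀ u x| ≤ 1 / 2 * a ^ 2 + K * (R * a + a) := by
  have h1 : ‖gradient u x‖ ^ 2 ≤ a ^ 2 := by gcongr
  have h2 : |inner ℝ (x - x₀) (gradient u x)| ≤ R * a :=
    (abs_real_inner_le_norm _ _).trans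
      (mul_le_mul hR hg (norm_nonneg _) ((norm_nonneg _).trans hR))
  have h3 : |inner ℝ (x - x₀) (gradient u x) - u x| ≤ R * a + a :=
    (abs_sub _ _).trans (add_le_add h2 hu)
  rw [weight, real_inner_self_eq_norm_sq]
  refine (abs_add_le _ _).trans (add_le_add ?_ ?_)
  · rw [abs_of_nonneg (by positivity)]; linarith
  · rw [abs_mul, abs_of_nonneg hK]; gcongr

theorem continuousAt_gradient (hu : ContDiffAt ℝ 4 u x) : ContinuousAt (gradient u) x := by
  have : gradient u = fun y => ∑ α, gradVec u y α • coordVec α := funext (FrameAt.gradient_eq_sum u)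
  rw [this]
  exact tendsto_finsetSum _ fun α _ =>
    (contDiffAt_gradVec hu α).continuousAt.smul continuousAt_const

theorem continuousAt_weight (hu : ContDiffAt ℝ 4 u x) : ContinuousAt (weight K x₀ u) x := by
  have h1 := continuousAt_gradient hu
  have h2 := hu.continuousAt
  unfold weight
  fun_prop

theorem continuous_cutoff (R : ℝ) (x₀ : Base n) : Continuous (cutoff R x₀) := by
  unfold cutoff
  fun_prop

theorem jet_cutoff (R : ℝ) (x₀ x v : Base n) :
    HasJet (fun t : ℝ => cutoff R x₀ (x + t • v)) (cutoff R x₀ x) (-2 * inner ℝ (x - x₀) v)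
      (-2 * ‖v‖ ^ 2) := by
  have j := (HasJet.affine x v).sub (HasJet.const x₀)
  refine ((HasJet.const (R ^ 2)).sub (j.inner_mul j)).of_eq rfl ?_ ?_
  · rw [sub_zero, real_inner_comm v]; ring
  · simp

/-- In ⟨x - x₀, ∇u⟩ - u the derivative of x cancels that of u, so the whole first derivative carries
the factor λₖ. Without this factor the critical point equation would not decouple large and small
directions. -/
theorem FrameAt.jet_weight (h : FrameAt u x E lam) (hu : ContDiffAt ℝ 4 u x) (K : ℝ)
    (x₀ : Base n) (k : Fin n) :
    HasJet (fun t : ℝ => weight K x₀ u (x + t • frameVec E k)) (weight K x₀ u x)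
      (lam k * inner ℝ (gradient u x + K • (x - x₀)) (frameVec (metricMat (gradVec u x) * E) k))
      (lam k ^ 2 * ‖frameVec (metricMat (gradVec u x) * E) k‖ ^ 2
        + ∑ m, dd (frameVec E k) (dd (frameVec E k) (dd (frameVec E m) u)) x
          * inner ℝ (gradient u x + K • (x - x₀)) (frameVec (metricMat (gradVec u x) * E) m)
        + K * lam k) := by
  have hu2 : ContDiffAt ℝ 2 u x := hu.of_le (by norm_num)
  have jG := h.jet_gradient hu k
  have jy := (HasJet.affine x (frameVec E k)).sub (HasJet.const x₀)
  have ju := HasJet.of_contDiffAt hu2 (frameVec E k)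
  have j := ((jG.inner_mul jG).const_smul (1 / 2)).add
    (((jy.inner_mul jG).sub ju).const_smul K)
  refine j.of_eq rfl ?_ ?_
  · simp only [smul_eq_mul, sub_zero, inner_add_left, inner_smul_left, inner_smul_right,
      conj_trivial]
    rw [real_inner_comm (gradient u x) (frameVec E k), inner_gradient u x (frameVec E k),
      real_inner_comm (gradient u x) (frameVec (metricMat (gradVec u x) * E) k)]
    ring
  · have e1 : ∀ w : Base n, inner ℝ w
        (∑ m, dd (frameVec E k) (dd (frameVec E k) (dd (frameVec E m) u)) x
          • frameVec (metricMat (gradVec u x) * E) m)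
        = ∑ m, dd (frameVec E k) (dd (frameVec E k) (dd (frameVec E m) u)) x
          * inner ℝ w (frameVec (metricMat (gradVec u x) * E) m) := by
      intro w; rw [inner_sum]; exact sum_congr rfl fun m _ => inner_smul_right _ _ _
    rw [← e1, real_inner_comm (gradient u x) (∑ m, _ • _), inner_add_left, h.dd_dd hu2, if_pos rfl]
    simp only [smul_eq_mul, sub_zero, inner_smul_left, inner_smul_right, inner_zero_left,
      conj_trivial, h.inner_dual, real_inner_self_eq_norm_sq]
    ring

end

end CurvEst

end

/-! ### The test function, its interior maximum, and the estimate. -/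

noncomputable section

namespace CurvEst

open Finset Matrix Filter Topology

variable {n : ℕ}

/-- The logarithm of the test function. -/
def logTest (β K R : ℝ) (x₀ : Base n) (u : Base n → ℝ) (x : Base n) : ℝ :=
  2 * Real.log (cutoff R x₀ x) + β * weight K x₀ u x + Real.log (Real.log (traceHess u x))

theorem norm_sq_le_of_cutoff_nonneg {R : ℝ} {x₀ x : Base n} (hR : 0 ≤ R)
    (h : 0 ≤ cutoff R x₀ x) : ‖x - x₀‖ ≤ R := by
  rw [cutoff, real_inner_self_eq_norm_sq] at h
  exact (sq_le_sq₀ (norm_nonneg _) hR).mp (by linarith)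

namespace ControlledSolution

/-- The constants are independent of β, so that β can be chosen afterwards in terms of them. -/
theorem exists_maxData (hn : 0 < n) {a b m R K : ℝ} (hm : 0 < m) (ha : 0 ≤ a) (hb : 0 ≤ b)
    (hR : 0 < R) (hK : 2 * a * R + 2 ≤ K * R ^ 2) :
    ∃ C H₀ : ℝ, 0 < C ∧ 1 ≤ H₀ ∧ ∀ (r : ℝ) (u : Base n → ℝ) (F : Ambient n × Ambient n → ℝ)
      (x₀ x : Base n) (β : ℝ), ControlledSolution r a b m u F → x ∈ ball (0 : Base n) r →
      0 < cutoff R x₀ x → 1 < Real.log (traceHess u x) → H₀ ≤ traceHess u x →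
      IsLocalMax (logTest β K R x₀ u) x →
      ∃ (lam : Fin n → ℝ) (i₀ : Fin n) (y Q v e h₁ h₂ Φ₂ : Fin n → ℝ),
        MaxData m (m + (1 + a ^ 2) * b) C R 1 β lam i₀ (traceHess u x) (cutoff R x₀ x)
          y Q v e h₁ h₂ Φ₂ := by
  have hK0 : 0 < K := by
    have : 0 < K * R ^ 2 := lt_of_lt_of_le (by positivity) hK
    exact pos_of_mul_pos_left this (by positivity)
  set M := m + (1 + a ^ 2) * b with hM
  have hmM : m ≤ M := by
    have : 0 ≤ (1 + a ^ 2) * b := by positivity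
    linarith
  have hM0 : 0 < M := hm.trans_le hmM
  set C₀ := 10 * b * (1 + a) ^ 4 with hC₀
  have hC₀0 : 0 ≤ C₀ := by positivity
  set q := (a + K * R) * (1 + a) with hq
  have hq0 : 0 ≤ q := by positivity
  obtain ⟨C', H₀, hC', hH₀, hjac⟩ := jacobi_of_equationJet (ι := Fin n) hm hmM hC₀0
  have hnqC : 0 ≤ n * (q * C₀) := by positivity
  -- One summand for each use: the Jacobi inequality, |Q|, |v|, and the inhomogeneous part of the
  -- linearized equation.
  refine ⟨C' + q + (C₀ + 4 * M) + n * (q * C₀), H₀, by positivity, hH₀, ?_⟩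
  intro r u F x₀ x β h hx hρ hlog hH hmax
  obtain ⟨E, lam, i₀, hE, hS⟩ := h.exists_spectrum hn hm hx
  have hu := h.contDiffAt x hx
  have hW := areaElt_pos u x
  have hga := h.norm_gradient_le x hx
  obtain ⟨u₄, b₁, b₂, α, c, s, hJ, jH⟩ := hE.exists_equationJet (b := b) hu hS.nonneg hga
    (inv_pos.mpr hW).le (inv_le_one_of_one_le₀ (one_le_areaElt u x))
    (by rw [← normal_eq]; exact h.contDiffAt_rhs x hx)
    (by rw [← normal_eq]; exact h.abs_rhs_le x hx)
    (by rw [← normal_eq]; exact h.norm_fderiv_le x hx)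
    (by rw [← normal_eq]; exact h.norm_fderiv_fderiv_le x hx)
    (by
      filter_upwards [isOpen_ball.mem_nhds hx] with y hy
      exact h.equation y hy _ (inv_pos.mpr hW))
  rw [hS.sum_eq] at hJ jH
  rw [← hC₀] at hJ
  set H := traceHess u x with hHdef
  set ρ := cutoff R x₀ x with hρdef
  set e := frameVec E with he
  set g := frameVec (metricMat (gradVec u x) * E) with hg
  set Q : Fin n → ℝ := fun k => inner ℝ (gradient u x + K • (x - x₀)) (g k) with hQ
  set y : Fin n → ℝ := fun k => inner ℝ (x - x₀) (e k) with hy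
  set Φ₂ : Fin n → ℝ := fun k => lam k ^ 2 * ‖g k‖ ^ 2
    + ∑ m, dd (e k) (dd (e k) (dd (e m) u)) x * Q m + K * lam k with hΦ₂
  set v : Fin n → ℝ := fun k => c k + 2 * ((H - lam k) * lam k) * dd (e k) u x with hv
  have hHpos : 0 < H := hS.H_pos
  have hyR : ‖x - x₀‖ ≤ R := norm_sq_le_of_cutoff_nonneg hR.le hρ.le
  have hQ_le : ∀ k, |Q k| ≤ q := by
    intro k
    have h1 : ‖gradient u x + K • (x - x₀)‖ ≤ a + K * R := by
      refine (norm_add_le _ _).trans (add_le_add hga ?_)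
      rw [norm_smul, Real.norm_of_nonneg hK0.le]
      gcongr
    exact (abs_real_inner_le_norm _ _).trans
      (mul_le_mul h1 ((hE.norm_dual_le k).trans (by linarith)) (norm_nonneg _) (by positivity))
  have hcrit : ∀ k, (∑ i, b₁ k i i) / H / Real.log H = 4 * y k / ρ - β * (lam k * Q k) ∧
      -4 * ‖e k‖ ^ 2 / ρ - 8 * y k ^ 2 / ρ ^ 2 + β * Φ₂ k
        + (((∑ i, b₂ k i) / H - ((∑ i, b₁ k i i) / H) ^ 2) / Real.log H
          - ((∑ i, b₁ k i i) / H) ^ 2 / Real.log H ^ 2) ≤ 0 := by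
    intro k
    have jP := ((((jet_cutoff R x₀ x (e k)).log hρ.ne').const_smul 2).add
      ((hE.jet_weight hu K x₀ k).const_smul β)).add
      (((jH k).log hHpos.ne').log (zero_lt_one.trans hlog).ne')
    have hcont : ContinuousAt (fun t : ℝ => x + t • e k) 0 := by fun_prop
    have hloc : IsLocalMax (fun t : ℝ => logTest β K R x₀ u (x + t • e k)) 0 := by
      have h0 : IsLocalMax (logTest β K R x₀ u) ((fun t : ℝ => x + t • e k) 0) := by
        simpa using hmax
      exact h0.comp_continuous (g := fun t : ℝ => x + t • e k) hcont
    obtain ⟨h1, h2⟩ := jP.isLocalMax hloc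
    simp only [smul_eq_mul] at h1 h2
    change 2 * (-2 * y k / ρ) + β * (lam k * Q k) + _ = 0 at h1
    change 2 * (-2 * ‖e k‖ ^ 2 / ρ - (-2 * y k / ρ) ^ 2) + β * Φ₂ k + _ ≤ 0 at h2
    refine ⟨?_, ?_⟩
    · have : 4 * y k / ρ = -(2 * (-2 * y k / ρ)) := by ring
      linarith
    · refine le_trans (le_of_eq ?_) h2
      simp only [div_pow]
      ring
  have hF0 := hS.F_nonneg
  have he_le : ∀ k, ‖e k‖ ≤ 1 := hE.norm_le
  have hQα : -(n * (q * C₀)) ≤ ∑ k, Q k * α k := by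
    have h1 : ∀ k ∈ (univ : Finset (Fin n)), -(q * C₀) ≤ Q k * α k := by
      intro k _
      refine (neg_le_neg ?_).trans (neg_abs_le _)
      rw [abs_mul]
      exact mul_le_mul (hQ_le k) (hJ.abs_a k) (abs_nonneg _) hq0
    refine le_trans (le_of_eq ?_) (sum_le_sum h1)
    rw [sum_const, card_univ, nsmul_eq_mul, Fintype.card_fin]; ring
  -- Third derivatives enter Σ Fₖ Φₖₖ only contracted with F, and the linearized equation eliminates
  -- them.
  have hlin : ∑ k, (H - lam k) * ∑ m, dd (e k) (dd (e k) (dd (e m) u)) x * Q m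
      = ∑ k, Q k * α k + ∑ k, v k * (lam k * Q k) := by
    have e1 : ∀ m, Q m * α m + v m * (lam m * Q m)
        = ∑ k, (H - lam k) * (dd (e k) (dd (e k) (dd (e m) u)) x * Q m) := by
      intro m
      have h1 := hJ.linearized m
      have h2 : Q m * α m + v m * (lam m * Q m)
          = (α m + (c m + 2 * ((H - lam m) * lam m) * dd (e m) u x) * lam m) * Q m := by
        rw [hv]; ring
      rw [h2, ← h1, sum_mul]
      exact sum_congr rfl fun k _ => by ring
    rw [← sum_add_distrib, sum_congr rfl fun m _ => e1 m, sum_comm]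
    exact sum_congr rfl fun k _ => by rw [mul_sum]
  refine ⟨lam, i₀, y, Q, v, fun k => ‖e k‖ ^ 2, fun k => ∑ i, b₁ k i i, fun k => ∑ i, b₂ k i, Φ₂,
    hS, hρ, ?_, ?_, ?_, ?_, ?_, ?_, hlog, ?_, fun k => (hcrit k).2, ?_, ?_⟩
  · have : 0 ≤ inner ℝ (x - x₀) (x - x₀) := real_inner_self_nonneg
    rw [hρdef, cutoff]; linarith
  · intro k
    refine (abs_real_inner_le_norm _ _).trans ?_
    calc ‖x - x₀‖ * ‖e k‖ ≤ R * 1 := mul_le_mul hyR (he_le k) (norm_nonneg _) hR.le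
      _ = R := mul_one R
  · intro k
    refine (hQ_le k).trans ?_
    linarith
  · intro k
    have h1 := hS.F_mul_le k
    have h2 : 0 ≤ (H - lam k) * lam k := mul_nonneg (hF0 k) (hS.nonneg k)
    have h3 : |c k| ≤ C₀ := hJ.abs_c k
    have h4 : |dd (e k) u x| ≤ 1 := hE.abs_dd_le k
    calc |v k| ≤ |c k| + |2 * ((H - lam k) * lam k) * dd (e k) u x| := abs_add_le _ _
      _ = |c k| + 2 * ((H - lam k) * lam k) * |dd (e k) u x| := by
        rw [abs_mul, abs_of_nonneg (by positivity : 0 ≤ 2 * ((H - lam k) * lam k))]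
      _ ≤ C₀ + 2 * (2 * M) * 1 := by gcongr
      _ ≤ _ := by linarith
  · intro k
    exact pow_le_one₀ (norm_nonneg _) (he_le k)
  -- Σ yₖQₖ = ⟨∇u + K(x - x₀), x - x₀⟩ ≥ KR²/2 - aR ≥ 1 by the choice of K.
  · intro hfar
    have e1 : ∑ k, y k * Q k = inner ℝ (gradient u x + K • (x - x₀)) (x - x₀) :=
      hE.sum_inner_mul_inner _ _
    rw [e1, inner_add_left, inner_smul_left, conj_trivial]
    have h1 : -(a * R) ≤ inner ℝ (gradient u x) (x - x₀) := by
      refine (neg_le_neg ((abs_real_inner_le_norm _ _).trans ?_)).trans (neg_abs_le _)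
      exact mul_le_mul hga hyR (norm_nonneg _) ha
    have h2 : R ^ 2 / 2 ≤ inner ℝ (x - x₀) (x - x₀) := by
      rw [hρdef, cutoff] at hfar; linarith
    have h3 := mul_le_mul_of_nonneg_left h2 hK0.le
    linarith
  · intro k
    rw [← (hcrit k).1, div_div]
  · have h1 := hjac lam i₀ H _ _ u₄ b₁ b₂ α c s hS hH hJ
    have h2 : C' * H ^ 2 ≤ (C' + q + (C₀ + 4 * M) + n * (q * C₀)) * H ^ 2 :=
      mul_le_mul_of_nonneg_right (by linarith) (by positivity)
    linarith
  · have h1 : ∑ k, (H - lam k) * Φ₂ k = ∑ k, (H - lam k) * (lam k ^ 2 * ‖g k‖ ^ 2)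
        + (∑ k, Q k * α k + ∑ k, v k * (lam k * Q k)) + ∑ k, (H - lam k) * (K * lam k) := by
      rw [← hlin, ← sum_add_distrib, ← sum_add_distrib]
      exact sum_congr rfl fun k _ => by rw [hΦ₂]; ring
    have h2 : ∑ k, (H - lam k) * lam k ^ 2 ≤ ∑ k, (H - lam k) * (lam k ^ 2 * ‖g k‖ ^ 2) := by
      refine sum_le_sum fun k _ => mul_le_mul_of_nonneg_left ?_ (hF0 k)
      exact le_mul_of_one_le_right (sq_nonneg _) (one_le_pow₀ (hE.one_le_norm_dual k))
    have h3 : 0 ≤ ∑ k, (H - lam k) * (K * lam k) :=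
      sum_nonneg fun k _ => mul_nonneg (hF0 k) (mul_nonneg hK0.le (hS.nonneg k))
    linarith

/-- The test function. -/
def test (β K R : ℝ) (x₀ : Base n) (u : Base n → ℝ) (x : Base n) : ℝ :=
  cutoff R x₀ x ^ 2 * Real.exp (β * weight K x₀ u x) * Real.log (traceHess u x)

theorem log_test {β K R : ℝ} {x₀ x : Base n} {u : Base n → ℝ} (hρ : 0 < cutoff R x₀ x)
    (hH : 0 < Real.log (traceHess u x)) :
    Real.log (test β K R x₀ u x) = logTest β K R x₀ u x := by
  rw [test, logTest, Real.log_mul (by positivity) hH.ne', Real.log_mul (by positivity)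
    (Real.exp_ne_zero _), Real.log_exp, Real.log_pow]
  norm_num

theorem test_pos {β K R : ℝ} {x₀ x : Base n} {u : Base n → ℝ} (hρ : 0 < cutoff R x₀ x)
    (hH : 0 < Real.log (traceHess u x)) : 0 < test β K R x₀ u x := by
  unfold test; positivity

variable {r a b m : ℝ} {u : Base n → ℝ} {F : Ambient n × Ambient n → ℝ}

theorem traceHess_pos (h : ControlledSolution r a b m u F) (hn : 0 < n) (hm : 0 < m) {x : Base n}
    (hx : x ∈ ball (0 : Base n) r) : 0 < traceHess u x := by
  obtain ⟨E, lam, i₀, -, hS⟩ := h.exists_spectrum hn hm hx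
  exact hS.H_pos

theorem continuousAt_log_traceHess (h : ControlledSolution r a b m u F) (hn : 0 < n) (hm : 0 < m)
    {x : Base n} (hx : x ∈ ball (0 : Base n) r) :
    ContinuousAt (fun y => Real.log (traceHess u y)) x :=
  (contDiffAt_traceHess (h.contDiffAt x hx)).continuousAt.log (h.traceHess_pos hn hm hx).ne'

/-- The test function has a positive maximum in the interior, which is a local maximum of its
logarithm. -/
theorem exists_isLocalMax_logTest (h : ControlledSolution r a b m u F) (hn : 0 < n) (hm : 0 < m)
    (β K : ℝ) {R : ℝ} (hR : 0 < R) {x₀ : Base n} (hx₀ : closedBall x₀ R ⊆ ball (0 : Base n) r)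
    (hH : 0 < Real.log (traceHess u x₀)) :
    ∃ x ∈ ball (0 : Base n) r, 0 < cutoff R x₀ x ∧ 0 < Real.log (traceHess u x) ∧
      test β K R x₀ u x₀ ≤ test β K R x₀ u x ∧ IsLocalMax (logTest β K R x₀ u) x := by
  have hcont : ContinuousOn (test β K R x₀ u) (closedBall x₀ R) := by
    intro x hx
    have hxr := hx₀ hx
    refine ContinuousAt.continuousWithinAt ?_
    exact (((continuous_cutoff R x₀).continuousAt.pow 2).mul
      (((continuousAt_weight (h.contDiffAt x hxr)).const_mul β).rexp)).mul
      (h.continuousAt_log_traceHess hn hm hxr)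
  have hmem : x₀ ∈ closedBall x₀ R := mem_closedBall_self hR.le
  obtain ⟨x, hx, hmax⟩ := (isCompact_closedBall x₀ R).exists_isMaxOn ⟨x₀, hmem⟩ hcont
  have hxr := hx₀ hx
  have hcut : ∀ y ∈ closedBall x₀ R, 0 ≤ cutoff R x₀ y := by
    intro y hy
    rw [mem_closedBall, dist_eq_norm] at hy
    rw [cutoff, real_inner_self_eq_norm_sq, sub_nonneg]
    gcongr
  have hρ₀ : 0 < cutoff R x₀ x₀ := by
    rw [cutoff, sub_self, inner_zero_left, sub_zero]; positivity
  have hle : test β K R x₀ u x₀ ≤ test β K R x₀ u x := hmax hmem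
  have hpos : 0 < test β K R x₀ u x := (test_pos hρ₀ hH).trans_le hle
  have hρ : 0 < cutoff R x₀ x := by
    refine (hcut x hx).lt_of_ne fun h0 => ?_
    rw [test, ← h0] at hpos
    simp at hpos
  have hHx : 0 < Real.log (traceHess u x) := by
    rw [test] at hpos
    exact pos_of_mul_pos_right hpos (by positivity)
  have hxb : x ∈ ball x₀ R := by
    rw [mem_ball, dist_eq_norm]
    rw [cutoff, real_inner_self_eq_norm_sq, sub_pos] at hρ
    exact (sq_lt_sq₀ (norm_nonneg _) hR.le).mp hρ
  refine ⟨x, hxr, hρ, hHx, hle, ?_⟩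
  filter_upwards [isOpen_ball.mem_nhds hxb,
    (continuous_cutoff R x₀).continuousAt.eventually_const_lt hρ,
    (h.continuousAt_log_traceHess hn hm hxr).eventually_const_lt hHx] with y h1 h2 h3
  rw [← log_test h2 h3, ← log_test hρ hHx]
  exact Real.log_le_log (test_pos h2 h3) (hmax (ball_subset_closedBall h1))

/-- The interior estimate for the trace of the Hessian. -/
theorem exists_traceHess_le (hn : 0 < n) {r a b m : ℝ} (hr : 0 < r) (ha : 0 ≤ a) (hb : 0 ≤ b)
    (hm : 0 < m) :
    ∃ C : ℝ, ∀ (u : Base n → ℝ) (F : Ambient n × Ambient n → ℝ), ControlledSolution r a b m u F →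
      ∀ x₀ ∈ closedBall (0 : Base n) (r / 2), traceHess u x₀ ≤ C := by
  -- Balls of this radius about points of the closed ball of radius r/2 stay inside the open ball of
  -- radius r.
  set R := r / 4 with hRdef
  have hR : 0 < R := by positivity
  set K := (2 * a * R + 2) / R ^ 2 with hK
  have hK0 : 0 ≤ K := by positivity
  have hKR : 2 * a * R + 2 ≤ K * R ^ 2 := by rw [hK, div_mul_cancel₀ _ (by positivity)]
  obtain ⟨C, H₀, hC, hH₀, key⟩ := exists_maxData hn hm ha hb hR hKR
  obtain ⟨β, Λ, hβ, hΛ, hbound⟩ := exists_weight (Fin n) hm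
    (by positivity : 0 < m + (1 + a ^ 2) * b) hC hR one_pos
  set N := 1 / 2 * a ^ 2 + K * (R * a + a) with hN
  -- The second entry covers maximum points where H is too small for the Jacobi inequality or log H
  -- ≤ 1.
  set L := max Λ (max 1 (Real.log H₀) * (R ^ 2) ^ 2) with hL
  refine ⟨Real.exp (L * Real.exp (β * N) * Real.exp (β * N) / (R ^ 2) ^ 2), fun u F h x₀ hx₀ => ?_⟩
  have hL0 : 0 ≤ L := hΛ.trans (le_max_left _ _)
  have hsub : closedBall x₀ R ⊆ ball (0 : Base n) r := by
    intro y hy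
    rw [mem_closedBall, dist_eq_norm] at hy
    rw [mem_closedBall_zero_iff] at hx₀
    rw [mem_ball_zero_iff]
    have := norm_add_le (y - x₀) x₀
    rw [sub_add_cancel] at this
    linarith
  have hxr : x₀ ∈ ball (0 : Base n) r := hsub (mem_closedBall_self hR.le)
  rw [← Real.log_le_iff_le_exp (h.traceHess_pos hn hm hxr), le_div_iff₀ (by positivity)]
  -- If log H(x₀) > 0 the test function is positive at x₀, which keeps its maximum off the boundary
  -- and log H positive there.
  by_cases hlog : Real.log (traceHess u x₀) ≤ 0
  · exact (mul_nonpos_of_nonpos_of_nonneg hlog (by positivity)).trans (by positivity)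
  push Not at hlog
  obtain ⟨x, hx, hρ, hHx, hle, hmax⟩ := h.exists_isLocalMax_logTest hn hm β K hR hsub hlog
  have hw : ∀ y ∈ ball (0 : Base n) r, 0 ≤ cutoff R x₀ y → |weight K x₀ u y| ≤ N :=
    fun y hy h0 => abs_weight_le hK0 (norm_sq_le_of_cutoff_nonneg hR.le h0) (h.abs_le y hy)
      (h.norm_gradient_le y hy)
  have hρ₀ : cutoff R x₀ x₀ = R ^ 2 := by
    rw [cutoff, sub_self, inner_zero_left, sub_zero]
  have hρR : cutoff R x₀ x ≤ R ^ 2 := by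
    have : 0 ≤ inner ℝ (x - x₀) (x - x₀) := real_inner_self_nonneg
    rw [cutoff]; linarith
  have hmain : cutoff R x₀ x ^ 2 * Real.log (traceHess u x) ≤ L := by
    by_cases hbig : 1 < Real.log (traceHess u x) ∧ H₀ ≤ traceHess u x
    · obtain ⟨lam, i₀, y, Q, v, e, h₁, h₂, Φ₂, hD⟩ :=
        key r u F x₀ x β h hx hρ hbig.1 hbig.2 hmax
      rw [mul_comm]
      exact (hbound _ _ _ _ _ _ _ _ _ _ _ hD).trans (le_max_left _ _)
    · have h1 : Real.log (traceHess u x) ≤ max 1 (Real.log H₀) := by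
        rw [not_and_or, not_lt, not_le] at hbig
        rcases hbig with h1 | h1
        · exact h1.trans (le_max_left _ _)
        · exact (Real.log_le_log (h.traceHess_pos hn hm hx) h1.le).trans (le_max_right _ _)
      refine le_trans ?_ (le_max_right _ _)
      rw [mul_comm]
      gcongr
  have e1 : Real.exp (β * weight K x₀ u x) ≤ Real.exp (β * N) := by
    have := (_root_.abs_le.mp (hw x hx hρ.le)).2
    gcongr
  have e2 : 1 ≤ Real.exp (β * weight K x₀ u x₀) * Real.exp (β * N) := by
    rw [← Real.exp_add, ← mul_add]
    refine Real.one_le_exp (mul_nonneg hβ.le ?_)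
    have := (_root_.abs_le.mp (hw x₀ hxr (by rw [hρ₀]; positivity))).1
    linarith
  rw [test, test, hρ₀] at hle
  calc Real.log (traceHess u x₀) * (R ^ 2) ^ 2
      ≤ Real.log (traceHess u x₀) * (R ^ 2) ^ 2
          * (Real.exp (β * weight K x₀ u x₀) * Real.exp (β * N)) :=
        le_mul_of_one_le_right (by positivity) e2
    _ = ((R ^ 2) ^ 2 * Real.exp (β * weight K x₀ u x₀) * Real.log (traceHess u x₀))
          * Real.exp (β * N) := by ring
    _ ≤ (cutoff R x₀ x ^ 2 * Real.exp (β * weight K x₀ u x) * Real.log (traceHess u x))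
          * Real.exp (β * N) := by gcongr
    _ = (cutoff R x₀ x ^ 2 * Real.log (traceHess u x)) * Real.exp (β * weight K x₀ u x)
          * Real.exp (β * N) := by ring
    _ ≤ L * Real.exp (β * N) * Real.exp (β * N) := by gcongr

end ControlledSolution

end CurvEst

end

/-- Interior curvature estimate for convex graphs of prescribed scalar curvature. -/
theorem theorem2 (n : ℕ) (hn : 2 ≤ n) (r : ℝ) (hr : 0 < r) (a b c : ℝ≥0) :
    ∃ C : ℝ, ∀ (u : CurvEst.Base n → ℝ) (f : CurvEst.Ambient n → CurvEst.UnitSphere n → ℝ),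
      ContDiffOn ℝ 4 u (ball 0 r) →
      ConvexOn ℝ (ball 0 r) u →
      CurvEst.IsC2 r f →
      CurvEst.SolvesScalarCurvatureEq r u f →
      CurvEst.normC1 r u ≤ a →
      CurvEst.normC2 r u f ≤ b →
      CurvEst.normInv r u f ≤ c →
      ∀ x ∈ closedBall (0 : CurvEst.Base n) (r / 2),
        ∀ κ ∈ CurvEst.principalCurvatures u x, |κ| ≤ C := by
  -- The lower bound 1/(c + 1) for f is positive even for c = 0, and C is fixed before u and f.
  obtain ⟨C, hC⟩ := CurvEst.ControlledSolution.exists_traceHess_le (n := n) (by lia) hr a.coe_nonneg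
    b.coe_nonneg (by positivity : (0 : ℝ) < 1 / (c + 1))
  refine ⟨C, fun u f hu hconv hf heq ha hb hc x hx κ hκ => ?_⟩
  have hx' : x ∈ ball (0 : CurvEst.Base n) r := closedBall_subset_ball (by linarith) hx
  have hnhds := isOpen_ball.mem_nhds hx'
  exact (CurvEst.abs_principalCurvature_le hnhds hconv
    ((hu.contDiffAt hnhds).of_le (by norm_num)) hκ).trans
    (hC u _ (CurvEst.controlledSolution_of_norms hu hconv hf heq ha hb hc) x hx)
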